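/- **Setting.** For $n\ge 1$ and $G,J\in\mathbb R^{n\times n}$ let $$\mathrm Q(G,J)=\frac1{n^2}\max_{\rho}\sum_{i,j=1}^n J_{i,j}\,G_{\rho(i),\rho(j)},\qquad \mathrm{AC}(G)=\frac1{n^2}\max_\rho\sum_{i,j=1}^n G_{i,j}\,\mathbb 1_{\{\rho(j)\ge\rho(i)\}},$$ where $\rho$ runs over all permutations of $[n]$ (quadratic assignment problem and maximum acyclic subgraph density). For bounded measurable $W,J:[0,1]^2\to\mathbb R$ let $$\mathrm Q(W,J)=\max_\mu\int_{[0,1]^2}J(i,j)\Big(\int\!\!\int W(x,y)\,d\mu(i,x)\,d\mu(j,y)\Big)\,di\,dj ,$$ where $\mu$ runs over all fractional permutations, i.e. probability kernels $\mu$ on $[0,1]$ with $\int_0^1\mu(x,A)\,dx=\lambda(A)$ for all measurable $A$; and let $\mathrm{AC}(W)=\mathrm Q(W,\mathbb 1_{\{x\le y\}})$. For $G\in\mathbb R^{n\times n}$ let $W_G$ be the associated step function on $[0,1]^2$, with value $G_{i,j}$ on the $(i,j)$-th of $n^2$ congruent squares. An array or kernel $J$ on an index set $V$ ($V=[n]$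 or $V=[0,1]$) is *$d$-dimensional geometric* if there are $p\in[1,\infty]$ and $e:V\to\mathbb R^d$ with $J(i,j)=\|e(i)-e(j)\|_p$ for all $i,j\in V$. For $k\le n$, $\mathbb G(k,G)$ is the subarray of $G$ induced by a uniformly random sequence of $k$ distinct indices; $\mathbb G(k,W)=(W(U_i,U_j))_{i,j\le k}$ with $U_1,\dots,U_k$ independent and uniform on $[0,1]$; $\mathbb G'$ denotes an independent copy of the sampling process. $\|\cdot\|_\infty$ is the supremum of the absolute value. **Statement.** (1) *The $d$-dimensional geometric QAP is efficiently testable.* For every $d$ there is a measurable $\beta:(0,\infty)\to\mathbb N$, depending only on $d$, with $\beta(\varepsilon)=O\big(\log(1/\varepsilon)\,\varepsilon^{-(2d+4)}\big)$ as $\varepsilon\to0$, such that for all $\varepsilon>0$ and all $k\ge\beta(\varepsilon)$: - (continuous problem) for all bounded measurable $W,J:[0,1]^2\to\mathbb R$ with $J$ $d$-dimensional geometric, $$\mathbb P\big(|\mathrm Q(W,J)-\mathrm Q(\mathbb G(k,W),\mathbb G'(k,J))|>\varepsilon\|W\|_\infty\|J\|_\infty\big)<\varepsilon;$$ - (discrete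 problem) for all $n\ge k$ and $G,J\in\mathbb R^{n\times n}$ with $J$ $d$-dimensional geometric, $$\mathbb P\big(|\mathrm Q(G,J)-\mathrm Q(\mathbb G(k,G),\mathbb G'(k,J))|>\varepsilon\|G\|_\infty\|J\|_\infty\big)<\varepsilon;$$ - (as a parameter with fixed $J$) for every bounded measurable $d$-dimensional geometric $J:[0,1]^2\to\mathbb R$, the graph parameter $f(G)=\mathrm Q(W_G,J)$ and the graphon parameter $f(W)=\mathrm Q(W,J)$ satisfy $$\mathbb P\big(|f(G)-f(\mathbb G(k,G))|>\varepsilon\|G\|_\infty\|J\|_\infty\big)<\varepsilon,\qquad \mathbb P\big(|f(W)-f(\mathbb G(k,W))|>\varepsilon\|W\|_\infty\|J\|_\infty\big)<\varepsilon$$ for all $G\in\mathbb R^{n\times n}$ with $n\ge k$ and all bounded measurable $W:[0,1]^2\to\mathbb R$. (2) *The maximum acyclic subgraph problem is efficiently testable.* There is a measurable $\beta:(0,\infty)\to\mathbb N$ with $\beta(\varepsilon)=O\big(\log(1/\varepsilon)\,\varepsilon^{-6}\big)$ as $\varepsilon\to0$, such that for all $\varepsilon>0$ and all $k\ge\beta(\varepsilon)$,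 $$\mathbb P\big(|\mathrm{AC}(G)-\mathrm{AC}(\mathbb G(k,G))|>\varepsilon\|G\|_\infty\big)<\varepsilon,\qquad \mathbb P\big(|\mathrm{AC}(W)-\mathrm{AC}(\mathbb G(k,W))|>\varepsilon\|W\|_\infty\big)<\varepsilon$$ for all $G\in\mathbb R^{n\times n}$ with $n\ge k$ and all bounded measurable $W:[0,1]^2\to\mathbb R$. -/

import Mathlib

open MeasureTheory ProbabilityTheory Filter Asymptotics Topology

noncomputable section

namespace GeomQAP

/-- The restriction of a `2`-array `A` on `V` to a sequence `s` of elements of `V`. With `s` a random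
injection into the vertex set this is the sampled graph `𝔾(k, G)`; with `s` an i.i.d. uniform sequence
in `[0,1]` it is the sampled graph `𝔾(k, W)`. -/
def induced {V ι : Type} (A : V → V → ℝ) (s : ι → V) : ι → ι → ℝ :=
  fun i j => A (s i) (s j)

/-- Finite quadratic assignment problem: `n⁻² max_ρ ∑ J i j * G (ρ i) (ρ j)` over permutations `ρ`. -/
def qap {n : ℕ} (G J : Fin n → Fin n → ℝ) : ℝ :=
  (1 / (n : ℝ) ^ 2) * ⨆ ρ : Equiv.Perm (Fin n), ∑ i, ∑ j, J i j * G (ρ i) (ρ j)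

/-- Maximum acyclic subgraph density: `n⁻² max_ρ ∑ G i j 𝟙[ρ j ≥ ρ i]` over permutations `ρ`. -/
def mas (n : ℕ) (G : Fin n → Fin n → ℝ) : ℝ :=
  (1 / (n : ℝ) ^ 2) *
    ⨆ ρ : Equiv.Perm (Fin n), ∑ i, ∑ j, G i j * (if ρ i ≤ ρ j then 1 else 0)

/-- A fractional permutation of `[0,1]`: a probability kernel that preserves Lebesgue measure. -/
def IsFracPerm (μ : Kernel unitInterval unitInterval) : Prop :=
  IsMarkovKernel μ ∧ ∀ A : Set unitInterval, MeasurableSet A → ∫⁻ x, μ x A = volume A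

/-- The value `Q_μ(W, J)` of a fractional permutation. -/
def contQapAt (μ : Kernel unitInterval unitInterval) (W J : unitInterval → unitInterval → ℝ) : ℝ :=
  ∫ i, ∫ j, J i j * ∫ x, ∫ y, W x y ∂(μ j) ∂(μ i)

/-- The continuous quadratic assignment problem `Q(W, J)`, the maximum of `Q_μ(W, J)` over
fractional permutations `μ`. -/
def contQap (W J : unitInterval → unitInterval → ℝ) : ℝ :=
  ⨆ μ : {μ : Kernel unitInterval unitInterval // IsFracPerm μ}, contQapAt μ.1 W J

/-- The continuous maximum acyclic subgraph problem `AC(W)`: the continuous quadratic assignment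
problem whose second argument is the upper triangular kernel. -/
def contMas (W : unitInterval → unitInterval → ℝ) : ℝ :=
  contQap W (fun x y => if x ≤ y then 1 else 0)

/-- The step function `W_G` on `[0,1]²` of an array `G`: it equals `G i j` on
`[i/n, (i+1)/n) × [j/n, (j+1)/n)` for `0 ≤ i, j < n` (and `0` on the remaining null set). -/
def stepGraphon {n : ℕ} (G : Fin n → Fin n → ℝ) : unitInterval → unitInterval → ℝ := fun x y =>
  ∑ i : Fin n, ∑ j : Fin n,
    if ⌊(n : ℝ) * (x : ℝ)⌋ = ((i : ℕ) : ℤ) ∧ ⌊(n : ℝ) * (y : ℝ)⌋ = ((j : ℕ) : ℤ) then G i j else 0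

/-- The quadratic assignment problem with a fixed kernel `J` as a graph parameter, `G ↦ Q(W_G, J)`. -/
def fixedQap (J : unitInterval → unitInterval → ℝ) (n : ℕ) (G : Fin n → Fin n → ℝ) : ℝ :=
  contQap (stepGraphon G) J

/-- `J` is a `d`-dimensional geometric distance array: its index set can be mapped to `ℝ^d` with
some `ℓ^p` metric, `1 ≤ p ≤ ∞`, such that the distances of the images are the entries of `J`. -/
def IsGeometric (d : ℕ) {V : Type} (J : V → V → ℝ) : Prop :=
  ∃ (p : ENNReal) (_ : Fact (1 ≤ p)) (e : V → PiLp p (fun _ : Fin d => ℝ)),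
    ∀ i j, J i j = dist (e i) (e j)

/-- Probability of the event `A` under the uniform distribution on the finite type `Ω`. -/
def unifProb {Ω : Type} [Finite Ω] (A : Set Ω) : ℝ :=
  (A.ncard : ℝ) / (Nat.card Ω : ℝ)

/-- `β`-testability of a graph parameter `f` on real-valued directed graphs, with the error measured
in units of `c * ‖G‖∞` (here `‖G‖` is the largest absolute value of an entry of `G`). A uniformly
random injection selects `k` vertices without replacement. -/
def IsGraphTestable (β : ℝ → ℕ) (c : ℝ) (f : (n : ℕ) → (Fin n → Fin n → ℝ) → ℝ) : Prop :=
  ∀ ε : ℝ, 0 < ε → ∀ k n : ℕ, β ε ≤ k → k ≤ n → ∀ G : Fin n → Fin n → ℝ,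
    unifProb {σ : Fin k ↪ Fin n | ε * c * ‖G‖ < |f n G - f k (induced G σ)|} < ε

/-- `β`-testability of a graphon parameter `F`, whose value on finite graphs is `f`, with the error
measured in units of `c * M`, where `M` bounds the graphon. -/
def IsGraphonTestable (β : ℝ → ℕ) (c : ℝ) (F : (unitInterval → unitInterval → ℝ) → ℝ)
    (f : (n : ℕ) → (Fin n → Fin n → ℝ) → ℝ) : Prop :=
  ∀ ε : ℝ, 0 < ε → ∀ k : ℕ, β ε ≤ k → ∀ (W : unitInterval → unitInterval → ℝ) (M : ℝ),
    Measurable (Function.uncurry W) → (∀ x y, |W x y| ≤ M) →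
    volume {U : Fin k → unitInterval | ε * c * M < |F W - f k (induced W U)|} < ENNReal.ofReal ε

/-- `β`-testability of the finite quadratic assignment problem over `d`-dimensional geometric
arrays `J`: both `G` and `J` are sampled, independently of each other. -/
def IsDiscreteQapTestable (β : ℝ → ℕ) (d : ℕ) : Prop :=
  ∀ ε : ℝ, 0 < ε → ∀ k n : ℕ, β ε ≤ k → k ≤ n → ∀ G J : Fin n → Fin n → ℝ, IsGeometric d J →
    unifProb {s : (Fin k ↪ Fin n) × (Fin k ↪ Fin n) |
      ε * ‖J‖ * ‖G‖ < |qap G J - qap (induced G s.1) (induced J s.2)|} < ε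

/-- `β`-testability of the continuous quadratic assignment problem over `d`-dimensional geometric
kernels `J`: both `W` and `J` are sampled, independently of each other. -/
def IsContQapTestable (β : ℝ → ℕ) (d : ℕ) : Prop :=
  ∀ ε : ℝ, 0 < ε → ∀ k : ℕ, β ε ≤ k → ∀ (W J : unitInterval → unitInterval → ℝ) (M N : ℝ),
    Measurable (Function.uncurry W) → (∀ x y, |W x y| ≤ M) →
    Measurable (Function.uncurry J) → (∀ x y, |J x y| ≤ N) → IsGeometric d J →
    volume {s : (Fin k → unitInterval) × (Fin k → unitInterval) |
      ε * N * M < |contQap W J - qap (induced W s.1) (induced J s.2)|} < ENNReal.ofReal ε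

/-- The sample size function `β` is (measurable and) `O(log(1/ε) ε^{-e})` as `ε → 0⁺`. -/
def HasRate (β : ℝ → ℕ) (e : ℕ) : Prop :=
  Measurable β ∧
    (fun ε : ℝ => (β ε : ℝ)) =O[𝓝[>] 0] (fun ε : ℝ => Real.log (1 / ε) * (1 / ε) ^ e)

end GeomQAP

end

/-! Normalize so that all entries lie in [-1,1]. A geometric `J` is within `x` of a block array `D
(l i) (l j)` with q = O(x^(-d)) labels, because its points lie in a box of bounded size
(`exists_labels`). For a block array an assignment matters only through the labelling it induces on
the vertices of `G`. So the QAP becomes: maximize the average of `D (a i) (a j) * G i j` over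
labellings `a` with prescribed label fractions `c`. This constraint is replaced by the penalty 4 Σ_b
|marg b - c b|. Relabelling a proportion m of the vertices changes the form by at most 4m, so
violating the constraint cannot pay. The resulting free problem is `partOpt`. It approximates the
discrete QAP (`abs_qap_sub_partOpt_le`) and the continuous one (`abs_contQap_cellGraphon_sub_le`).
In the continuous case fractional permutations correspond to fractional labellings, and randomized
rounding makes these integral.

The core is that `partOpt` is testable (`unifProb_partOpt_le`). In one direction, an optimal
labelling of `G` restricted to a random sample has nearly the same value
(`partOpt_le_expect_partOpt`). The other direction (`expect_partOpt_le`) must show that no labelling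
of the sample does much better than the best one of `G`, although there are exponentially many
labellings. It combines guessing with duality: - The labels of m ≈ q/x² random points determine, up
to a small error, the linear field that a labelling creates at every vertex. Given this guess, the
quadratic problem is a linear program. - For each of the q^m guesses, a minimax theorem gives
multipliers for `G` certifying that the Lagrangian dual is at most `partOpt` plus the rounding error
(`exists_dual_le`). - The same multipliers give an upper bound on the sample. This sampled dual is
concentrated by bounded differences, so a union bound over q^m guesses on m(L+1) points costs about
sqrt(log q / L). Hence L ≈ (1 + log q)/x² suffices. - In the sample itself, the guess made by an
optimal labelling is accurate on average when one point is picked at random from each of m blocks of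
L+1 points (`partOpt_le_expect_sampleDual`).

This controls expectations for samples of K ≈ q(1 + log q)/x⁴ points. For k ≥ K/x, the values of `G`
and of a k-vertex sample are both near the mean over K-point samples. Repeated points are then
negligible, and a variance bound upgrades expectation to probability. Graphons are handled by step
functions with so many cells that sampling cells with or without replacement is nearly the same.

When `J` is sampled too, its label fractions must concentrate, which costs q²/x⁴ points. With q ≈
x^(-d) and d ≥ 1, this q²/x⁴ and the log(1/x) x^(-d-5) of the core are both O(log(1/x) x^(-2d-4)).
The acyclic subgraph problem is the case of the triangular kernel, which is L¹-close to a block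
kernel with 1/x interval labels, so it has the rate of d = 1. -/

noncomputable section

namespace GeomQAP

open scoped BigOperators

set_option linter.unusedSectionVars false

/-! ### Finite product measures: second moments, bounded differences, expected maxima. -/

section ProductExpectation

variable {ι β : Type*} [Fintype ι] [DecidableEq ι] [Fintype β]

/-- Expectation of `f` under the product of the weights `p i` on `β`. -/
def pexp (p : ι → β → ℝ) (f : (ι → β) → ℝ) : ℝ := ∑ w, (∏ i, p i (w i)) * f w

/-- Each `p i` is a probability vector. -/
structure IsProb {ι β : Type*} [Fintype β] (p : ι → β → ℝ) : Prop where
  nonneg : ∀ i b, 0 ≤ p i b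
  sum_eq : ∀ i, ∑ b, p i b = 1

variable {p : ι → β → ℝ}

lemma pexp_const (hp : IsProb p) (c : ℝ) : pexp p (fun _ => c) = c := by
  unfold pexp
  rw [← Finset.sum_mul]
  have h := Finset.prod_univ_sum (fun _ : ι => (Finset.univ : Finset β)) p
  simp only [hp.sum_eq, Finset.prod_const_one, Fintype.piFinset_univ] at h
  rw [← h, one_mul]

lemma pexp_add (f g : (ι → β) → ℝ) : pexp p (fun w => f w + g w) = pexp p f + pexp p g := by
  simp [pexp, mul_add, Finset.sum_add_distrib]

lemma pexp_sub (f g : (ι → β) → ℝ) : pexp p (fun w => f w - g w) = pexp p f - pexp p g := by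
  simp [pexp, mul_sub, Finset.sum_sub_distrib]

lemma pexp_mul_left (c : ℝ) (f : (ι → β) → ℝ) : pexp p (fun w => c * f w) = c * pexp p f := by
  simp only [pexp, Finset.mul_sum]
  exact Finset.sum_congr rfl fun w _ => by ring

lemma pexp_sum {κ : Type*} (s : Finset κ) (f : κ → (ι → β) → ℝ) :
    pexp p (fun w => ∑ k ∈ s, f k w) = ∑ k ∈ s, pexp p (f k) := by
  simp only [pexp, Finset.mul_sum]
  exact Finset.sum_comm

lemma pexp_mono (hp : IsProb p) {f g : (ι → β) → ℝ} (h : ∀ w, f w ≤ g w) :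
    pexp p f ≤ pexp p g :=
  Finset.sum_le_sum fun w _ =>
    mul_le_mul_of_nonneg_left (h w) (Finset.prod_nonneg fun i _ => hp.nonneg i _)

lemma exists_pexp_le (hp : IsProb p) (f : (ι → β) → ℝ) : ∃ w, pexp p f ≤ f w := by
  by_contra! h
  have hne : Nonempty (ι → β) := by
    by_contra hemp
    rw [not_nonempty_iff] at hemp
    have := pexp_const hp 1
    simp [pexp] at this
  obtain ⟨w₀, hw₀⟩ := Finite.exists_max f
  have h1 : pexp p f ≤ f w₀ := (pexp_mono hp hw₀).trans (pexp_const hp _).le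
  exact absurd (h w₀) (not_lt.mpr h1)

/-- Average of `f` over the `i`-th coordinate. -/
def resample (p : ι → β → ℝ) (i : ι) (f : (ι → β) → ℝ) (w : ι → β) : ℝ :=
  ∑ v, p i v * f (Function.update w i v)

/-- Exchanging the `i`-th coordinate of `w` with an independent copy `v` is a weight-preserving
involution on pairs `(w, v)`. -/
lemma pexp_resample (hp : IsProb p) (i : ι) (f : (ι → β) → ℝ) :
    pexp p (resample p i f) = pexp p f := by
  have key : ∑ x : (ι → β) × β, (∏ j, p j (x.1 j)) * p i x.2 * f (Function.update x.1 i x.2)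
      = ∑ x : (ι → β) × β, (∏ j, p j (x.1 j)) * p i x.2 * f x.1 := by
    refine Finset.sum_nbij' (fun x => (Function.update x.1 i x.2, x.1 i))
      (fun x => (Function.update x.1 i x.2, x.1 i)) (by simp) (by simp) (by simp) (by simp) ?_
    rintro ⟨w, v⟩ -
    have h1 : ∀ (u : ι → β), ∏ j, p j (u j) = p i (u i) * ∏ j ∈ Finset.univ.erase i, p j (u j) :=
      fun u => (Finset.mul_prod_erase _ _ (Finset.mem_univ i)).symm
    have h2 : ∏ j ∈ Finset.univ.erase i, p j (Function.update w i v j)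
        = ∏ j ∈ Finset.univ.erase i, p j (w j) :=
      Finset.prod_congr rfl fun j hj => by
        rw [Function.update_of_ne (Finset.ne_of_mem_erase hj)]
    simp only [h1 w, h1 (Function.update w i v), h2, Function.update_self]
    ring
  rw [Fintype.sum_prod_type, Fintype.sum_prod_type] at key
  unfold pexp resample
  calc _ = ∑ w : ι → β, ∑ v, (∏ j, p j (w j)) * p i v * f (Function.update w i v) := by
        refine Finset.sum_congr rfl fun w _ => ?_
        rw [Finset.mul_sum]
        exact Finset.sum_congr rfl fun v _ => by ring
    _ = _ := key
    _ = _ := by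
        refine Finset.sum_congr rfl fun w _ => ?_
        show ∑ v, (∏ j, p j (w j)) * p i v * f w = _
        rw [← Finset.sum_mul, ← Finset.mul_sum, hp.sum_eq, mul_one]

lemma pexp_apply (hp : IsProb p) (i : ι) (f : β → ℝ) :
    pexp p (fun w => f (w i)) = ∑ b, p i b * f b := by
  rw [← pexp_resample hp i]
  unfold resample
  simp only [Function.update_self]
  exact pexp_const hp _

lemma pexp_apply₂ (hp : IsProb p) {i j : ι} (hij : i ≠ j) (f : β → β → ℝ) :
    pexp p (fun w => f (w i) (w j)) = ∑ a, ∑ b, p i a * p j b * f a b := by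
  rw [← pexp_resample hp i]
  unfold resample
  simp only [Function.update_self, Function.update_of_ne hij.symm]
  rw [pexp_apply hp j (fun b => ∑ a, p i a * f a b), Finset.sum_comm]
  refine Finset.sum_congr rfl fun b _ => ?_
  rw [Finset.mul_sum]
  exact Finset.sum_congr rfl fun a _ => by ring

/-- Second moment of a sum of terms, each centred with respect to a coordinate that the others
ignore. -/
lemma pexp_sq_sum (hp : IsProb p) (s : Finset ι) (F : ι → (ι → β) → ℝ)
    (hc : ∀ i ∈ s, ∀ w, resample p i (F i) w = 0)
    (hi : ∀ i ∈ s, ∀ j ∈ s, i ≠ j → ∀ w v, F j (Function.update w i v) = F j w) :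
    pexp p (fun w => (∑ i ∈ s, F i w) ^ 2) = ∑ i ∈ s, pexp p (fun w => F i w ^ 2) := by
  have h1 : ∀ w, (∑ i ∈ s, F i w) ^ 2 = ∑ i ∈ s, ∑ j ∈ s, F i w * F j w := fun w => by
    rw [sq, Finset.sum_mul_sum]
  simp only [h1]
  rw [pexp_sum]
  refine Finset.sum_congr rfl fun i his => ?_
  rw [pexp_sum, Finset.sum_eq_single i]
  · simp only [sq]
  · intro j hj hji
    rw [← pexp_resample hp i]
    have : ∀ w, resample p i (fun w => F i w * F j w) w = 0 := by
      intro w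
      have h2 := hc i his w
      unfold resample at h2 ⊢
      simp only [hi i his j hj hji.symm]
      calc _ = (∑ v, p i v * F i (Function.update w i v)) * F j w := by
            rw [Finset.sum_mul]; exact Finset.sum_congr rfl fun v _ => by ring
        _ = 0 := by rw [h2, zero_mul]
    rw [show resample p i _ = fun _ => (0 : ℝ) from funext this]
    exact pexp_const hp 0
  · exact fun h => absurd his h

lemma isProb_uniform [Nonempty β] :
    IsProb (fun (_ : ι) (_ : β) => ((Fintype.card β : ℝ))⁻¹) where
  nonneg _ _ := by positivity
  sum_eq _ := by simp

lemma pexp_uniform (f : (ι → β) → ℝ) :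
    pexp (fun (_ : ι) (_ : β) => ((Fintype.card β : ℝ))⁻¹) f = 𝔼 w, f w := by
  rw [Fintype.expect_eq_sum_div_card, pexp]
  simp only [Finset.prod_const, Finset.card_univ, ← Finset.mul_sum, Fintype.card_fun, Nat.cast_pow]
  rw [div_eq_inv_mul, inv_pow]

/-! ### Bounded differences -/

/-- Changing one coordinate changes `f` by at most `c`. -/
def BddDiff (c : ℝ) (f : (ι → β) → ℝ) : Prop :=
  ∀ w i v, |f (Function.update w i v) - f w| ≤ c

/-- Convexity: on `[-c, c]` the exponential lies below its chord, here written as even part plus odd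
part. -/
lemma exp_mul_le_of_abs_le {x c t : ℝ} (hc : 0 < c) (hx : |x| ≤ c) :
    Real.exp (t * x) ≤ Real.cosh (t * c) + x * (Real.sinh (t * c) / c) := by
  obtain ⟨h1, h2⟩ := abs_le.mp hx
  have ha : 0 ≤ (1 + x / c) / 2 := by
    have : -1 ≤ x / c := by rw [le_div_iff₀ hc]; linarith
    linarith
  have hb : 0 ≤ (1 - x / c) / 2 := by
    have : x / c ≤ 1 := by rw [div_le_iff₀ hc]; linarith
    linarith
  have h := convexOn_exp.2 (Set.mem_univ (t * c)) (Set.mem_univ (-(t * c))) ha hb (by ring)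
  simp only [smul_eq_mul] at h
  have e1 : (1 + x / c) / 2 * (t * c) + (1 - x / c) / 2 * -(t * c) = t * x := by
    field_simp; ring
  rw [e1] at h
  rw [Real.cosh_eq, Real.sinh_eq]
  refine h.trans (le_of_eq ?_)
  field_simp; ring

/-- Hoeffding's lemma: centring kills the odd part of the chord, and cosh u ≤ exp(u²/2). The sharp
constant is not needed. -/
lemma sum_exp_le_of_centered {q : β → ℝ} (hq : ∀ b, 0 ≤ q b) (hq1 : ∑ b, q b = 1) {x : β → ℝ}
    {c : ℝ} (hx : ∀ b, |x b| ≤ c) (h0 : ∑ b, q b * x b = 0) (t : ℝ) :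
    ∑ b, q b * Real.exp (t * x b) ≤ Real.exp (t ^ 2 * c ^ 2 / 2) := by
  have hne : Nonempty β := by
    by_contra hemp
    rw [not_nonempty_iff] at hemp
    simp at hq1
  have hc0 : 0 ≤ c := (abs_nonneg _).trans (hx hne.some)
  rcases hc0.eq_or_lt with hc | hc
  · have : ∀ b, x b = 0 := fun b => abs_nonpos_iff.mp (hc ▸ hx b)
    simp [this, hq1, ← hc]
  calc ∑ b, q b * Real.exp (t * x b)
      ≤ ∑ b, q b * (Real.cosh (t * c) + x b * (Real.sinh (t * c) / c)) :=
        Finset.sum_le_sum fun b _ =>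
          mul_le_mul_of_nonneg_left (exp_mul_le_of_abs_le hc (hx b)) (hq b)
    _ = Real.cosh (t * c) := by
        simp only [mul_add, Finset.sum_add_distrib, ← mul_assoc, ← Finset.sum_mul, hq1, h0]
        ring
    _ ≤ Real.exp ((t * c) ^ 2 / 2) := Real.cosh_le_exp_half_sq _
    _ = _ := by rw [mul_pow]

lemma resample_sub_self (hp : IsProb p) (i : ι) (f : (ι → β) → ℝ) (w : ι → β) :
    ∑ v, p i v * (f (Function.update w i v) - resample p i f w) = 0 := by
  simp only [mul_sub, Finset.sum_sub_distrib, ← Finset.sum_mul, hp.sum_eq, one_mul]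
  exact sub_self _

lemma resample_update (i : ι) (f : (ι → β) → ℝ) (w : ι → β) (v : β) :
    resample p i f (Function.update w i v) = resample p i f w := by
  simp [resample]

lemma abs_sum_mul_le {q : β → ℝ} (hq : ∀ b, 0 ≤ q b) (hq1 : ∑ b, q b = 1) {x : β → ℝ} {c : ℝ}
    (hx : ∀ b, |x b| ≤ c) : |∑ b, q b * x b| ≤ c := by
  calc |∑ b, q b * x b| ≤ ∑ b, |q b * x b| := Finset.abs_sum_le_sum_abs _ _
    _ ≤ ∑ b, q b * c := Finset.sum_le_sum fun b _ => by
        rw [abs_mul, abs_of_nonneg (hq b)]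
        exact mul_le_mul_of_nonneg_left (hx b) (hq b)
    _ = c := by rw [← Finset.sum_mul, hq1, one_mul]

lemma BddDiff.resample (hp : IsProb p) {c : ℝ} {f : (ι → β) → ℝ} (hf : BddDiff c f) (i : ι) :
    BddDiff c (resample p i f) := by
  intro w j v
  by_cases hij : j = i
  · subst hij
    rw [resample_update, sub_self, abs_zero]
    exact (abs_nonneg _).trans (hf w j v)
  · have : GeomQAP.resample p i f (Function.update w j v) - GeomQAP.resample p i f w
        = ∑ u, p i u * (f (Function.update (Function.update w i u) j v)
            - f (Function.update w i u)) := by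
      simp only [GeomQAP.resample, mul_sub, Finset.sum_sub_distrib,
        Function.update_comm hij]
    rw [this]
    exact abs_sum_mul_le (hp.nonneg i) (hp.sum_eq i) fun u => hf _ _ _

/-- The martingale argument as an induction on the averaged coordinates: `g` is `f` averaged over
`S`, and each averaging step multiplies the exponential moment by one Hoeffding factor. The third
clause keeps coordinates that were already ignored ignored. -/
lemma mgf_aux (hp : IsProb p) (t c : ℝ) (S : Finset ι) : ∀ f : (ι → β) → ℝ, BddDiff c f →
    ∃ g : (ι → β) → ℝ, pexp p g = pexp p f ∧ (∀ i ∈ S, ∀ w v, g (Function.update w i v) = g w) ∧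
      (∀ i, (∀ w v, f (Function.update w i v) = f w) → ∀ w v, g (Function.update w i v) = g w) ∧
      pexp p (fun w => Real.exp (t * (f w - g w))) ≤ Real.exp (S.card * (t ^ 2 * c ^ 2 / 2)) := by
  induction S using Finset.induction_on with
  | empty =>
    intro f _
    exact ⟨f, rfl, by simp, fun i h => h, by simp [pexp_const hp]⟩
  | insert i S hiS ih =>
    intro f hf
    obtain ⟨g, hg1, hg2, hg3, hg4⟩ := ih _ (hf.resample hp i)
    have hgi := hg3 i (resample_update i f)
    refine ⟨g, hg1.trans (pexp_resample hp i f), ?_, ?_, ?_⟩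
    · intro j hj
      rcases Finset.mem_insert.mp hj with rfl | hj
      · exact hgi
      · exact hg2 j hj
    · intro j hj
      by_cases hij : j = i
      · exact hij ▸ hgi
      · refine hg3 j fun w v => ?_
        simp only [resample, Function.update_comm hij, hj]
    · rw [← pexp_resample hp i]
      have hstep : ∀ w, resample p i (fun w => Real.exp (t * (f w - g w))) w
          ≤ Real.exp (t ^ 2 * c ^ 2 / 2) * Real.exp (t * (resample p i f w - g w)) := by
        intro w
        have h1 : resample p i (fun w => Real.exp (t * (f w - g w))) w
            = (∑ v, p i v * Real.exp (t * (f (Function.update w i v) - resample p i f w)))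
              * Real.exp (t * (resample p i f w - g w)) := by
          rw [resample, Finset.sum_mul]
          refine Finset.sum_congr rfl fun v _ => ?_
          rw [hgi, mul_assoc, ← Real.exp_add]
          congr 2
          ring
        rw [h1]
        refine mul_le_mul_of_nonneg_right ?_ (Real.exp_pos _).le
        refine sum_exp_le_of_centered (hp.nonneg i) (hp.sum_eq i) (fun v => ?_)
          (resample_sub_self hp i f w) t
        have h2 : f (Function.update w i v) - resample p i f w
            = ∑ u, p i u * (f (Function.update w i v) - f (Function.update w i u)) := by
          simp only [mul_sub, Finset.sum_sub_distrib, ← Finset.sum_mul, hp.sum_eq, one_mul]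
          rfl
        rw [h2]
        refine abs_sum_mul_le (hp.nonneg i) (hp.sum_eq i) fun u => ?_
        have := hf (Function.update w i u) i v
        rwa [Function.update_idem] at this
      calc _ ≤ pexp p (fun w => Real.exp (t ^ 2 * c ^ 2 / 2) *
              Real.exp (t * (resample p i f w - g w))) := pexp_mono hp hstep
        _ ≤ Real.exp (t ^ 2 * c ^ 2 / 2) * Real.exp (S.card * (t ^ 2 * c ^ 2 / 2)) := by
            rw [pexp_mul_left]
            exact mul_le_mul_of_nonneg_left hg4 (Real.exp_pos _).le
        _ = _ := by
            rw [← Real.exp_add, Finset.card_insert_of_notMem hiS]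
            congr 1
            push_cast
            ring

lemma eq_of_forall_update_eq {f : (ι → β) → ℝ} (h : ∀ i w v, f (Function.update w i v) = f w)
    (w w' : ι → β) : f w = f w' := by
  have key : ∀ S : Finset ι, f (fun i => if i ∈ S then w i else w' i) = f w' := by
    intro S
    induction S using Finset.induction_on with
    | empty => simp
    | insert i S hi ih =>
      rw [← ih, ← h i (fun j => if j ∈ S then w j else w' j) (w i)]
      congr 1
      ext j
      by_cases hj : j = i
      · subst hj; simp
      · simp [hj]
  simpa using key Finset.univ

/-- McDiarmid's bounded difference inequality, in exponential moment form. -/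
lemma pexp_exp_le (hp : IsProb p) {c : ℝ} {f : (ι → β) → ℝ} (hf : BddDiff c f) (t : ℝ) :
    pexp p (fun w => Real.exp (t * (f w - pexp p f)))
      ≤ Real.exp (Fintype.card ι * (t ^ 2 * c ^ 2 / 2)) := by
  obtain ⟨g, hg1, hg2, -, hg4⟩ := mgf_aux hp t c Finset.univ f hf
  have hconst : ∀ w, g w = pexp p f := fun w => by
    rw [← hg1]
    have : g = fun _ => g w :=
      funext fun w' => eq_of_forall_update_eq (fun i w v => hg2 i (Finset.mem_univ i) w v) _ _
    conv_rhs => rw [this]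
    rw [pexp_const hp]
  simpa only [hconst, Finset.card_univ] using hg4

lemma BddDiff.sub_le {c : ℝ} {f : (ι → β) → ℝ} (hf : BddDiff c f) (S : Finset ι) (w w' : ι → β)
    (h : ∀ i, i ∉ S → w i = w' i) : |f w - f w'| ≤ S.card * c := by
  induction S using Finset.induction_on generalizing w with
  | empty =>
    have : w = w' := funext fun i => h i (by simp)
    simp [this]
  | insert i S hi ih =>
    have h1 := ih (Function.update w i (w' i)) fun j hj => by
      by_cases hij : j = i
      · subst hij; simp
      · rw [Function.update_of_ne hij]
        exact h j (by simp [hij, hj])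
    have h2 := hf w i (w' i)
    rw [abs_sub_comm] at h2
    rw [Finset.card_insert_of_notMem hi]
    push_cast
    calc |f w - f w'| ≤ _ := abs_sub_le _ (f (Function.update w i (w' i))) _
      _ ≤ _ := by linarith

/-- Expected maximum of finitely many functions with bounded differences. -/
lemma pexp_sup_le (hp : IsProb p) {Λ : Type*} [Fintype Λ] [Nonempty Λ] {c M t : ℝ} (ht : 0 < t)
    (f : Λ → (ι → β) → ℝ) (hf : ∀ l, BddDiff c (f l)) (hM : ∀ l, pexp p (f l) ≤ M) :
    pexp p (fun w => ⨆ l, f l w)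
      ≤ M + Real.log (Fintype.card Λ) / t + Fintype.card ι * (t * c ^ 2 / 2) := by
  set N : ℝ := (Fintype.card Λ : ℝ) with hN
  have hNpos : 0 < N := by rw [hN]; exact_mod_cast Fintype.card_pos
  set s : ℝ := Fintype.card ι * (t ^ 2 * c ^ 2 / 2) with hs
  -- The exponential of a maximum is at most the sum of the exponentials, so the cardinality enters
  -- only through its logarithm.
  have h1 : pexp p (fun w => Real.exp (t * ((⨆ l, f l w) - M))) ≤ N * Real.exp s := by
    calc _ ≤ pexp p (fun w => ∑ l, Real.exp (t * (f l w - pexp p (f l)))) := by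
          refine pexp_mono hp fun w => ?_
          obtain ⟨l, hl⟩ := exists_eq_ciSup_of_finite (f := fun l => f l w)
          rw [← hl]
          refine le_trans ?_ (Finset.single_le_sum (f := fun l =>
            Real.exp (t * (f l w - pexp p (f l)))) (fun _ _ => (Real.exp_pos _).le)
            (Finset.mem_univ l))
          refine Real.exp_le_exp.mpr (mul_le_mul_of_nonneg_left ?_ ht.le)
          linarith [hM l]
      _ ≤ ∑ _l : Λ, Real.exp s := by
          rw [pexp_sum]
          exact Finset.sum_le_sum fun l _ => pexp_exp_le hp (hf l) t
      _ = _ := by simp [hN]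
  set X := pexp p (fun w => ⨆ l, f l w) with hX
  have h2 : Real.exp (t * (X - M)) ≤ N * Real.exp s := by
    refine le_trans ?_ h1
    -- Jensen's inequality, via the tangent line of the exponential at the mean `X`.
    have h3 : ∀ w, Real.exp (t * (X - M)) * (1 + t * ((⨆ l, f l w) - X))
        ≤ Real.exp (t * ((⨆ l, f l w) - M)) := by
      intro w
      have : t * ((⨆ l, f l w) - M) = t * (X - M) + t * ((⨆ l, f l w) - X) := by ring
      rw [this, Real.exp_add]
      refine mul_le_mul_of_nonneg_left ?_ (Real.exp_pos _).le
      linarith [Real.add_one_le_exp (t * ((⨆ l, f l w) - X))]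
    refine le_trans (le_of_eq ?_) (pexp_mono hp h3)
    rw [pexp_mul_left, pexp_add, pexp_const hp, pexp_mul_left, pexp_sub, pexp_const hp]
    simp [hX]
  have h4 : t * (X - M) ≤ Real.log N + s := by
    have := Real.log_le_log (Real.exp_pos _) h2
    rwa [Real.log_exp, Real.log_mul hNpos.ne' (Real.exp_ne_zero _), Real.log_exp] at this
  have h5 : X - M ≤ (Real.log N + s) / t := by
    rw [le_div_iff₀ ht]; linarith
  have h6 : (Real.log N + s) / t = Real.log N / t + Fintype.card ι * (t * c ^ 2 / 2) := by
    rw [hs]; field_simp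
  linarith

end ProductExpectation

/-! ### Uniformly random injections: comparison with independent sampling, invariance, variance. -/

section Embeddings

variable {α : Type*} [Fintype α] [DecidableEq α]

lemma expect_mono {ι : Type*} [Fintype ι] {f g : ι → ℝ} (h : ∀ i, f i ≤ g i) :
    𝔼 i, f i ≤ 𝔼 i, g i :=
  Finset.expect_le_expect fun i _ => h i

lemma abs_expect_le {ι : Type*} [Fintype ι] {f : ι → ℝ} {c : ℝ} (hc : 0 ≤ c)
    (h : ∀ i, |f i| ≤ c) : |𝔼 i, f i| ≤ c := by
  rcases isEmpty_or_nonempty ι with hι | hι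
  · simpa [Finset.univ_eq_empty] using hc
  · refine abs_le.mpr ⟨?_, ?_⟩
    · exact (Fintype.expect_const (ι := ι) (-c)).symm.le.trans
        (expect_mono fun i => (abs_le.mp (h i)).1)
    · exact (expect_mono fun i => (abs_le.mp (h i)).2).trans (Fintype.expect_const (ι := ι) c).le

lemma card_range_embedding {k : ℕ} (e : Fin k ↪ α) [Fintype {i // i ∈ Set.range e}] :
    Fintype.card {i // i ∈ Set.range e} = k :=
  (Fintype.card_congr (Equiv.ofInjective e e.injective)).symm.trans (Fintype.card_fin k)

lemma expect_embedding_succ {k : ℕ} (F : (Fin (k + 1) ↪ α) → ℝ) :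
    𝔼 σ, F σ = 𝔼 e : Fin k ↪ α, 𝔼 i : {i // i ∉ Set.range e},
      F ((Equiv.embeddingFinSucc k α).symm ⟨e, i⟩) := by
  classical
  have hcard : ∀ e : Fin k ↪ α, Fintype.card {i // i ∉ Set.range e} = Fintype.card α - k := by
    intro e
    rw [Fintype.card_subtype_compl, card_range_embedding]
  rw [Fintype.expect_equiv (Equiv.embeddingFinSucc k α) F
    (fun x => F ((Equiv.embeddingFinSucc k α).symm x)) (fun i => by simp)]
  simp only [Fintype.expect_eq_sum_div_card, Fintype.card_sigma, hcard]
  rw [Fintype.sum_sigma, ← Finset.sum_div, div_div]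
  congr 1
  simp [mul_comm]

lemma expect_fin_cons {k : ℕ} (F : (Fin (k + 1) → α) → ℝ) :
    𝔼 x, F x = 𝔼 y : Fin k → α, 𝔼 v, F (Fin.cons v y) := by
  rw [← Fintype.expect_equiv (Fin.consEquiv fun _ => α) (fun z => F (Fin.cons z.1 z.2)) F
    (fun i => rfl), ← Finset.univ_product_univ, Finset.expect_product, Finset.expect_comm]

/-- Deviations from the mean over the complement of `s` sum to zero there, so only the `k` points of
`s` contribute. -/
lemma abs_expect_compl_sub_le {s : Set α} [DecidablePred (· ∈ s)] [Nonempty {i // i ∉ s}]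
    {h : α → ℝ} {c : ℝ} (hc : ∀ i j, |h i - h j| ≤ c) {k : ℕ} (hs : Fintype.card s = k) :
    |𝔼 i, h i - 𝔼 i : {i // i ∉ s}, h i| ≤ c * k / Fintype.card α := by
  set a := 𝔼 i : {i // i ∉ s}, h i with ha
  have hne : Nonempty α := ⟨(Classical.arbitrary {i // i ∉ s}).1⟩
  have hN : (0 : ℝ) < Fintype.card α := by exact_mod_cast Fintype.card_pos
  have hc0 : 0 ≤ c := (abs_nonneg _).trans (hc hne.some hne.some)
  have h1 : ∑ i : {i // i ∉ s}, (h i - a) = 0 := by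
    rw [Finset.sum_sub_distrib, ← Fintype.card_smul_expect, ← ha]
    simp
  have h2 : 𝔼 i, h i - a = (∑ i : s, (h i - a)) / Fintype.card α := by
    have : 𝔼 i, h i - a = 𝔼 i, (h i - a) := by
      rw [Finset.expect_sub_distrib, Fintype.expect_const]
    rw [this, Fintype.expect_eq_sum_div_card]
    congr 1
    rw [← Fintype.sum_subtype_add_sum_subtype (· ∈ s), h1, add_zero]
  rw [h2, abs_div, abs_of_pos hN]
  refine div_le_div_of_nonneg_right ?_ hN.le
  refine (Finset.abs_sum_le_sum_abs _ _).trans ?_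
  have h3 : ∀ i, |h i - a| ≤ c := by
    intro i
    have : h i - a = 𝔼 j : {i // i ∉ s}, (h i - h j) := by
      rw [Finset.expect_sub_distrib, Fintype.expect_const]
    rw [this]
    exact abs_expect_le hc0 fun j => hc _ _
  refine (Finset.sum_le_sum fun i _ => h3 i.1).trans ?_
  simp [hs, mul_comm]

lemma update_cons_zero {k : ℕ} (v u : α) (x : Fin k → α) :
    Function.update (Fin.cons v x : Fin (k + 1) → α) 0 u = Fin.cons u x :=
  Fin.update_cons_zero _ _ _

/-- Sampling with and without replacement give close expectations. -/
lemma abs_expect_sub_expect_embedding_le {c : ℝ} (hc : 0 ≤ c) : ∀ {k : ℕ},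
    k ≤ Fintype.card α → ∀ f : (Fin k → α) → ℝ, BddDiff c f →
    |𝔼 x, f x - 𝔼 σ : Fin k ↪ α, f σ| ≤ c * k ^ 2 / Fintype.card α := by
  classical
  intro k
  induction k with
  | zero =>
    intro _ f _
    have h1 : ∀ x : Fin 0 → α, f x = f Fin.elim0 := fun x => congrArg f (Subsingleton.elim _ _)
    have : Nonempty (Fin 0 ↪ α) := ⟨Function.Embedding.ofIsEmpty⟩
    simp [h1]
  | succ k ih =>
    intro hk f hf
    have hN : (0 : ℝ) < Fintype.card α := by
      have : 0 < Fintype.card α := by omega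
      exact_mod_cast this
    have hne : Nonempty α := Fintype.card_pos_iff.mp (by omega)
    -- Average out one point. Its law given the others is uniform on all of `α` or on the complement
    -- of `k` points, at cost c·k/N, and these costs add up to at most c·k²/N.
    set f' : (Fin k → α) → ℝ := fun y => 𝔼 v, f (Fin.cons v y) with hf'
    have hbd : BddDiff c f' := by
      intro y i u
      have : f' (Function.update y i u) - f' y
          = 𝔼 v, (f (Function.update (Fin.cons v y) i.succ u) - f (Fin.cons v y)) := by
        rw [Finset.expect_sub_distrib]
        simp only [hf', Fin.cons_update]
      rw [this]
      exact abs_expect_le hc fun v => hf _ _ _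
    have h1 := ih (by omega) f' hbd
    rw [expect_fin_cons, expect_embedding_succ (fun σ => f σ)]
    have h2 : |𝔼 e : Fin k ↪ α, f' e - 𝔼 e : Fin k ↪ α, 𝔼 i : {i // i ∉ Set.range e},
        f ((Equiv.embeddingFinSucc k α).symm ⟨e, i⟩)| ≤ c * k / Fintype.card α := by
      rw [← Finset.expect_sub_distrib]
      refine abs_expect_le (by positivity) fun e => ?_
      simp only [Equiv.coe_embeddingFinSucc_symm]
      have : Nonempty {i // i ∉ Set.range e} := by
        rw [← Fintype.card_pos_iff, Fintype.card_subtype_compl, card_range_embedding]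
        omega
      refine abs_expect_compl_sub_le (s := Set.range e) (h := fun v => f (Fin.cons v e))
        (fun i j => ?_) (by convert card_range_embedding e)
      have := hf (Fin.cons j e) 0 i
      rwa [update_cons_zero] at this
    calc _ ≤ _ := abs_sub_le _ (𝔼 e : Fin k ↪ α, f' e) _
      _ ≤ c * k ^ 2 / Fintype.card α + c * k / Fintype.card α := add_le_add h1 h2
      _ ≤ _ := by
          rw [← add_div]
          refine div_le_div_of_nonneg_right ?_ hN.le
          push_cast
          nlinarith [mul_nonneg hc (Nat.cast_nonneg (α := ℝ) k)]

/-- Composing a uniformly random injection with a fixed injection gives a uniformly random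
injection. -/
lemma expect_embedding_comp {k m : ℕ} (hk : k ≤ Fintype.card α) (τ : Fin m ↪ Fin k)
    (F : (Fin m ↪ α) → ℝ) : 𝔼 σ : Fin k ↪ α, F (τ.trans σ) = 𝔼 σ, F σ := by
  classical
  have hne : Nonempty (Fin k ↪ α) := by
    rw [Function.Embedding.nonempty_iff_card_le]; simpa using hk
  obtain ⟨σ₀⟩ := hne
  -- Averaging over all relabelings of `α` changes nothing, and since permutations act transitively
  -- on injections, the average no longer depends on the injection.
  have hinv : ∀ (l : ℕ) (G : (Fin l ↪ α) → ℝ),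
      𝔼 σ, G σ = 𝔼 σ, 𝔼 ρ : Equiv.Perm α, G (ρ • σ) := by
    intro l G
    rw [Finset.expect_comm]
    have : ∀ ρ : Equiv.Perm α, 𝔼 σ, G (ρ • σ) = 𝔼 σ, G σ := fun ρ =>
      Fintype.expect_equiv (MulAction.toPerm ρ) _ _ fun _ => rfl
    simp only [this, Fintype.expect_const]
  have hconst : ∀ τ' : Fin m ↪ α, 𝔼 ρ : Equiv.Perm α, F (ρ • τ')
      = 𝔼 ρ : Equiv.Perm α, F (ρ • (τ.trans σ₀)) := by
    intro τ'
    have hpt : MulAction.IsPretransitive (Equiv.Perm α) (Fin m ↪ α) :=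
      Equiv.Perm.isMultiplyPretransitive α m
    obtain ⟨g, hg⟩ := MulAction.exists_smul_eq (Equiv.Perm α) τ' (τ.trans σ₀)
    refine Fintype.expect_equiv (Equiv.mulRight g⁻¹) _ _ fun ρ => ?_
    rw [← hg, Equiv.coe_mulRight, smul_smul, inv_mul_cancel_right]
  have hne' : Nonempty (Fin k ↪ α) := ⟨σ₀⟩
  have hne'' : Nonempty (Fin m ↪ α) := ⟨τ.trans σ₀⟩
  rw [hinv k, hinv m]
  have hsm : ∀ (ρ : Equiv.Perm α) (σ : Fin k ↪ α), τ.trans (ρ • σ) = ρ • (τ.trans σ) :=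
    fun ρ σ => rfl
  simp only [hsm, hconst, Fintype.expect_const]

/-- Variance bound for functions of a uniformly random injection. -/
lemma expect_embedding_sq_le {c : ℝ} (hc : 0 ≤ c) : ∀ {k : ℕ}, k ≤ Fintype.card α →
    ∀ f : (Fin k ↪ α) → ℝ, (∀ (σ : Fin k ↪ α) (a b : α), |f (Equiv.swap a b • σ) - f σ| ≤ c) →
    𝔼 σ, (f σ - 𝔼 τ, f τ) ^ 2 ≤ k * c ^ 2 := by
  classical
  intro k
  induction k with
  | zero =>
    intro _ f _
    have h1 : ∀ x : Fin 0 ↪ α, f x = f Function.Embedding.ofIsEmpty :=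
      fun x => congrArg f (Subsingleton.elim _ _)
    have : Nonempty (Fin 0 ↪ α) := ⟨Function.Embedding.ofIsEmpty⟩
    simp [h1]
  | succ k ih =>
    intro hk f hf
    set Φ := (Equiv.embeddingFinSucc k α).symm with hΦ
    set f' : (Fin k ↪ α) → ℝ := fun e => 𝔼 i : {i // i ∉ Set.range e}, f (Φ ⟨e, i⟩) with hf'
    have hne : Nonempty (Fin k ↪ α) := by
      rw [Function.Embedding.nonempty_iff_card_le, Fintype.card_fin]; omega
    have hne' : ∀ e : Fin k ↪ α, Nonempty {i // i ∉ Set.range e} := fun e => by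
      rw [← Fintype.card_pos_iff, Fintype.card_subtype_compl, card_range_embedding]
      omega
    have hmean : 𝔼 τ, f τ = 𝔼 e, f' e := expect_embedding_succ f
    have hΦs : ∀ (a b : α) (e : Fin k ↪ α) (i : {i // i ∉ Set.range e})
        (h : Equiv.swap a b i ∉ Set.range (Equiv.swap a b • e)),
        Φ ⟨Equiv.swap a b • e, ⟨Equiv.swap a b i, h⟩⟩ = Equiv.swap a b • Φ ⟨e, i⟩ := by
      intro a b e i h
      ext j
      rw [Function.Embedding.smul_apply]
      simp only [hΦ, Equiv.coe_embeddingFinSucc_symm]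
      refine Fin.cases ?_ (fun j => ?_) j
      · simp
      · simp [Function.Embedding.smul_apply]
    -- The Lipschitz condition is phrased with transpositions because in this form the conditional
    -- mean `f'` inherits it.
    have hL : ∀ (e : Fin k ↪ α) (a b : α), |f' (Equiv.swap a b • e) - f' e| ≤ c := by
      intro e a b
      have hmem : ∀ i, i ∉ Set.range e ↔ Equiv.swap a b i ∉ Set.range (Equiv.swap a b • e) := by
        intro i
        simp [Set.mem_range, Function.Embedding.smul_apply]
      have h1 : f' (Equiv.swap a b • e)
          = 𝔼 i : {i // i ∉ Set.range e}, f (Equiv.swap a b • Φ ⟨e, i⟩) := by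
        symm
        refine Fintype.expect_equiv ((Equiv.swap a b).subtypeEquiv hmem) _ _ fun i => ?_
        rw [Equiv.subtypeEquiv_apply, hΦs]
      rw [h1, hf', ← Finset.expect_sub_distrib]
      exact abs_expect_le hc fun i => hf _ _ _
    have hin : ∀ (e : Fin k ↪ α) (i j : {i // i ∉ Set.range e}),
        |f (Φ ⟨e, i⟩) - f (Φ ⟨e, j⟩)| ≤ c := by
      intro e i j
      -- Replacing the newly drawn point `j` by `i` is a transposition, because neither is among the
      -- other points.
      have h1 : Φ ⟨e, i⟩ = Equiv.swap (i : α) j • Φ ⟨e, j⟩ := by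
        ext l
        rw [Function.Embedding.smul_apply]
        simp only [hΦ, Equiv.coe_embeddingFinSucc_symm]
        refine Fin.cases ?_ (fun l => ?_) l
        · simp
        · simp only [Fin.cons_succ, Equiv.Perm.smul_def]
          rw [Equiv.swap_apply_of_ne_of_ne]
          · rintro h; exact i.2 ⟨l, h⟩
          · rintro h; exact j.2 ⟨l, h⟩
      rw [h1]
      exact hf _ _ _
    rw [expect_embedding_succ (fun σ => (f σ - 𝔼 τ, f τ) ^ 2)]
    set μ := 𝔼 τ, f τ with hμ
    -- Law of total variance: the conditional variance is at most c², and the rest is the variance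
    -- of `f'`.
    have hstep : ∀ e : Fin k ↪ α, 𝔼 i : {i // i ∉ Set.range e}, (f (Φ ⟨e, i⟩) - μ) ^ 2
        ≤ c ^ 2 + (f' e - μ) ^ 2 := by
      intro e
      have hne1 := hne' e
      have h0 : 𝔼 i : {i // i ∉ Set.range e}, (f (Φ ⟨e, i⟩) - f' e) = 0 := by
        rw [Finset.expect_sub_distrib, Fintype.expect_const, sub_self]
      have h1 : ∀ i : {i // i ∉ Set.range e}, (f (Φ ⟨e, i⟩) - μ) ^ 2
          = (f (Φ ⟨e, i⟩) - f' e) ^ 2 + (2 * (f' e - μ) * (f (Φ ⟨e, i⟩) - f' e)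
            + (f' e - μ) ^ 2) := fun i => by ring
      simp only [h1]
      rw [Finset.expect_add_distrib, Finset.expect_add_distrib, ← Finset.mul_expect, h0,
        Fintype.expect_const, mul_zero, zero_add]
      refine add_le_add ?_ le_rfl
      refine (expect_mono fun i => ?_).trans (Fintype.expect_const (c ^ 2)).le
      refine sq_le_sq' ?_ ?_ <;> [skip; skip]
      all_goals
        have h3 : |f (Φ ⟨e, i⟩) - f' e| ≤ c := by
          have : f (Φ ⟨e, i⟩) - f' e
              = 𝔼 j : {i // i ∉ Set.range e}, (f (Φ ⟨e, i⟩) - f (Φ ⟨e, j⟩)) := by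
            rw [Finset.expect_sub_distrib, Fintype.expect_const]
          rw [this]
          exact abs_expect_le hc fun j => hin e i j
        first
        | exact (abs_le.mp h3).1
        | exact (abs_le.mp h3).2
    have hfin := ih (by omega) f' hL
    rw [← hmean] at hfin
    calc _ ≤ 𝔼 e : Fin k ↪ α, (c ^ 2 + (f' e - μ) ^ 2) := expect_mono hstep
      _ = c ^ 2 + 𝔼 e : Fin k ↪ α, (f' e - μ) ^ 2 := by
          rw [Finset.expect_add_distrib, Fintype.expect_const]
      _ ≤ _ := by push_cast; linarith

end Embeddings

/-! ### The penalized labelling problem: stability, rounding, restriction to samples. -/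

section PartitionProblem

variable {ι κ B : Type*} [Fintype ι] [Fintype κ] [Fintype B] [DecidableEq B]

/-- Density of the quadratic form of the fractional labelling `φ` with label interaction `D`. -/
def quad (D : B → B → ℝ) (H : ι → ι → ℝ) (φ : ι → B → ℝ) : ℝ :=
  𝔼 i, 𝔼 j, ∑ a, ∑ b, φ i a * φ j b * D a b * H i j

/-- Fraction of the label `b` in the fractional labelling `φ`. -/
def marg (φ : ι → B → ℝ) (b : B) : ℝ := 𝔼 i, φ i b

/-- Quadratic form penalized by the deviation of the label fractions from `c`. -/
def fracVal (D : B → B → ℝ) (c : B → ℝ) (H : ι → ι → ℝ) (φ : ι → B → ℝ) : ℝ :=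
  quad D H φ - 4 * ∑ b, |marg φ b - c b|

/-- An integral labelling as a fractional one. -/
def vertex (a : ι → B) : ι → B → ℝ := fun i b => if a i = b then 1 else 0

/-- Optimum of the penalized labelling problem. -/
def partOpt (D : B → B → ℝ) (c : B → ℝ) (H : ι → ι → ℝ) : ℝ :=
  ⨆ a : ι → B, fracVal D c H (vertex a)

variable {D : B → B → ℝ} {c : B → ℝ}

lemma isProb_vertex (a : ι → B) : IsProb (vertex a) where
  nonneg i b := by unfold vertex; positivity
  sum_eq i := by simp [vertex]

lemma quad_vertex (H : ι → ι → ℝ) (a : ι → B) :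
    quad D H (vertex a) = 𝔼 i, 𝔼 j, D (a i) (a j) * H i j := by
  simp [quad, vertex]

lemma marg_nonneg {φ : ι → B → ℝ} (hφ : IsProb φ) (b : B) : 0 ≤ marg φ b :=
  Finset.expect_nonneg fun i _ => hφ.nonneg i b

lemma sum_marg [Nonempty ι] {φ : ι → B → ℝ} (hφ : IsProb φ) : ∑ b, marg φ b = 1 := by
  simp only [marg]
  rw [← Finset.expect_sum_comm]
  simp only [hφ.sum_eq, Fintype.expect_const]

lemma fracVal_le_partOpt (H : ι → ι → ℝ) (a : ι → B) :
    fracVal D c H (vertex a) ≤ partOpt D c H :=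
  le_ciSup (f := fun a => fracVal D c H (vertex a)) (Set.finite_range _).bddAbove a

lemma exists_partOpt_eq [Nonempty B] (D : B → B → ℝ) (c : B → ℝ) (H : ι → ι → ℝ) :
    ∃ a : ι → B, fracVal D c H (vertex a) = partOpt D c H := by
  classical
  exact exists_eq_ciSup_of_finite

lemma sum_sum_mul_le {p q : B → ℝ} (hp : ∀ b, 0 ≤ p b) (hp1 : ∑ b, p b = 1) (hq : ∀ b, 0 ≤ q b)
    (hq1 : ∑ b, q b = 1) {D : B → B → ℝ} {M : ℝ} (hD : ∀ a b, |D a b| ≤ M) :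
    |∑ a, ∑ b, p a * q b * D a b| ≤ M := by
  have : ∑ a, ∑ b, p a * q b * D a b = ∑ a, p a * ∑ b, q b * D a b := by
    simp only [Finset.mul_sum, mul_assoc]
  rw [this]
  exact abs_sum_mul_le hp hp1 fun a => abs_sum_mul_le hq hq1 fun b => hD a b

lemma quad_eq (H : ι → ι → ℝ) (φ : ι → B → ℝ) :
    quad D H φ = 𝔼 i, 𝔼 j, (∑ a, ∑ b, φ i a * φ j b * D a b) * H i j := by
  simp only [quad, Finset.sum_mul]

lemma abs_expect_expect_le {f : ι → ι → ℝ} {g : ι → ι → ℝ} (h : ∀ i j, |f i j| ≤ g i j) :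
    |𝔼 i, 𝔼 j, f i j| ≤ 𝔼 i, 𝔼 j, g i j := by
  refine abs_le.mpr ⟨?_, expect_mono fun i => expect_mono fun j => (abs_le.mp (h i j)).2⟩
  simp only [← Finset.expect_neg_distrib]
  exact expect_mono fun i => expect_mono fun j => (abs_le.mp (h i j)).1

lemma abs_quad_sub_le (hD : ∀ a b, |D a b| ≤ 1) (H H' : ι → ι → ℝ) {φ : ι → B → ℝ}
    (hφ : IsProb φ) : |quad D H φ - quad D H' φ| ≤ 𝔼 i, 𝔼 j, |H i j - H' i j| := by
  rw [quad_eq, quad_eq]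
  simp only [← Finset.expect_sub_distrib, ← mul_sub]
  refine abs_expect_expect_le fun i j => ?_
  rw [abs_mul]
  exact mul_le_of_le_one_left (abs_nonneg _)
    (sum_sum_mul_le (hφ.nonneg i) (hφ.sum_eq i) (hφ.nonneg j) (hφ.sum_eq j) hD)

lemma abs_partOpt_sub_le_of_forall [Nonempty B] {c' : B → ℝ} {H H' : ι → ι → ℝ}
    {D' : B → B → ℝ} {e : ℝ}
    (h : ∀ a : ι → B, |fracVal D c H (vertex a) - fracVal D' c' H' (vertex a)| ≤ e) :
    |partOpt D c H - partOpt D' c' H'| ≤ e := by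
  obtain ⟨a, ha⟩ := exists_partOpt_eq D c H
  obtain ⟨a', ha'⟩ := exists_partOpt_eq D' c' H'
  have h1 := abs_le.mp (h a)
  have h2 := abs_le.mp (h a')
  have h3 := fracVal_le_partOpt (D := D') (c := c') H' a
  have h4 := fracVal_le_partOpt (D := D) (c := c) H a'
  exact abs_le.mpr ⟨by linarith, by linarith⟩

lemma abs_partOpt_sub_le [Nonempty B] (hD : ∀ a b, |D a b| ≤ 1) (H H' : ι → ι → ℝ) :
    |partOpt D c H - partOpt D c H'| ≤ 𝔼 i, 𝔼 j, |H i j - H' i j| := by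
  refine abs_partOpt_sub_le_of_forall fun a => ?_
  simp only [fracVal, sub_sub_sub_cancel_right]
  exact abs_quad_sub_le hD H H' (isProb_vertex a)

lemma fracVal_comp (e : κ ≃ ι) (H : ι → ι → ℝ) (φ : ι → B → ℝ) :
    fracVal D c (fun i j => H (e i) (e j)) (fun i => φ (e i)) = fracVal D c H φ := by
  unfold fracVal quad marg
  congr 1
  · refine Fintype.expect_equiv e _ _ fun i => ?_
    exact Fintype.expect_equiv e _ _ fun j => rfl
  · congr 1
    refine Finset.sum_congr rfl fun b _ => ?_
    rw [Fintype.expect_equiv e (fun i => φ (e i) b) (fun i => φ i b) fun i => rfl]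

lemma partOpt_comp (e : κ ≃ ι) (H : ι → ι → ℝ) :
    partOpt D c (fun i j => H (e i) (e j)) = partOpt D c H := by
  unfold partOpt
  rw [← (e.arrowCongr (Equiv.refl B)).symm.iSup_congr fun a => ?_]
  exact fracVal_comp e H (vertex a)

/-- A coordinate-change bound for pairs. -/
lemma expect_expect_ite_le [DecidableEq ι] [Nonempty ι] (i₀ : ι) :
    𝔼 i : ι, 𝔼 j : ι, ((if i = i₀ then (1 : ℝ) else 0) + if j = i₀ then 1 else 0)
      = 2 / Fintype.card ι := by
  simp only [Finset.expect_add_distrib, Fintype.expect_const]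
  simp [NNRat.smul_def]
  ring

/-- A proportion 2/|ι| of the index pairs involves the changed point, and each entry moves by at
most 2. -/
lemma bddDiff_partOpt [DecidableEq ι] [Nonempty ι] [Nonempty B] {α : Type} [Fintype α]
    (hD : ∀ a b, |D a b| ≤ 1) {G : α → α → ℝ} (hG : ∀ x y, |G x y| ≤ 1) :
    BddDiff (4 / Fintype.card ι) (fun y : ι → α => partOpt D c (fun i j => G (y i) (y j))) := by
  intro y i₀ v
  refine (abs_partOpt_sub_le hD _ _).trans ?_
  calc _ ≤ 𝔼 i : ι, 𝔼 j : ι, 2 * ((if i = i₀ then (1 : ℝ) else 0) + if j = i₀ then 1 else 0) := by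
        refine expect_mono fun i => expect_mono fun j => ?_
        have h2 : ∀ x y x' y', |G x y - G x' y'| ≤ 2 := fun x y x' y' =>
          (abs_sub _ _).trans (by linarith [hG x y, hG x' y'])
        by_cases hi : i = i₀
        · refine (h2 _ _ _ _).trans ?_
          simp only [hi, if_true]
          split_ifs <;> norm_num
        · by_cases hj : j = i₀
          · refine (h2 _ _ _ _).trans ?_
            simp [hj, hi]
          · simp [hi, hj]
    _ = 4 / Fintype.card ι := by
        simp only [← Finset.mul_expect]
        rw [expect_expect_ite_le]
        ring

/-- Stands in for Cauchy–Schwarz: it turns second moment bounds into first moment bounds, with a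
free parameter `s`. -/
lemma abs_le_add_sq_div {x s : ℝ} (hs : 0 < s) : |x| ≤ s + x ^ 2 / s := by
  rw [← sq_abs, ← sub_le_iff_le_add', le_div_iff₀ hs]
  nlinarith [sq_nonneg (|x| - s), abs_nonneg x]

/-- Concentration of the empirical distribution of the labels of independent samples. -/
lemma pexp_marg_dev_le [DecidableEq ι] [Nonempty ι] [Nonempty B] {β : Type*} [Fintype β]
    {p : ι → β → ℝ} (hp : IsProb p) (l : β → B) {δ : ℝ} (hδ : 0 < δ) :
    pexp p (fun w => ∑ b, |marg (vertex fun i => l (w i)) b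
        - 𝔼 i, ∑ v, p i v * if l v = b then 1 else 0|)
      ≤ δ + Fintype.card B / (Fintype.card ι * δ) := by
  set k : ℝ := (Fintype.card ι : ℝ) with hk
  set q : ℝ := (Fintype.card B : ℝ) with hq
  have hkpos : 0 < k := by rw [hk]; exact_mod_cast Fintype.card_pos
  have hqpos : 0 < q := by rw [hq]; exact_mod_cast Fintype.card_pos
  set r : ι → B → ℝ := fun i b => ∑ v, p i v * if l v = b then 1 else 0 with hr
  have hr0 : ∀ i b, 0 ≤ r i b := fun i b =>
    Finset.sum_nonneg fun v _ => mul_nonneg (hp.nonneg i v) (by positivity)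
  have hr1 : ∀ i, ∑ b, r i b = 1 := fun i => by
    simp only [hr]
    rw [Finset.sum_comm]
    simp [hp.sum_eq]
  set F : B → ι → (ι → β) → ℝ := fun b i w => (if l (w i) = b then 1 else 0) - r i b with hF
  have hX : ∀ b w, marg (vertex fun i => l (w i)) b - 𝔼 i, r i b = (∑ i, F b i w) / k := by
    intro b w
    rw [marg, ← Finset.expect_sub_distrib, Fintype.expect_eq_sum_div_card]
    rfl
  -- The variance of an indicator is at most its mean. Summed over the labels this gives one unit
  -- per sample point, so that the final bound has a single factor q.
  have hvar : ∀ b, pexp p (fun w => (∑ i, F b i w) ^ 2) ≤ ∑ i, r i b := by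
    intro b
    rw [pexp_sq_sum hp]
    · refine Finset.sum_le_sum fun i _ => ?_
      have h1 : ∀ w, F b i w ^ 2 = (1 - 2 * r i b) * (if l (w i) = b then 1 else 0) + r i b ^ 2 := by
        intro w
        simp only [hF]
        split_ifs <;> ring
      simp only [h1]
      rw [pexp_add, pexp_mul_left, pexp_const hp,
        pexp_apply hp i (fun v => if l v = b then (1 : ℝ) else 0)]
      change (1 - 2 * r i b) * r i b + r i b ^ 2 ≤ r i b
      nlinarith [sq_nonneg (r i b)]
    · intro i _ w
      simp only [resample, hF, Function.update_self, mul_sub, Finset.sum_sub_distrib,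
        ← Finset.sum_mul, hp.sum_eq, one_mul]
      exact sub_self _
    · intro i _ j _ hij w v
      simp only [hF, Function.update_of_ne hij.symm]
  calc _ ≤ pexp p (fun w => ∑ b, (δ / q + (q / (δ * k ^ 2)) * (∑ i, F b i w) ^ 2)) := by
        refine pexp_mono hp fun w => Finset.sum_le_sum fun b _ => ?_
        rw [hX]
        refine (abs_le_add_sq_div (div_pos hδ hqpos)).trans (le_of_eq ?_)
        field_simp
    _ = ∑ b, (δ / q + (q / (δ * k ^ 2)) * pexp p (fun w => (∑ i, F b i w) ^ 2)) := by
        rw [pexp_sum]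
        refine Finset.sum_congr rfl fun b _ => ?_
        rw [pexp_add, pexp_const hp, pexp_mul_left]
    _ ≤ ∑ b, (δ / q + (q / (δ * k ^ 2)) * ∑ i, r i b) :=
        Finset.sum_le_sum fun b _ => add_le_add le_rfl
          (mul_le_mul_of_nonneg_left (hvar b) (by positivity))
    _ = δ + q / (k * δ) := by
        rw [Finset.sum_add_distrib, ← Finset.mul_sum, Finset.sum_comm]
        simp only [hr1, Finset.sum_const, Finset.card_univ, nsmul_eq_mul, ← hq, ← hk]
        field_simp

/-- Independence factorizes every off-diagonal pair; the diagonal is a proportion 1/|ι| of the pairs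
and costs at most 2 each. -/
lemma pexp_abs_quad_dev [DecidableEq ι] [Nonempty ι] {β : Type*} [Fintype β]
    {p : ι → β → ℝ} (hp : IsProb p) (f : ι → ι → β → β → ℝ) (hf : ∀ i j a b, |f i j a b| ≤ 1) :
    (𝔼 i, 𝔼 j, ∑ a, ∑ b, p i a * p j b * f i j a b) - 2 / Fintype.card ι
      ≤ pexp p (fun w => 𝔼 i, 𝔼 j, f i j (w i) (w j)) := by
  classical
  have h1 : pexp p (fun w => 𝔼 i, 𝔼 j, f i j (w i) (w j))
      = 𝔼 i, 𝔼 j, pexp p (fun w => f i j (w i) (w j)) := by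
    simp only [Fintype.expect_eq_sum_div_card, div_eq_inv_mul]
    rw [pexp_mul_left, pexp_sum]
    congr 1
    refine Finset.sum_congr rfl fun i _ => ?_
    rw [pexp_mul_left, pexp_sum]
  rw [h1, sub_le_iff_le_add]
  have hk : 2 / (Fintype.card ι : ℝ) = 𝔼 i : ι, 𝔼 j : ι, if i = j then (2 : ℝ) else 0 := by
    simp [NNRat.smul_def, div_eq_inv_mul]
  rw [hk, ← Finset.expect_add_distrib]
  refine expect_mono fun i => ?_
  rw [← Finset.expect_add_distrib]
  refine expect_mono fun j => ?_
  by_cases hij : i = j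
  · subst hij
    have h2 := (abs_le.mp (sum_sum_mul_le (hp.nonneg i) (hp.sum_eq i) (hp.nonneg i)
      (hp.sum_eq i) (hf i i))).2
    have h3 : -1 ≤ pexp p (fun w => f i i (w i) (w i)) :=
      (pexp_const hp (-1)).symm.le.trans (pexp_mono hp fun w => (abs_le.mp (hf i i _ _)).1)
    simp only [if_true]
    linarith
  · rw [if_neg hij, add_zero, pexp_apply₂ hp hij]

/-- Randomized rounding. -/
lemma fracVal_le_partOpt_add [DecidableEq ι] [Nonempty ι] [Nonempty B] (hD : ∀ a b, |D a b| ≤ 1)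
    {H : ι → ι → ℝ} (hH : ∀ i j, |H i j| ≤ 1) {φ : ι → B → ℝ} (hφ : IsProb φ) {δ : ℝ}
    (hδ : 0 < δ) :
    fracVal D c H φ ≤ partOpt D c H
      + (2 / Fintype.card ι + 4 * (δ + Fintype.card B / (Fintype.card ι * δ))) := by
  obtain ⟨a, ha⟩ := exists_pexp_le hφ (fun a => fracVal D c H (vertex a))
  refine le_trans ?_ (add_le_add (ha.trans (fracVal_le_partOpt H a)) le_rfl)
  have h1 := pexp_abs_quad_dev hφ (fun i j a b => D a b * H i j) (fun i j a b => by
    rw [abs_mul]; exact mul_le_one₀ (hD a b) (abs_nonneg _) (hH i j))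
  have h2 := pexp_marg_dev_le hφ (fun b : B => b) hδ
  have h3 : ∀ a : ι → B, quad D H (vertex a) - 4 * (∑ b, |marg φ b - c b|)
      - 4 * ∑ b, |marg (vertex a) b - marg φ b| ≤ fracVal D c H (vertex a) := by
    intro a
    have : ∑ b, |marg (vertex a) b - c b| ≤ ∑ b, |marg φ b - c b|
        + ∑ b, |marg (vertex a) b - marg φ b| := by
      rw [← Finset.sum_add_distrib]
      refine Finset.sum_le_sum fun b _ => ?_
      rw [add_comm]
      exact abs_sub_le _ _ _
    unfold fracVal
    linarith
  have h4 := pexp_mono hφ h3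
  simp only [pexp_sub, pexp_mul_left, pexp_const hφ, quad_vertex] at h4
  have h5 : ∀ b, 𝔼 i, ∑ v, φ i v * (if v = b then 1 else 0) = marg φ b := fun b => by
    simp [marg]
  simp only [h5] at h2
  have h6 : 𝔼 i, 𝔼 j, ∑ a, ∑ b, φ i a * φ j b * (D a b * H i j) = quad D H φ := by
    simp only [quad, mul_assoc]
  rw [h6] at h1
  unfold fracVal
  unfold fracVal at h4
  simp only [quad_vertex] at h4 ⊢
  linarith

lemma expect_expect_apply {α : Type*} [Fintype α] [Nonempty α] (f : α → α → ℝ) :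
    ∑ a, ∑ b, ((Fintype.card α : ℝ))⁻¹ * ((Fintype.card α : ℝ))⁻¹ * f a b
      = 𝔼 a, 𝔼 b, f a b := by
  simp only [Fintype.expect_eq_sum_div_card, div_eq_inv_mul, Finset.mul_sum, mul_assoc]

/-- Restricting an optimal labelling to a random sample. -/
lemma partOpt_le_expect_partOpt [DecidableEq ι] [Nonempty ι] [Nonempty B] {α : Type} [Fintype α]
    [Nonempty α] (hD : ∀ a b, |D a b| ≤ 1) {G : α → α → ℝ} (hG : ∀ x y, |G x y| ≤ 1) {δ : ℝ}
    (hδ : 0 < δ) :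
    partOpt D c G ≤ 𝔼 y : ι → α, partOpt D c (fun i j => G (y i) (y j))
      + (2 / Fintype.card ι + 4 * (δ + Fintype.card B / (Fintype.card ι * δ))) := by
  obtain ⟨a, ha⟩ := exists_partOpt_eq D c G
  have hp : IsProb (fun (_ : ι) (_ : α) => ((Fintype.card α : ℝ))⁻¹) := isProb_uniform
  rw [← pexp_uniform, ← ha]
  have h1 := pexp_abs_quad_dev hp (fun _ _ x y => D (a x) (a y) * G x y) (fun i j x y => by
    rw [abs_mul]; exact mul_le_one₀ (hD _ _) (abs_nonneg _) (hG x y))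
  have h2 := pexp_marg_dev_le hp a hδ
  simp only [expect_expect_apply, Fintype.expect_const] at h1
  have h5 : ∀ b, ∑ v, ((Fintype.card α : ℝ))⁻¹ * (if a v = b then 1 else 0)
      = marg (vertex a) b := fun b => by
    rw [marg, Fintype.expect_eq_sum_div_card, ← Finset.mul_sum, div_eq_inv_mul]
    rfl
  simp only [h5, Fintype.expect_const] at h2
  have h3 : ∀ y : ι → α, (𝔼 i, 𝔼 j, D (a (y i)) (a (y j)) * G (y i) (y j))
      - 4 * (∑ b, |marg (vertex a) b - c b|)
      - 4 * ∑ b, |marg (vertex fun i => a (y i)) b - marg (vertex a) b|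
      ≤ partOpt D c (fun i j => G (y i) (y j)) := by
    intro y
    have : ∑ b, |marg (vertex fun i => a (y i)) b - c b| ≤ ∑ b, |marg (vertex a) b - c b|
        + ∑ b, |marg (vertex fun i => a (y i)) b - marg (vertex a) b| := by
      rw [← Finset.sum_add_distrib]
      refine Finset.sum_le_sum fun b _ => ?_
      rw [add_comm]
      exact abs_sub_le _ _ _
    refine le_trans ?_ (fracVal_le_partOpt _ (fun i => a (y i)))
    unfold fracVal
    rw [quad_vertex]
    linarith
  have h4 := pexp_mono hp h3
  simp only [pexp_sub, pexp_mul_left, pexp_const hp] at h4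
  unfold fracVal
  rw [quad_vertex]
  linarith

end PartitionProblem

/-! ### Linearization at a guessed field and minimax duality. -/

section Duality

variable {ι B : Type*} [Fintype ι] [Fintype B] [DecidableEq B]

/-- The linear field created by a fractional labelling. -/
def field (D : B → B → ℝ) (H : ι → ι → ℝ) (φ : ι → B → ℝ) (i : ι) (b : B) : ℝ :=
  𝔼 j, ∑ b', φ j b' * D b b' * H i j

/-- The transposed linear field created by a dual labelling. -/
def score (D : B → B → ℝ) (H : ι → ι → ℝ) (θ : ι → B → ℝ) (j : ι) (b : B) : ℝ :=
  𝔼 i, ∑ b', θ i b' * D b' b * H i j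

/-- Lagrangian of the labelling problem linearized at the guess `g` of the field: `θ` penalizes
wrong guesses and `π` penalizes wrong label fractions. -/
def lagr (D : B → B → ℝ) (c : B → ℝ) (H : ι → ι → ℝ) (g : ι → B → ℝ) (θ : ι → B → ℝ) (π : B → ℝ)
    (φ : ι → B → ℝ) : ℝ :=
  (𝔼 i, ∑ b, φ i b * g i b) + (𝔼 i, ∑ b, θ i b * (field D H φ i b - g i b))
    - ∑ b, π b * (marg φ b - c b)

/-- Maximum of the Lagrangian over all fractional labellings. -/
def dual (D : B → B → ℝ) (c : B → ℝ) (H : ι → ι → ℝ) (g : ι → B → ℝ) (θ : ι → B → ℝ)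
    (π : B → ℝ) : ℝ :=
  (𝔼 j, ⨆ b, (g j b + score D H θ j b - π b)) - (𝔼 i, ∑ b, θ i b * g i b) + ∑ b, π b * c b

variable {D : B → B → ℝ} {c : B → ℝ} {H : ι → ι → ℝ} {g θ φ : ι → B → ℝ} {π : B → ℝ}

/-- `score` is the adjoint of `field`: exchange the order of summation. -/
lemma expect_sum_mul_field :
    𝔼 i, ∑ b, θ i b * field D H φ i b = 𝔼 j, ∑ b, φ j b * score D H θ j b := by
  simp only [field, score, Fintype.expect_eq_sum_div_card, Finset.mul_sum, Finset.sum_div,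
    mul_div_assoc']
  calc _ = ∑ i, ∑ j, ∑ b, ∑ b', θ i b * (φ j b' * D b b' * H i j) / (Fintype.card ι : ℝ)
            / (Fintype.card ι : ℝ) :=
        Finset.sum_congr rfl fun i _ => Finset.sum_comm
    _ = ∑ j, ∑ i, ∑ b', ∑ b, θ i b * (φ j b' * D b b' * H i j) / (Fintype.card ι : ℝ)
            / (Fintype.card ι : ℝ) := by
        rw [Finset.sum_comm]
        exact Finset.sum_congr rfl fun j _ => Finset.sum_congr rfl fun i _ => Finset.sum_comm
    _ = _ := by
        refine Finset.sum_congr rfl fun j _ => ?_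
        rw [Finset.sum_comm]
        refine Finset.sum_congr rfl fun b' _ => Finset.sum_congr rfl fun i _ =>
          Finset.sum_congr rfl fun b _ => ?_
        ring

lemma lagr_eq :
    lagr D c H g θ π φ = (𝔼 j, ∑ b, φ j b * (g j b + score D H θ j b - π b))
      - (𝔼 i, ∑ b, θ i b * g i b) + ∑ b, π b * c b := by
  have h1 : ∑ b, π b * (marg φ b - c b) = (𝔼 j, ∑ b, φ j b * π b) - ∑ b, π b * c b := by
    simp only [mul_sub, Finset.sum_sub_distrib]
    congr 1
    rw [Finset.expect_sum_comm]
    refine Finset.sum_congr rfl fun b _ => ?_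
    rw [← Finset.expect_mul, mul_comm]
    rfl
  have h2 : 𝔼 j, ∑ b, φ j b * (g j b + score D H θ j b - π b)
      = (𝔼 j, ∑ b, φ j b * g j b) + (𝔼 j, ∑ b, φ j b * score D H θ j b)
        - 𝔼 j, ∑ b, φ j b * π b := by
    simp only [mul_sub, mul_add, Finset.sum_sub_distrib, Finset.sum_add_distrib,
      Finset.expect_sub_distrib, Finset.expect_add_distrib]
  have h3 : 𝔼 i, ∑ b, θ i b * (field D H φ i b - g i b)
      = (𝔼 j, ∑ b, φ j b * score D H θ j b) - 𝔼 i, ∑ b, θ i b * g i b := by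
    rw [← expect_sum_mul_field]
    simp only [mul_sub, Finset.sum_sub_distrib, Finset.expect_sub_distrib]
  rw [lagr, h1, h2, h3]
  ring

/-- By `lagr_eq` the Lagrangian is linear in `φ`, separately at each vertex, so it is bounded by
putting all mass on the best label. -/
lemma lagr_le_dual (hφ : IsProb φ) : lagr D c H g θ π φ ≤ dual D c H g θ π := by
  rw [lagr_eq, dual]
  refine add_le_add (sub_le_sub ?_ le_rfl) le_rfl
  refine expect_mono fun j => ?_
  calc _ ≤ ∑ b, φ j b * ⨆ b, (g j b + score D H θ j b - π b) :=
        Finset.sum_le_sum fun b _ => mul_le_mul_of_nonneg_left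
          (le_ciSup (f := fun b => g j b + score D H θ j b - π b)
            (Set.finite_range _).bddAbove b) (hφ.nonneg j b)
    _ = _ := by rw [← Finset.sum_mul, hφ.sum_eq, one_mul]

lemma exists_lagr_eq_dual [Nonempty B] (D : B → B → ℝ) (c : B → ℝ) (H : ι → ι → ℝ)
    (g θ : ι → B → ℝ) (π : B → ℝ) :
    ∃ a : ι → B, lagr D c H g θ π (vertex a) = dual D c H g θ π := by
  have h : ∀ j, ∃ b, (g j b + score D H θ j b - π b)
      = ⨆ b, (g j b + score D H θ j b - π b) := fun j =>
    exists_eq_ciSup_of_finite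
  choose a ha using h
  refine ⟨a, ?_⟩
  rw [lagr_eq, dual]
  congr 2
  refine Finset.expect_congr rfl fun j _ => ?_
  rw [← ha j]
  simp [vertex]

/-- The Lagrangian at `θ = φ` recovers the penalized problem. -/
lemma lagr_self (φ : ι → B → ℝ) :
    lagr D c H g φ (fun b => 4 * SignType.sign (marg φ b - c b)) φ = fracVal D c H φ := by
  unfold lagr fracVal
  congr 1
  -- For `θ = φ` the two occurrences of the guess cancel, whatever `g` is, and the quadratic form is
  -- left.
  · simp only [mul_sub, Finset.sum_sub_distrib, Finset.expect_sub_distrib, add_sub_cancel]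
    simp only [field, quad, Finset.mul_expect, Finset.mul_sum]
    refine Finset.expect_congr rfl fun i _ => ?_
    rw [← Finset.expect_sum_comm]
    refine Finset.expect_congr rfl fun j _ => Finset.sum_congr rfl fun a _ =>
      Finset.sum_congr rfl fun b _ => ?_
    ring
  · rw [Finset.mul_sum]
    refine Finset.sum_congr rfl fun b _ => ?_
    rw [mul_assoc, sign_mul_self]

lemma lagr_affine_right {s t : ℝ} (hst : s + t = 1) (φ φ' : ι → B → ℝ) :
    lagr D c H g θ π (s • φ + t • φ') = s * lagr D c H g θ π φ + t * lagr D c H g θ π φ' := by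
  have h1 : 𝔼 j, ∑ b, (s • φ + t • φ') j b * (g j b + score D H θ j b - π b)
      = s * (𝔼 j, ∑ b, φ j b * (g j b + score D H θ j b - π b))
        + t * 𝔼 j, ∑ b, φ' j b * (g j b + score D H θ j b - π b) := by
    simp only [Finset.mul_expect, Finset.mul_sum, ← Finset.expect_add_distrib,
      ← Finset.sum_add_distrib]
    refine Finset.expect_congr rfl fun j _ => Finset.sum_congr rfl fun b _ => ?_
    simp only [Pi.add_apply, Pi.smul_apply, smul_eq_mul]
    ring
  rw [lagr_eq, lagr_eq, lagr_eq, h1]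
  have : t = 1 - s := by linarith
  subst this
  ring

lemma lagr_affine_left {s t : ℝ} (hst : s + t = 1) (x x' : (ι → B → ℝ) × (B → ℝ)) :
    lagr D c H g (s • x + t • x').1 (s • x + t • x').2 φ
      = s * lagr D c H g x.1 x.2 φ + t * lagr D c H g x'.1 x'.2 φ := by
  have h1 : 𝔼 i, ∑ b, (s • x + t • x').1 i b * (field D H φ i b - g i b)
      = s * (𝔼 i, ∑ b, x.1 i b * (field D H φ i b - g i b))
        + t * 𝔼 i, ∑ b, x'.1 i b * (field D H φ i b - g i b) := by
    simp only [Finset.mul_expect, Finset.mul_sum, ← Finset.expect_add_distrib,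
      ← Finset.sum_add_distrib]
    refine Finset.expect_congr rfl fun j _ => Finset.sum_congr rfl fun b _ => ?_
    simp only [Prod.fst_add, Prod.smul_fst, Pi.add_apply, Pi.smul_apply, smul_eq_mul]
    ring
  have h2 : ∑ b, (s • x + t • x').2 b * (marg φ b - c b)
      = s * (∑ b, x.2 b * (marg φ b - c b)) + t * ∑ b, x'.2 b * (marg φ b - c b) := by
    simp only [Finset.mul_sum, ← Finset.sum_add_distrib]
    refine Finset.sum_congr rfl fun b _ => ?_
    simp only [Prod.snd_add, Prod.smul_snd, Pi.add_apply, Pi.smul_apply, smul_eq_mul]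
    ring
  rw [lagr, lagr, lagr, h1, h2]
  have : t = 1 - s := by linarith
  subst this
  ring

/-- The Lagrangian dominates the penalized problem up to the error of the guess. -/
lemma fracVal_le_lagr_add (hφ : IsProb φ) (hθ : IsProb θ) (hπ : ∀ b, |π b| ≤ 4) {ξ : ι → ℝ}
    (hξ : ∀ i b, |field D H φ i b - g i b| ≤ ξ i) :
    fracVal D c H φ ≤ lagr D c H g θ π φ + 2 * 𝔼 i, ξ i := by
  rw [← lagr_self]
  have h1 : ∀ ψ : ι → B → ℝ, IsProb ψ → ∀ i, |∑ b, ψ i b * (field D H φ i b - g i b)| ≤ ξ i :=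
    fun ψ hψ i => abs_sum_mul_le (hψ.nonneg i) (hψ.sum_eq i) (hξ i)
  have h2 : 𝔼 i, ∑ b, φ i b * (field D H φ i b - g i b) ≤ 𝔼 i, ξ i :=
    expect_mono fun i => (abs_le.mp (h1 φ hφ i)).2
  have h3 : -𝔼 i, ξ i ≤ 𝔼 i, ∑ b, θ i b * (field D H φ i b - g i b) := by
    rw [← Finset.expect_neg_distrib]
    exact expect_mono fun i => (abs_le.mp (h1 θ hθ i)).1
  have h4 : ∑ b, π b * (marg φ b - c b)
      ≤ ∑ b, 4 * SignType.sign (marg φ b - c b) * (marg φ b - c b) := by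
    refine Finset.sum_le_sum fun b _ => ?_
    rw [mul_assoc, sign_mul_self]
    refine (le_abs_self _).trans ?_
    rw [abs_mul]
    exact mul_le_mul_of_nonneg_right (hπ b) (abs_nonneg _)
  unfold lagr
  linarith

/-- Fractional labellings. -/
def probSet (ι B : Type*) [Fintype B] : Set (ι → B → ℝ) := Set.univ.pi fun _ => stdSimplex ℝ B

lemma mem_probSet : φ ∈ probSet ι B ↔ IsProb φ :=
  ⟨fun h => ⟨fun i b => (h i trivial).1 b, fun i => (h i trivial).2⟩,
    fun h i _ => ⟨h.nonneg i, h.sum_eq i⟩⟩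

lemma quasiconvexOn_of_affine {E : Type*} [AddCommGroup E] [Module ℝ E] {X : Set E}
    (hX : Convex ℝ X) {f : E → ℝ}
    (hf : ∀ s t : ℝ, s + t = 1 → ∀ x x', f (s • x + t • x') = s * f x + t * f x') :
    QuasiconvexOn ℝ X f ∧ QuasiconcaveOn ℝ X f :=
  ⟨ConvexOn.quasiconvexOn ⟨hX, fun x _ y _ a b _ _ hab => (hf a b hab x y).le⟩,
    ConcaveOn.quasiconcaveOn ⟨hX, fun x _ y _ a b _ _ hab => (hf a b hab x y).ge⟩⟩

/-- Minimax: some multipliers certify an upper bound close to the integral optimum. -/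
lemma exists_dual_le [DecidableEq ι] [Nonempty ι] [Nonempty B] (hD : ∀ a b, |D a b| ≤ 1)
    (hH : ∀ i j, |H i j| ≤ 1) (c : B → ℝ) (g : ι → B → ℝ) {δ : ℝ} (hδ : 0 < δ) :
    ∃ θ : ι → B → ℝ, ∃ π : B → ℝ, IsProb θ ∧ (∀ b, |π b| ≤ 4) ∧
      dual D c H g θ π ≤ partOpt D c H
      + (2 / Fintype.card ι + 4 * (δ + Fintype.card B / (Fintype.card ι * δ))) := by
  have cY : Convex ℝ (probSet ι B) := convex_pi fun _ _ => convex_stdSimplex ℝ B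
  have kY : IsCompact (probSet ι B) := isCompact_univ_pi fun _ => isCompact_stdSimplex ℝ B
  have neY : (probSet ι B).Nonempty :=
    ⟨vertex fun _ => Classical.arbitrary B, mem_probSet.mpr (isProb_vertex _)⟩
  set P : Set (B → ℝ) := Set.univ.pi fun _ => Set.Icc (-4) 4 with hP
  have cP : Convex ℝ P := convex_pi fun _ _ => convex_Icc _ _
  have kP : IsCompact P := isCompact_univ_pi fun _ => isCompact_Icc
  have neP : P.Nonempty := ⟨0, fun b _ => by simp⟩
  -- The Lagrangian is affine in the multipliers and in `φ` separately, over compact convex sets.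
  -- The multipliers minimize and the labelling maximizes.
  obtain ⟨x, hx, y, hy, hs⟩ := Sion.exists_isSaddlePointOn (X := probSet ι B ×ˢ P)
    (Y := probSet ι B) (f := fun x φ => lagr D c H g x.1 x.2 φ)
    (neY.prod neP) (cY.prod cP) (kY.prod kP)
    (fun φ _ => by
      refine Continuous.lowerSemicontinuous ?_ |>.lowerSemicontinuousOn _
      simp only [lagr, Fintype.expect_eq_sum_div_card]
      fun_prop)
    (fun φ _ => (quasiconvexOn_of_affine (cY.prod cP) fun s t h x x' =>
      lagr_affine_left h x x').1)
    cY neY kY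
    (fun x _ => by
      refine Continuous.upperSemicontinuous ?_ |>.upperSemicontinuousOn _
      simp only [lagr, field, marg, Fintype.expect_eq_sum_div_card]
      fun_prop)
    (fun x _ => (quasiconvexOn_of_affine cY fun s t h φ φ' => lagr_affine_right h φ φ').2)
  refine ⟨x.1, x.2, mem_probSet.mp hx.1, fun b => abs_le.mpr (hx.2 b trivial), ?_⟩
  obtain ⟨a, ha⟩ := exists_lagr_eq_dual D c H g x.1 x.2
  rw [← ha]
  have hy' := mem_probSet.mp hy
  -- At the saddle point the minimizer may answer `y` with `θ = y` and the sign multipliers. This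
  -- recovers the penalized value of `y`, which rounding compares with `partOpt`; the quality of the
  -- guess plays no role.
  have h1 := hs (y, fun b => 4 * SignType.sign (marg y b - c b)) ⟨hy, fun b _ => by
    rcases lt_trichotomy (marg y b - c b) 0 with h | h | h
    · simp [sign_neg h]
    · simp [h]
    · simp [sign_pos h]⟩ (vertex a) (mem_probSet.mpr (isProb_vertex a))
  simp only [lagr_self] at h1
  exact h1.trans (fracVal_le_partOpt_add hD hH hy' hδ)

end Duality

/-! ### The dual function on a random sample. -/

section DualSampling

variable {ι B : Type*} [Fintype ι] [DecidableEq ι] [Nonempty ι] [Fintype B] [DecidableEq B]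
  [Nonempty B] {α : Type} [Fintype α] [Nonempty α]

/-- The dual function of a sample. -/
def sampleDual (D : B → B → ℝ) (c : B → ℝ) (G : α → α → ℝ) (g θ : α → B → ℝ) (π : B → ℝ)
    (w : ι → α) : ℝ :=
  dual D c (fun i j => G (w i) (w j)) (fun i => g (w i)) (fun i => θ (w i)) π

variable {D : B → B → ℝ} {c : B → ℝ} {G : α → α → ℝ} {g θ : α → B → ℝ} {π : B → ℝ}

lemma abs_ciSup_sub_le {f f' : B → ℝ} {e : ℝ} (h : ∀ b, |f b - f' b| ≤ e) :
    |(⨆ b, f b) - ⨆ b, f' b| ≤ e := by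
  refine abs_le.mpr ⟨?_, ?_⟩
  · have : ⨆ b, f' b ≤ (⨆ b, f b) + e := ciSup_le fun b => by
      have := le_ciSup (f := f) (Set.finite_range _).bddAbove b
      linarith [(abs_le.mp (h b)).1]
    linarith
  · have : ⨆ b, f b ≤ (⨆ b, f' b) + e := ciSup_le fun b => by
      have := le_ciSup (f := f') (Set.finite_range _).bddAbove b
      linarith [(abs_le.mp (h b)).2]
    linarith

/-- The dual does not see the order of the sample, so rearranging points only changes which of them
are distinguished. -/
lemma sampleDual_comp (e : ι ≃ ι) (w : ι → α) :
    sampleDual D c G g θ π (fun i => w (e i)) = sampleDual D c G g θ π w := by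
  unfold sampleDual dual
  congr 1
  congr 1
  · refine Fintype.expect_equiv e _ _ fun j => ?_
    congr 1
    ext b
    congr 2
    exact Fintype.expect_equiv e _ _ fun i => rfl
  · exact Fintype.expect_equiv e _ _ fun i => rfl

lemma expect_ite_eq_inv (i₀ : ι) (x : ℝ) :
    𝔼 i : ι, (if i = i₀ then x else 0) = x / Fintype.card ι := by
  simp [NNRat.smul_def, div_eq_inv_mul]

lemma abs_cross_le (hD : ∀ a b, |D a b| ≤ 1) (hG : ∀ x y, |G x y| ≤ 1) (hθ : IsProb θ) (x y : α)
    (b : B) : |∑ b', θ x b' * D b' b * G x y| ≤ 1 := by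
  simp only [mul_assoc]
  refine abs_sum_mul_le (hθ.nonneg x) (hθ.sum_eq x) fun b' => ?_
  rw [abs_mul]
  exact mul_le_one₀ (hD _ _) (abs_nonneg _) (hG x y)

/-- Moving one point changes its own supremum by at most 4, every other supremum by 2/k through the
score, and one term of the average of θ·g by 2. The total is (4 + 2 + 2)/k. -/
lemma bddDiff_sampleDual (hD : ∀ a b, |D a b| ≤ 1) (hG : ∀ x y, |G x y| ≤ 1)
    (hg : ∀ x b, |g x b| ≤ 1) (hθ : IsProb θ) :
    BddDiff (8 / Fintype.card ι) (fun w : ι → α => sampleDual D c G g θ π w) := by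
  intro w i₀ v
  set w' := Function.update w i₀ v with hw'
  have hne : ∀ i, i ≠ i₀ → w' i = w i := fun i hi => Function.update_of_ne hi _ _
  set C : α → α → B → ℝ := fun x y b => ∑ b', θ x b' * D b' b * G x y with hC
  have hCb : ∀ x y b, |C x y b| ≤ 1 := fun x y b => abs_cross_le hD hG hθ x y b
  have hA : ∀ x, |∑ b, θ x b * g x b| ≤ 1 := fun x =>
    abs_sum_mul_le (hθ.nonneg x) (hθ.sum_eq x) (hg x)
  have hscore : ∀ (u : ι → α) j b, score D (fun i j => G (u i) (u j)) (fun i => θ (u i)) j b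
      = 𝔼 i, C (u i) (u j) b := fun _ _ _ => rfl
  have hsc : ∀ j b, j ≠ i₀ → |(𝔼 i, C (w' i) (w' j) b) - 𝔼 i, C (w i) (w j) b|
      ≤ 2 / Fintype.card ι := by
    intro j b hj
    rw [hne j hj, ← Finset.expect_sub_distrib, ← expect_ite_eq_inv i₀]
    refine abs_le.mpr ⟨?_, ?_⟩
    · rw [← Finset.expect_neg_distrib]
      refine expect_mono fun i => ?_
      split_ifs with h
      · linarith [(abs_le.mp (hCb (w' i) (w j) b)).1, (abs_le.mp (hCb (w i) (w j) b)).2]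
      · rw [hne i h]; simp
    · refine expect_mono fun i => ?_
      split_ifs with h
      · linarith [(abs_le.mp (hCb (w' i) (w j) b)).2, (abs_le.mp (hCb (w i) (w j) b)).1]
      · rw [hne i h]; simp
  have hsup : ∀ j, |(⨆ b, (g (w' j) b + (𝔼 i, C (w' i) (w' j) b) - π b))
      - ⨆ b, (g (w j) b + (𝔼 i, C (w i) (w j) b) - π b)|
      ≤ 2 / Fintype.card ι + if j = i₀ then 4 else 0 := by
    intro j
    refine abs_ciSup_sub_le fun b => ?_
    split_ifs with h
    · have e1 : |𝔼 i, C (w' i) (w' j) b| ≤ 1 := abs_expect_le zero_le_one fun i => hCb _ _ _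
      have e2 : |𝔼 i, C (w i) (w j) b| ≤ 1 := abs_expect_le zero_le_one fun i => hCb _ _ _
      have e3 := abs_le.mp (hg (w' j) b)
      have e4 := abs_le.mp (hg (w j) b)
      have e5 : (0 : ℝ) ≤ 2 / Fintype.card ι := by positivity
      rw [abs_le] at e1 e2 ⊢
      constructor <;> linarith
    · have := hsc j b h
      rw [add_zero]
      refine le_trans (le_of_eq ?_) this
      rw [hne j h]
      congr 1
      ring
  have hAd : ∀ i, |(∑ b, θ (w' i) b * g (w' i) b) - ∑ b, θ (w i) b * g (w i) b|
      ≤ if i = i₀ then 2 else 0 := by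
    intro i
    split_ifs with h
    · refine (abs_sub _ _).trans ?_
      linarith [hA (w' i), hA (w i)]
    · rw [hne i h]; simp
  have h1 : |(𝔼 j, ⨆ b, (g (w' j) b + (𝔼 i, C (w' i) (w' j) b) - π b))
      - 𝔼 j, ⨆ b, (g (w j) b + (𝔼 i, C (w i) (w j) b) - π b)| ≤ 6 / Fintype.card ι := by
    have e : (6 : ℝ) / Fintype.card ι
        = 𝔼 j : ι, (2 / (Fintype.card ι : ℝ) + if j = i₀ then 4 else 0) := by
      rw [Finset.expect_add_distrib, expect_ite_eq_inv, Fintype.expect_const]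
      ring
    rw [e, ← Finset.expect_sub_distrib]
    refine abs_le.mpr ⟨?_, expect_mono fun j => (abs_le.mp (hsup j)).2⟩
    rw [← Finset.expect_neg_distrib]
    exact expect_mono fun j => (abs_le.mp (hsup j)).1
  have h2 : |(𝔼 i, ∑ b, θ (w' i) b * g (w' i) b) - 𝔼 i, ∑ b, θ (w i) b * g (w i) b|
      ≤ 2 / Fintype.card ι := by
    rw [← expect_ite_eq_inv i₀, ← Finset.expect_sub_distrib]
    refine abs_le.mpr ⟨?_, expect_mono fun j => (abs_le.mp (hAd j)).2⟩
    rw [← Finset.expect_neg_distrib]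
    exact expect_mono fun j => (abs_le.mp (hAd j)).1
  have h3 : (8 : ℝ) / Fintype.card ι = 6 / Fintype.card ι + 2 / Fintype.card ι := by ring
  simp only [sampleDual, dual, hscore]
  rw [h3, abs_le]
  rw [abs_le] at h1 h2
  constructor <;> linarith

/-- Second moment of a sampling error. -/
lemma pexp_cross_dev_sq_le {p : ι → α → ℝ} (hp : IsProb p) {C : α → α → ℝ}
    (hC : ∀ x y, |C x y| ≤ 1) (hpc : ∀ i i' x, p i x = p i' x) (j : ι) :
    pexp p (fun w => ((𝔼 i, C (w i) (w j)) - ∑ x, p j x * C x (w j)) ^ 2)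
      ≤ 16 / Fintype.card ι := by
  set k : ℝ := (Fintype.card ι : ℝ) with hk
  have hk1 : 1 ≤ k := by rw [hk]; exact_mod_cast Fintype.card_pos
  set C' : α → α → ℝ := fun x y => C x y - ∑ x', p j x' * C x' y with hC'
  have hb : ∀ x y, |C' x y| ≤ 2 := by
    intro x y
    have := abs_sum_mul_le (hp.nonneg j) (hp.sum_eq j) fun x' => hC x' y
    exact (abs_sub _ _).trans (by linarith [hC x y])
  have hb2 : ∀ x y, C' x y ^ 2 ≤ 4 := fun x y => by
    have := sq_le_sq' (abs_le.mp (hb x y)).1 (abs_le.mp (hb x y)).2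
    linarith
  -- The diagonal term is not centred given `w j`; it is split off and bounded trivially.
  set S := Finset.univ.erase j with hS
  have hcard : (S.card : ℝ) ≤ k := by
    rw [hk]
    exact_mod_cast (Finset.card_le_univ S)
  have hvar : pexp p (fun w => (∑ i ∈ S, C' (w i) (w j)) ^ 2) ≤ 4 * k := by
    rw [pexp_sq_sum hp]
    · calc _ ≤ ∑ i ∈ S, (4 : ℝ) := Finset.sum_le_sum fun i _ =>
            (pexp_mono hp fun w => hb2 (w i) (w j)).trans (pexp_const hp 4).le
        _ ≤ 4 * k := by
            rw [Finset.sum_const, nsmul_eq_mul]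
            linarith
    · intro i hi w
      have hij : j ≠ i := (Finset.ne_of_mem_erase hi).symm
      simp only [resample, Function.update_self, Function.update_of_ne hij, hC', mul_sub,
        Finset.sum_sub_distrib, ← Finset.sum_mul, hp.sum_eq, one_mul, hpc i j]
      exact sub_self _
    · intro i hi i' _ hii w v
      have hij : j ≠ i := (Finset.ne_of_mem_erase hi).symm
      simp only [Function.update_of_ne hij, Function.update_of_ne hii.symm]
  have hpt : ∀ w : ι → α, ((𝔼 i, C (w i) (w j)) - ∑ x, p j x * C x (w j)) ^ 2
      ≤ 2 / k ^ 2 * (4 + (∑ i ∈ S, C' (w i) (w j)) ^ 2) := by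
    intro w
    have e1 : (𝔼 i, C (w i) (w j)) - ∑ x, p j x * C x (w j)
        = (C' (w j) (w j) + ∑ i ∈ S, C' (w i) (w j)) / k := by
      rw [Finset.add_sum_erase _ (fun i => C' (w i) (w j)) (Finset.mem_univ j)]
      simp only [hC', Finset.sum_sub_distrib, Finset.sum_const, Finset.card_univ, nsmul_eq_mul,
        ← hk]
      rw [Fintype.expect_eq_sum_div_card, ← hk]
      field_simp
    rw [e1, div_pow, div_mul_eq_mul_div]
    refine div_le_div_of_nonneg_right ?_ (by positivity)
    nlinarith [sq_nonneg (C' (w j) (w j) - ∑ i ∈ S, C' (w i) (w j)), hb2 (w j) (w j)]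
  refine (pexp_mono hp hpt).trans ?_
  rw [pexp_mul_left, pexp_add, pexp_const hp]
  calc _ ≤ 2 / k ^ 2 * (4 + 4 * k) := by gcongr
    _ ≤ 2 / k ^ 2 * (8 * k) := by gcongr; linarith
    _ = 16 / k := by field_simp; norm_num

/-- Given `w j`, the sampled score is an average of essentially independent terms centred at the
score in `G`. Each supremum thus exceeds its value in `G` by at most the largest deviation over the
labels, and s + Σ Δ²/s bounds this maximum without a union bound. -/
lemma expect_sampleDual_le (hD : ∀ a b, |D a b| ≤ 1) (hG : ∀ x y, |G x y| ≤ 1)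
    (hθ : IsProb θ) {s : ℝ} (hs : 0 < s) :
    𝔼 w : ι → α, sampleDual D c G g θ π w
      ≤ dual D c G g θ π + (s + 16 * Fintype.card B / (Fintype.card ι * s)) := by
  have hp : IsProb (fun (_ : ι) (_ : α) => ((Fintype.card α : ℝ))⁻¹) := isProb_uniform
  set p : ι → α → ℝ := fun _ _ => ((Fintype.card α : ℝ))⁻¹ with hpdef
  set C : B → α → α → ℝ := fun b x y => ∑ b', θ x b' * D b' b * G x y with hC
  have hCb : ∀ b x y, |C b x y| ≤ 1 := fun b x y => abs_cross_le hD hG hθ x y b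
  have hmean : ∀ (j : ι) (f : α → ℝ), ∑ x, p j x * f x = 𝔼 x, f x := fun j f => by
    rw [← Finset.mul_sum, Fintype.expect_eq_sum_div_card, div_eq_inv_mul]
  set M : α → ℝ := fun x => ⨆ b, (g x b + (𝔼 x', C b x' x) - π b) with hM
  set A : α → ℝ := fun x => ∑ b, θ x b * g x b with hA
  set Δ : B → ι → (ι → α) → ℝ := fun b j w => (𝔼 i, C b (w i) (w j)) - 𝔼 x, C b x (w j) with hΔ
  have hpt : ∀ w : ι → α, sampleDual D c G g θ π w
      ≤ (𝔼 j, (M (w j) + (s + ∑ b, Δ b j w ^ 2 / s))) - (𝔼 i, A (w i)) + ∑ b, π b * c b := by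
    intro w
    refine add_le_add (sub_le_sub ?_ le_rfl) le_rfl
    refine expect_mono fun j => ciSup_le fun b => ?_
    have e1 : score D (fun i j => G (w i) (w j)) (fun i => θ (w i)) j b
        = (𝔼 x', C b x' (w j)) + Δ b j w := by
      simp only [hΔ]
      rw [add_sub_cancel]
      rfl
    have e2 := le_ciSup (f := fun b => g (w j) b + (𝔼 x', C b x' (w j)) - π b)
      (Set.finite_range _).bddAbove b
    have e3 := (le_abs_self _).trans (abs_le_add_sq_div (x := Δ b j w) hs)
    have e4 : Δ b j w ^ 2 / s ≤ ∑ b, Δ b j w ^ 2 / s :=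
      Finset.single_le_sum (f := fun b => Δ b j w ^ 2 / s) (fun _ _ => by positivity)
        (Finset.mem_univ b)
    rw [e1]
    have e5 : g (w j) b + (𝔼 x', C b x' (w j)) - π b ≤ M (w j) := e2
    linarith
  have hk : (0 : ℝ) < Fintype.card ι := by exact_mod_cast Fintype.card_pos
  have hswap : ∀ F : ι → (ι → α) → ℝ, pexp p (fun w => 𝔼 j, F j w) = 𝔼 j, pexp p (F j) := by
    intro F
    simp only [Fintype.expect_eq_sum_div_card, div_eq_inv_mul]
    rw [pexp_mul_left, pexp_sum]
  have hsingle : ∀ f : α → ℝ, pexp p (fun w => 𝔼 j, f (w j)) = 𝔼 x, f x := by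
    intro f
    rw [hswap]
    simp only [pexp_apply hp _ f, hmean, Fintype.expect_const]
  have hdev : ∀ j b, pexp p (fun w => Δ b j w ^ 2) ≤ 16 / Fintype.card ι := by
    intro j b
    have := pexp_cross_dev_sq_le hp (hCb b) (fun _ _ _ => rfl) j
    simp only [hmean] at this
    exact this
  rw [← pexp_uniform]
  refine (pexp_mono hp hpt).trans ?_
  rw [pexp_add, pexp_sub, pexp_const hp, hsingle A]
  simp only [Finset.expect_add_distrib]
  rw [pexp_add, pexp_add, hsingle M, Fintype.expect_const, pexp_const hp, hswap]
  have h6 : 𝔼 j, pexp p (fun w => ∑ b, Δ b j w ^ 2 / s)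
      ≤ 16 * Fintype.card B / (Fintype.card ι * s) := by
    refine (expect_mono fun j => ?_).trans (Fintype.expect_const (ι := ι) _).le
    rw [pexp_sum]
    calc _ ≤ ∑ _b : B, 16 / (Fintype.card ι : ℝ) / s := by
          refine Finset.sum_le_sum fun b _ => ?_
          simp only [div_eq_inv_mul _ s]
          rw [pexp_mul_left]
          exact mul_le_mul_of_nonneg_left (hdev j b) (by positivity)
      _ = _ := by
          rw [Finset.sum_const, nsmul_eq_mul, Finset.card_univ]
          field_simp
  have h7 : dual D c G g θ π = (𝔼 x, M x) - (𝔼 x, A x) + ∑ b, π b * c b := rfl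
  rw [h7]
  linarith

end DualSampling

/-! ### Upper bound for the sampled optimum: guessed fields and a union bound over guesses. -/

section UpperBound

variable {B : Type*} [Fintype B] [DecidableEq B] [Nonempty B] {α : Type} [Fintype α] [Nonempty α]
  {D : B → B → ℝ} {c : B → ℝ} {G : α → α → ℝ}

/-- The field guessed from labelled sample points. -/
def guess {m : ℕ} (D : B → B → ℝ) (G : α → α → ℝ) (z : Fin m → α) (l : Fin m → B) (x : α) (b : B) :
    ℝ :=
  𝔼 t, D b (l t) * G x (z t)

lemma abs_guess_le {m : ℕ} (hD : ∀ a b, |D a b| ≤ 1) (hG : ∀ x y, |G x y| ≤ 1)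
    (z : Fin m → α) (l : Fin m → B) (x : α) (b : B) : |guess D G z l x b| ≤ 1 :=
  abs_expect_le zero_le_one fun t => by
    rw [abs_mul]; exact mul_le_one₀ (hD _ _) (abs_nonneg _) (hG _ _)

/-- Stratified sampling of an average over a product. -/
lemma expect_stratified_sq_le {m : ℕ} [NeZero m] {κ : Type*} [Fintype κ] [Nonempty κ]
    (X : Fin m × κ → ℝ) (hX : ∀ i, |X i| ≤ 1) :
    𝔼 r : Fin m → κ, ((𝔼 i, X i) - 𝔼 t, X (t, r t)) ^ 2 ≤ 4 / m := by
  have hp : IsProb (fun (_ : Fin m) (_ : κ) => ((Fintype.card κ : ℝ))⁻¹) := isProb_uniform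
  set p : Fin m → κ → ℝ := fun _ _ => ((Fintype.card κ : ℝ))⁻¹ with hpdef
  have hm : (0 : ℝ) < m := by exact_mod_cast Nat.pos_of_ne_zero (NeZero.ne m)
  set μ : Fin m → ℝ := fun t => 𝔼 o, X (t, o) with hμ
  have hmean : ∀ (t : Fin m) (f : κ → ℝ), ∑ x, p t x * f x = 𝔼 x, f x := fun j f => by
    rw [← Finset.mul_sum, Fintype.expect_eq_sum_div_card, div_eq_inv_mul]
  have h1 : 𝔼 i, X i = 𝔼 t, μ t := by
    rw [← Finset.univ_product_univ, Finset.expect_product]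
  rw [← pexp_uniform]
  -- The full average is the average of the stratum means, so the error is a mean of `m` independent
  -- centred terms of size at most 2.
  have h2 : ∀ r : Fin m → κ, ((𝔼 i, X i) - 𝔼 t, X (t, r t)) ^ 2
      = 1 / (m : ℝ) ^ 2 * (∑ t, (X (t, r t) - μ t)) ^ 2 := by
    intro r
    rw [h1, ← Finset.expect_sub_distrib, Fintype.expect_eq_sum_div_card, Fintype.card_fin, div_pow,
      one_div_mul_eq_div]
    congr 1
    rw [← neg_sq, ← Finset.sum_neg_distrib]
    simp
  simp only [h2]
  rw [pexp_mul_left, pexp_sq_sum hp]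
  · calc _ ≤ 1 / (m : ℝ) ^ 2 * ∑ _t : Fin m, (4 : ℝ) := by
          refine mul_le_mul_of_nonneg_left (Finset.sum_le_sum fun t _ => ?_) (by positivity)
          refine (pexp_mono hp fun r => ?_).trans (pexp_const hp 4).le
          have e1 : |μ t| ≤ 1 := abs_expect_le zero_le_one fun o => hX _
          have e2 := abs_le.mp ((abs_sub (X (t, r t)) (μ t)).trans (add_le_add (hX _) e1))
          have := sq_le_sq' e2.1 e2.2
          linarith
      _ = 4 / m := by
          simp only [Finset.sum_const, Finset.card_univ, Fintype.card_fin, nsmul_eq_mul]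
          field_simp
  · intro t _ w
    simp only [resample, Function.update_self, mul_sub, Finset.sum_sub_distrib, ← Finset.sum_mul,
      hp.sum_eq, one_mul]
    change ∑ v, p t v * X (t, v) - μ t = 0
    rw [hmean t (fun v => X (t, v)), sub_self]
  · intro t _ t' _ htt w v
    simp only [Function.update_of_ne htt.symm]

variable {m L : ℕ}

/-- Transposes, in every block, the distinguished point with the one chosen by `r`. -/
def blockSwap (r : Fin m → Option (Fin L)) :
    (Fin m × Option (Fin L)) ≃ (Fin m × Option (Fin L)) :=
  Equiv.prodShear (Equiv.refl _) fun t => Equiv.swap none (r t)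

/-- Replaces the distinguished points of all blocks. -/
def replaceHead (z : Fin m → α) (w : Fin m × Option (Fin L) → α) (i : Fin m × Option (Fin L)) : α :=
  if i.2 = none then z i.1 else w i

lemma expect_replaceHead (F : (Fin m × Option (Fin L) → α) → ℝ) :
    𝔼 w, F w = 𝔼 z : Fin m → α, 𝔼 w, F (replaceHead z w) := by
  have h : 𝔼 x : (Fin m → α) × (Fin m × Option (Fin L) → α), F (replaceHead x.1 x.2)
      = 𝔼 x : (Fin m → α) × (Fin m × Option (Fin L) → α), F x.2 := by
    -- Exchanging the distinguished points with a fresh independent copy is an involution.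
    have hinv : Function.Involutive (fun x : (Fin m → α) × (Fin m × Option (Fin L) → α) =>
        ((fun t => x.2 (t, none)), replaceHead x.1 x.2)) := by
      rintro ⟨z, w⟩
      refine Prod.ext ?_ ?_
      · funext t
        simp [replaceHead]
      · funext i
        obtain ⟨t, o⟩ := i
        cases o <;> simp [replaceHead]
    exact Fintype.expect_equiv hinv.toPerm _ _ fun x => rfl
  rw [← Finset.univ_product_univ, Finset.expect_product, Finset.expect_product] at h
  rw [h]
  exact (Fintype.expect_const (ι := Fin m → α) _).symm

/-- Expected maximum of the dual functions of finitely many guesses when the distinguished points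
are kept fixed. -/
lemma expect_iSup_sampleDual_le [NeZero m] (hD : ∀ a b, |D a b| ≤ 1) (hG : ∀ x y, |G x y| ≤ 1)
    {Λ : Type*} [Fintype Λ] [Nonempty Λ] {g θ : Λ → α → B → ℝ} {π : Λ → B → ℝ}
    (hg : ∀ l x b, |g l x b| ≤ 1) (hθ : ∀ l, IsProb (θ l)) {M s t : ℝ} (hs : 0 < s) (ht : 0 < t)
    (hM : ∀ l, dual D c G (g l) (θ l) (π l) ≤ M) (z : Fin m → α) :
    𝔼 w : Fin m × Option (Fin L) → α, (⨆ l, sampleDual D c G (g l) (θ l) (π l) (replaceHead z w))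
      ≤ M + (s + 16 * Fintype.card B / ((m * (L + 1)) * s)) + 8 / (L + 1)
        + Real.log (Fintype.card Λ) / (t * (m * (L + 1))) + 32 * t := by
  have hm0 : 0 < m := Nat.pos_of_ne_zero (NeZero.ne m)
  have hm : (0 : ℝ) < m := by exact_mod_cast hm0
  have hcard : (Fintype.card (Fin m × Option (Fin L)) : ℝ) = m * (L + 1) := by
    simp
  have hp : IsProb (fun (_ : Fin m × Option (Fin L)) (_ : α) => ((Fintype.card α : ℝ))⁻¹) :=
    isProb_uniform
  set V : Λ → (Fin m × Option (Fin L) → α) → ℝ := fun l w =>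
    sampleDual D c G (g l) (θ l) (π l) w with hV
  have hbd : ∀ l, BddDiff (8 / (m * (L + 1) : ℝ)) (V l) := by
    intro l
    have := bddDiff_sampleDual (ι := Fin m × Option (Fin L)) (c := c) (π := π l) hD hG
      (hg l) (hθ l)
    rwa [hcard] at this
  have hk0 : (0 : ℝ) < m * (L + 1) := by positivity
  -- With the distinguished points frozen at `z`, guesses and multipliers are deterministic, and the
  -- frozen coordinates have no influence.
  have hbd' : ∀ l, BddDiff (8 / (m * (L + 1) : ℝ)) (fun w => V l (replaceHead z w)) := by
    intro l w i v
    beta_reduce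
    by_cases hi : i.2 = none
    · have : replaceHead z (Function.update w i v) = replaceHead z w := by
        funext j
        by_cases hj : j.2 = none
        · simp [replaceHead, hj]
        · have : j ≠ i := fun h => hj (h ▸ hi)
          simp [replaceHead, hj, this]
      rw [this, sub_self, abs_zero]
      positivity
    · have : replaceHead z (Function.update w i v)
          = Function.update (replaceHead z w) i v := by
        funext j
        by_cases hj : j = i
        · subst hj; simp [replaceHead, hi]
        · simp [replaceHead, hj]
      rw [this]
      exact hbd l _ _ _
  have hmean : ∀ l, pexp (fun (_ : Fin m × Option (Fin L)) (_ : α) => ((Fintype.card α : ℝ))⁻¹)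
      (fun w => V l (replaceHead z w))
      ≤ M + (s + 16 * Fintype.card B / ((m * (L + 1)) * s)) + 8 / (L + 1) := by
    intro l
    -- Freezing alters only `m` of the m(L+1) points, each worth 8/(m(L+1)).
    have e1 : ∀ w, V l (replaceHead z w) ≤ V l w + 8 / (L + 1) := by
      intro w
      have e2 := (hbd l).sub_le (Finset.univ.image fun t : Fin m => (t, (none : Option (Fin L))))
        (replaceHead z w) w fun i hi => by
          have : i.2 ≠ none := fun h => hi (Finset.mem_image.mpr
            ⟨i.1, Finset.mem_univ _, Prod.ext rfl h.symm⟩)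
          simp [replaceHead, this]
      have e3 : ((Finset.univ.image fun t : Fin m => (t, (none : Option (Fin L)))).card : ℝ)
          ≤ m := by
        have := Finset.card_image_le (s := Finset.univ)
          (f := fun t : Fin m => (t, (none : Option (Fin L))))
        rw [Finset.card_univ, Fintype.card_fin] at this
        exact_mod_cast this
      have e4 := (le_abs_self _).trans (e2.trans (mul_le_mul_of_nonneg_right e3 (by positivity)))
      have e5 : (m : ℝ) * (8 / (m * (L + 1))) = 8 / (L + 1) := by field_simp
      linarith
    have e6 := expect_sampleDual_le (ι := Fin m × Option (Fin L)) (c := c) (g := g l)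
      (π := π l) hD hG (hθ l) hs
    rw [hcard, ← pexp_uniform] at e6
    have e7 := hM l
    refine (pexp_mono hp e1).trans ?_
    rw [pexp_add, pexp_const hp]
    linarith
  rw [← pexp_uniform]
  -- Scaling the exponential parameter by the sample size makes the fluctuation term 32t,
  -- independent of m and L.
  have hsup := pexp_sup_le hp (t := t * (m * (L + 1))) (by positivity) _ hbd' hmean
  refine hsup.trans (le_of_eq ?_)
  rw [hcard]
  field_simp
  ring

/-- A random choice of points determines the field of a labelling up to a small error. -/
lemma partOpt_le_expect_sampleDual [NeZero m] (hD : ∀ a b, |D a b| ≤ 1)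
    (hG : ∀ x y, |G x y| ≤ 1) {θ : (Fin m → α) → (Fin m → B) → α → B → ℝ}
    {π : (Fin m → α) → (Fin m → B) → B → ℝ} (hθ : ∀ z l, IsProb (θ z l))
    (hπ : ∀ z l b, |π z l b| ≤ 4) {s : ℝ} (hs : 0 < s) {Φ : (Fin m × Option (Fin L) → α) → ℝ}
    (hΦ : ∀ w l, sampleDual D c G (guess D G (fun t => w (t, none)) l)
      (θ (fun t => w (t, none)) l) (π (fun t => w (t, none)) l) w ≤ Φ w)
    (w : Fin m × Option (Fin L) → α) :
    partOpt D c (fun i j => G (w i) (w j))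
      ≤ (𝔼 r : Fin m → Option (Fin L), Φ (fun i => w (blockSwap r i)))
        + 2 * (s + 4 * Fintype.card B / (m * s)) := by
  have hm0 : 0 < m := Nat.pos_of_ne_zero (NeZero.ne m)
  have hm : (0 : ℝ) < m := by exact_mod_cast hm0
  obtain ⟨a, ha⟩ := exists_partOpt_eq D c (fun i j => G (w i) (w j))
  set Δ : (Fin m → Option (Fin L)) → Fin m × Option (Fin L) → B → ℝ := fun r i b =>
    field D (fun i j => G (w i) (w j)) (vertex a) i b
      - guess D G (fun t => w (t, r t)) (fun t => a (t, r t)) (w i) b with hΔ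
  have hpt : ∀ r : Fin m → Option (Fin L), partOpt D c (fun i j => G (w i) (w j))
      ≤ Φ (fun i => w (blockSwap r i)) + 2 * 𝔼 i, (s + ∑ b, Δ r i b ^ 2 / s) := by
    intro r
    set z : Fin m → α := fun t => w (t, r t) with hz
    set l : Fin m → B := fun t => a (t, r t) with hl
    have e0 := fracVal_le_lagr_add (D := D) (c := c) (H := fun i j => G (w i) (w j))
      (isProb_vertex a) (θ := fun i => θ z l (w i)) (π := π z l)
      (g := fun i => guess D G z l (w i)) ⟨fun i => (hθ z l).nonneg _,
        fun i => (hθ z l).sum_eq _⟩ (hπ z l) (ξ := fun i => s + ∑ b, Δ r i b ^ 2 / s)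
        fun i b => (abs_le_add_sq_div hs).trans (add_le_add le_rfl
          (Finset.single_le_sum (f := fun b => Δ r i b ^ 2 / s) (fun _ _ => by positivity)
            (Finset.mem_univ b)))
    rw [← ha]
    refine e0.trans (add_le_add ?_ le_rfl)
    refine (lagr_le_dual (isProb_vertex a)).trans ?_
    -- After the block transpositions, the distinguished points are exactly the points chosen by
    -- `r`.
    have e1 : (fun t => w (blockSwap r (t, none))) = z := by
      funext t
      simp [blockSwap, hz]
    have e3 := hΦ (fun i => w (blockSwap r i)) l
    rw [sampleDual_comp, e1] at e3
    exact e3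
  -- The field of `a` is an average over all sample points and the guess is its stratified sample,
  -- one point per block.
  have hdev : ∀ i b, 𝔼 r, Δ r i b ^ 2 ≤ 4 / m := by
    intro i b
    have e := expect_stratified_sq_le (fun j : Fin m × Option (Fin L) =>
      D b (a j) * G (w i) (w j)) fun j => by
        rw [abs_mul]; exact mul_le_one₀ (hD _ _) (abs_nonneg _) (hG _ _)
    refine le_trans (le_of_eq ?_) e
    have hfield : field D (fun i j => G (w i) (w j)) (vertex a) i b
        = 𝔼 j, D b (a j) * G (w i) (w j) := by simp [field, vertex]
    simp only [hΔ, hfield, guess]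
  have h1 : partOpt D c (fun i j => G (w i) (w j))
      ≤ 𝔼 r, (Φ (fun i => w (blockSwap r i)) + 2 * 𝔼 i, (s + ∑ b, Δ r i b ^ 2 / s)) :=
    (Fintype.expect_const (ι := Fin m → Option (Fin L)) _).symm.le.trans (expect_mono hpt)
  refine h1.trans ?_
  rw [Finset.expect_add_distrib, ← Finset.mul_expect]
  refine add_le_add le_rfl (mul_le_mul_of_nonneg_left ?_ zero_le_two)
  rw [Finset.expect_comm]
  refine (expect_mono fun i => ?_).trans (Fintype.expect_const (ι := Fin m × Option (Fin L)) _).le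
  rw [Finset.expect_add_distrib, Fintype.expect_const, Finset.expect_sum_comm]
  refine add_le_add le_rfl ?_
  calc _ ≤ ∑ _b : B, 4 / (m : ℝ) / s := by
        refine Finset.sum_le_sum fun b _ => ?_
        rw [← Finset.expect_div]
        exact div_le_div_of_nonneg_right (hdev i b) hs.le
    _ = _ := by
        rw [Finset.sum_const, nsmul_eq_mul, Finset.card_univ]
        field_simp

/-- The optimum of a random sample does not exceed the optimum of the whole by much. -/
lemma expect_partOpt_le [NeZero m] (hD : ∀ a b, |D a b| ≤ 1) (hG : ∀ x y, |G x y| ≤ 1)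
    {δ s t : ℝ} (hδ : 0 < δ) (hs : 0 < s) (ht : 0 < t) :
    𝔼 w : Fin m × Option (Fin L) → α, partOpt D c (fun i j => G (w i) (w j))
      ≤ partOpt D c G
        + (2 / Fintype.card α + 4 * (δ + Fintype.card B / (Fintype.card α * δ)))
        + (s + 16 * Fintype.card B / ((m * (L + 1)) * s)) + 8 / (L + 1)
        + Real.log (Fintype.card B) / (t * (L + 1)) + 32 * t
        + 2 * (s + 4 * Fintype.card B / (m * s)) := by
  classical
  have hm0 : 0 < m := Nat.pos_of_ne_zero (NeZero.ne m)
  have hm : (0 : ℝ) < m := by exact_mod_cast hm0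
  -- The multipliers are computed in the whole of `G`, one pair for each position `z` and labelling
  -- `l` of the distinguished points.
  choose θ π hθ hπ hdual using fun (z : Fin m → α) (l : Fin m → B) =>
    exists_dual_le (D := D) (H := G) hD hG c (guess D G z l) hδ
  set Φ : (Fin m × Option (Fin L) → α) → ℝ := fun w =>
    ⨆ l, sampleDual D c G (guess D G (fun t => w (t, none)) l)
      (θ (fun t => w (t, none)) l) (π (fun t => w (t, none)) l) w with hΦ
  have hA := partOpt_le_expect_sampleDual (c := c) (L := L) hD hG hθ hπ hs (Φ := Φ) fun w l =>
    le_ciSup (f := fun l => sampleDual D c G (guess D G (fun t => w (t, none)) l)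
      (θ (fun t => w (t, none)) l) (π (fun t => w (t, none)) l) w) (Set.finite_range _).bddAbove l
  -- The law of an independent sample is invariant under the block transpositions.
  have hB : 𝔼 w : Fin m × Option (Fin L) → α, 𝔼 r : Fin m → Option (Fin L),
      Φ (fun i => w (blockSwap r i)) = 𝔼 w, Φ w := by
    rw [Finset.expect_comm]
    have : ∀ r : Fin m → Option (Fin L), 𝔼 w : Fin m × Option (Fin L) → α,
        Φ (fun i => w (blockSwap r i)) = 𝔼 w, Φ w :=
      fun r => Fintype.expect_equiv ((blockSwap r).symm.arrowCongr (Equiv.refl α)) _ _ fun w => rfl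
    simp only [this, Fintype.expect_const]
  have hC : ∀ z : Fin m → α, 𝔼 w : Fin m × Option (Fin L) → α, Φ (replaceHead z w)
      ≤ partOpt D c G
      + (2 / Fintype.card α + 4 * (δ + Fintype.card B / (Fintype.card α * δ)))
      + (s + 16 * Fintype.card B / ((m * (L + 1)) * s)) + 8 / (L + 1)
      + Real.log (Fintype.card B) / (t * (L + 1)) + 32 * t := by
    intro z
    have h := expect_iSup_sampleDual_le (L := L) hD hG (abs_guess_le hD hG z) (hθ z) hs ht
      (hdual z) z
    -- The q^m guesses cost m log q against m(L+1) points, so `m` cancels.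
    have hlog : Real.log (Fintype.card (Fin m → B)) / (t * (m * (L + 1)))
        = Real.log (Fintype.card B) / (t * (L + 1)) := by
      simp only [Fintype.card_fun, Fintype.card_fin, Nat.cast_pow, Real.log_pow]
      field_simp
    rw [hlog] at h
    exact h
  refine (expect_mono hA).trans ?_
  rw [Finset.expect_add_distrib, hB, Fintype.expect_const, expect_replaceHead Φ]
  refine add_le_add ?_ le_rfl
  exact (expect_mono hC).trans (Fintype.expect_const (ι := Fin m → α) _).le

end UpperBound

/-! ### Testability of the penalized labelling problem. -/

section Testability

variable {B : Type*} [Fintype B] [DecidableEq B] [Nonempty B] {D : B → B → ℝ} {c : B → ℝ}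

lemma unifProb_le_expect {Ω : Type} [Fintype Ω] (A : Set Ω) {F : Ω → ℝ} (hF : ∀ ω, 0 ≤ F ω) {y : ℝ}
    (hy : 0 < y) (hA : ∀ ω ∈ A, y ≤ F ω) : unifProb A ≤ (𝔼 ω, F ω) / y := by
  classical
  rw [unifProb, Fintype.expect_eq_sum_div_card, Nat.card_eq_fintype_card, div_right_comm]
  refine div_le_div_of_nonneg_right ?_ (Nat.cast_nonneg _)
  rw [le_div_iff₀ hy, Set.ncard_eq_toFinset_card', ← nsmul_eq_mul]
  calc _ ≤ ∑ ω ∈ A.toFinset, F ω := Finset.card_nsmul_le_sum _ _ _ fun ω hω =>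
        hA ω (Set.mem_toFinset.mp hω)
    _ ≤ ∑ ω, F ω := Finset.sum_le_sum_of_subset_of_nonneg (Finset.subset_univ _)
        fun ω _ _ => hF ω

lemma unifProb_mono {Ω : Type} [Finite Ω] {A A' : Set Ω} (h : A ⊆ A') :
    unifProb A ≤ unifProb A' := by
  unfold unifProb
  gcongr
  exact Set.toFinite _

lemma unifProb_union_le {Ω : Type} [Finite Ω] (A A' : Set Ω) :
    unifProb (A ∪ A') ≤ unifProb A + unifProb A' := by
  unfold unifProb
  rw [← add_div]
  gcongr
  exact_mod_cast Set.ncard_union_le A A'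

lemma abs_expect_partOpt_sub_le {α : Type} [Fintype α] [Nonempty α] (hD : ∀ a b, |D a b| ≤ 1)
    {G : α → α → ℝ} (hG : ∀ x y, |G x y| ≤ 1) {x : ℝ} (hx : 0 < x) (hx1 : x ≤ 1) {m L : ℕ}
    (hm : (Fintype.card B : ℝ) / x ^ 2 ≤ m)
    (hL : (1 + Real.log (Fintype.card B)) / x ^ 2 ≤ (L + 1 : ℝ))
    (hα : m * (L + 1) ≤ Fintype.card α) :
    |𝔼 w : Fin m × Option (Fin L) → α, partOpt D c (fun i j => G (w i) (w j)) - partOpt D c G|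
      ≤ 78 * x := by
  set q : ℝ := (Fintype.card B : ℝ) with hq
  have hq1 : 1 ≤ q := by rw [hq]; exact_mod_cast Fintype.card_pos
  have hlog : 0 ≤ Real.log q := Real.log_nonneg hq1
  have hmpos : (0 : ℝ) < m := lt_of_lt_of_le (by positivity) hm
  have hm0 : 0 < m := by exact_mod_cast hmpos
  have : NeZero m := ⟨hm0.ne'⟩
  have hL0 : (0 : ℝ) < L + 1 := by positivity
  set k : ℝ := m * (L + 1) with hk
  have hmk : (m : ℝ) ≤ k := by
    rw [hk]; nlinarith [Nat.cast_nonneg (α := ℝ) L]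
  have hkn : k ≤ Fintype.card α := by rw [hk]; exact_mod_cast hα
  have hqm : ∀ r : ℝ, (m : ℝ) ≤ r → q / (r * x) ≤ x := by
    intro r hr
    have hr0 : 0 < r := hmpos.trans_le hr
    rw [div_le_iff₀ (by positivity)]
    rw [div_le_iff₀ (by positivity)] at hm
    nlinarith
  have h1r : ∀ r : ℝ, (m : ℝ) ≤ r → 1 / r ≤ x := by
    intro r hr
    have hr0 : 0 < r := hmpos.trans_le hr
    refine le_trans ?_ (hqm r hr)
    rw [div_le_div_iff₀ hr0 (by positivity)]
    nlinarith
  have hLx : 1 / (L + 1 : ℝ) ≤ x := by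
    rw [div_le_iff₀ (by positivity)] at hL ⊢
    nlinarith
  have hLt : Real.log q / (x * (L + 1)) ≤ x := by
    rw [div_le_iff₀ (by positivity)] at hL ⊢
    nlinarith
  have hup := expect_partOpt_le (L := L) (m := m) (c := c) hD hG hx hx hx
  have hlow := partOpt_le_expect_partOpt (ι := Fin m × Option (Fin L)) (c := c) hD hG hx
  have hcard : (Fintype.card (Fin m × Option (Fin L)) : ℝ) = k := by simp [hk]
  rw [hcard] at hlow
  rw [← hk] at hup
  have e1 := hqm k hmk
  have e2 := hqm _ (hmk.trans hkn)
  have e3 := hqm m le_rfl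
  have e4 := h1r k hmk
  have e5 := h1r _ (hmk.trans hkn)
  have e6 : 16 * q / (k * x) = 16 * (q / (k * x)) := by ring
  have e7 : 4 * q / (m * x) = 4 * (q / (m * x)) := by ring
  have e8 : (8 : ℝ) / (L + 1) = 8 * (1 / (L + 1)) := by ring
  have e9 : (2 : ℝ) / Fintype.card α = 2 * (1 / Fintype.card α) := by ring
  have e10 : (2 : ℝ) / k = 2 * (1 / k) := by ring
  rw [e6, e7, e8, e9] at hup
  rw [e10] at hlow
  -- Every parameter was taken to be `x`. The upper error terms are at most 10, 17, 8, 1, 32 and 10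
  -- times `x`, in total 78; the lower bound needs only 10.
  rw [abs_le]
  constructor <;> linarith

lemma abs_expect_fin_partOpt_sub_le {α : Type} [Fintype α] [Nonempty α]
    (hD : ∀ a b, |D a b| ≤ 1)
    {G : α → α → ℝ} (hG : ∀ x y, |G x y| ≤ 1) {x : ℝ} (hx : 0 < x) (hx1 : x ≤ 1) {m L : ℕ}
    (hm : (Fintype.card B : ℝ) / x ^ 2 ≤ m)
    (hL : (1 + Real.log (Fintype.card B)) / x ^ 2 ≤ (L + 1 : ℝ))
    (hα : m * (L + 1) ≤ Fintype.card α) :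
    |𝔼 w : Fin (m * (L + 1)) → α, partOpt D c (fun i j => G (w i) (w j)) - partOpt D c G|
      ≤ 78 * x := by
  have hc : Fintype.card (Fin (m * (L + 1))) = Fintype.card (Fin m × Option (Fin L)) := by simp
  let e := Fintype.equivOfCardEq hc
  have h : 𝔼 w : Fin (m * (L + 1)) → α, partOpt D c (fun i j => G (w i) (w j))
      = 𝔼 w : Fin m × Option (Fin L) → α, partOpt D c (fun i j => G (w i) (w j)) := by
    refine Fintype.expect_equiv (e.arrowCongr (Equiv.refl α)) _ _ fun w => ?_
    rw [← partOpt_comp e.symm]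
    rfl
  rw [h]
  exact abs_expect_partOpt_sub_le hD hG hx hx1 hm hL hα

/-- Expected optimum of a sample without replacement. -/
lemma abs_expect_embedding_partOpt_sub_le {n k : ℕ} (hD : ∀ a b, |D a b| ≤ 1)
    {G : Fin n → Fin n → ℝ} (hG : ∀ x y, |G x y| ≤ 1) {x : ℝ} (hx : 0 < x) (hx1 : x ≤ 1) {m L : ℕ}
    (hm : (Fintype.card B : ℝ) / x ^ 2 ≤ m)
    (hL : (1 + Real.log (Fintype.card B)) / x ^ 2 ≤ (L + 1 : ℝ))
    (hk : (m * (L + 1) : ℝ) ≤ x * k) (hkn : k ≤ n) :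
    |𝔼 σ : Fin k ↪ Fin n, partOpt D c (induced G σ) - partOpt D c G| ≤ 164 * x := by
  have hq1 : (1 : ℝ) ≤ Fintype.card B := by exact_mod_cast Fintype.card_pos
  have hmpos : (0 : ℝ) < m := lt_of_lt_of_le (by positivity) hm
  have hk0pos : (0 : ℝ) < m * (L + 1) := by positivity
  have hkpos : (0 : ℝ) < k := by
    by_contra h
    have : (k : ℝ) = 0 := le_antisymm (not_lt.mp h) (Nat.cast_nonneg k)
    rw [this, mul_zero] at hk
    linarith
  have hk' : 0 < k := by exact_mod_cast hkpos
  have hk0k : m * (L + 1) ≤ k := by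
    have : (m * (L + 1) : ℝ) ≤ k := hk.trans (mul_le_of_le_one_left hkpos.le hx1)
    exact_mod_cast this
  have hnek : Nonempty (Fin k) := ⟨⟨0, hk'⟩⟩
  have hnen : Nonempty (Fin n) := ⟨⟨0, hk'.trans_le hkn⟩⟩
  set K := m * (L + 1) with hK
  have hKr : (K : ℝ) = m * (L + 1) := by rw [hK]; push_cast; ring
  have hKpos : 0 < K := by
    have : (0 : ℝ) < K := hKr ▸ hk0pos
    exact_mod_cast this
  have hneK : Nonempty (Fin K) := ⟨⟨0, hKpos⟩⟩
  have hnekn : Nonempty (Fin k ↪ Fin n) := by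
    rw [Function.Embedding.nonempty_iff_card_le]; simpa using hkn
  have hneKk : Nonempty (Fin K ↪ Fin k) := by
    rw [Function.Embedding.nonempty_iff_card_le]; simpa using hk0k
  -- The K-point bound is applied both to `G` and to each induced array. Passing to injections on
  -- either side (cost 4x each) makes the two K-point means equal, for a total of 78 + 4 + 4 + 78.
  have h1 : |𝔼 σ : Fin k ↪ Fin n, partOpt D c (induced G σ)
      - 𝔼 σ : Fin k ↪ Fin n, 𝔼 w : Fin K → Fin k,
        partOpt D c (fun i j => G (σ (w i)) (σ (w j)))| ≤ 78 * x := by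
    rw [← Finset.expect_sub_distrib]
    refine abs_expect_le (by positivity) fun σ => ?_
    rw [abs_sub_comm]
    exact abs_expect_fin_partOpt_sub_le (G := induced G σ) hD (fun _ _ => hG _ _) hx hx1 hm hL
      (by simpa using hk0k)
  have hyb : ∀ (r : ℕ), k ≤ r → 4 / (K : ℝ) * (K : ℝ) ^ 2 / (r : ℝ) ≤ 4 * x := by
    intro r hr
    have hr' : (k : ℝ) ≤ r := by exact_mod_cast hr
    have hKx : (K : ℝ) ≤ x * k := hKr ▸ hk
    have hK0 : (0 : ℝ) < K := by exact_mod_cast hKpos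
    have : 4 / (K : ℝ) * (K : ℝ) ^ 2 = 4 * K := by field_simp
    rw [this, div_le_iff₀ (hkpos.trans_le hr')]
    nlinarith
  have h2 : |𝔼 σ : Fin k ↪ Fin n, 𝔼 w : Fin K → Fin k,
        partOpt D c (fun i j => G (σ (w i)) (σ (w j)))
      - 𝔼 σ : Fin k ↪ Fin n, 𝔼 τ : Fin K ↪ Fin k,
        partOpt D c (fun i j => G (σ (τ i)) (σ (τ j)))| ≤ 4 * x := by
    rw [← Finset.expect_sub_distrib]
    refine abs_expect_le (by positivity) fun σ => ?_
    have h := bddDiff_partOpt (ι := Fin K) (c := c) hD (G := induced G σ) (fun _ _ => hG _ _)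
    rw [Fintype.card_fin] at h
    have h' := abs_expect_sub_expect_embedding_le (α := Fin k) (by positivity)
      (by simpa using hk0k) _ h
    rw [Fintype.card_fin] at h'
    exact h'.trans (hyb k le_rfl)
  have h3 : 𝔼 σ : Fin k ↪ Fin n, 𝔼 τ : Fin K ↪ Fin k,
        partOpt D c (fun i j => G (σ (τ i)) (σ (τ j)))
      = 𝔼 τ : Fin K ↪ Fin n, partOpt D c (fun i j => G (τ i) (τ j)) := by
    rw [Finset.expect_comm]
    have : ∀ τ : Fin K ↪ Fin k, 𝔼 σ : Fin k ↪ Fin n,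
        partOpt D c (fun i j => G (σ (τ i)) (σ (τ j)))
        = 𝔼 τ : Fin K ↪ Fin n, partOpt D c (fun i j => G (τ i) (τ j)) := fun τ =>
      expect_embedding_comp (by simpa using hkn) τ
        (fun ρ => partOpt D c (fun i j => G (ρ i) (ρ j)))
    simp only [this, Fintype.expect_const]
  have h4 : |𝔼 w : Fin K → Fin n, partOpt D c (fun i j => G (w i) (w j))
      - 𝔼 τ : Fin K ↪ Fin n, partOpt D c (fun i j => G (τ i) (τ j))| ≤ 4 * x := by
    have h := bddDiff_partOpt (ι := Fin K) (c := c) hD hG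
    rw [Fintype.card_fin] at h
    have h' := abs_expect_sub_expect_embedding_le (α := Fin n) (by positivity)
      (by simpa using hk0k.trans hkn) _ h
    rw [Fintype.card_fin] at h'
    exact h'.trans (hyb n hkn)
  have h5 := abs_expect_fin_partOpt_sub_le (c := c) hD hG hx hx1 hm hL
    (by simpa using hk0k.trans hkn)
  rw [h3] at h2
  rw [abs_le] at h1 h2 h4 h5 ⊢
  constructor <;> linarith

/-- The penalized labelling problem is testable. -/
theorem unifProb_partOpt_le {n k : ℕ} (hD : ∀ a b, |D a b| ≤ 1)
    {G : Fin n → Fin n → ℝ} (hG : ∀ x y, |G x y| ≤ 1) {x : ℝ} (hx : 0 < x) (hx1 : x ≤ 1)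
    (hk : 4 * Fintype.card B * (1 + Real.log (Fintype.card B)) / x ^ 5 ≤ k) (hkn : k ≤ n) :
    unifProb {σ : Fin k ↪ Fin n | 165 * x < |partOpt D c G - partOpt D c (induced G σ)|}
      ≤ 64 * x := by
  set q : ℝ := (Fintype.card B : ℝ) with hq
  have hq1 : 1 ≤ q := by rw [hq]; exact_mod_cast Fintype.card_pos
  have hlog : 0 ≤ Real.log q := Real.log_nonneg hq1
  have hx2 : x ^ 2 ≤ 1 := pow_le_one₀ hx.le hx1
  -- The least parameters allowed by the bounds on expectations; subtracting 1 from `L` accounts for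
  -- blocks having L+1 points.
  set m := ⌈q / x ^ 2⌉₊ with hm
  set L := ⌈(1 + Real.log q) / x ^ 2⌉₊ - 1 with hL
  have hL1 : (L + 1 : ℝ) = (⌈(1 + Real.log q) / x ^ 2⌉₊ : ℝ) := by
    have : 0 < ⌈(1 + Real.log q) / x ^ 2⌉₊ := Nat.ceil_pos.mpr (by positivity)
    have h : L + 1 = ⌈(1 + Real.log q) / x ^ 2⌉₊ := by omega
    exact_mod_cast congrArg (Nat.cast (R := ℝ)) h
  have h1 : q / x ^ 2 ≤ m := Nat.le_ceil _
  have h2 : (1 + Real.log q) / x ^ 2 ≤ (L + 1 : ℝ) := hL1 ▸ Nat.le_ceil _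
  have h1' : (m : ℝ) ≤ 2 * q / x ^ 2 := by
    have e : (m : ℝ) < q / x ^ 2 + 1 := Nat.ceil_lt_add_one (by positivity)
    have e2 : 1 ≤ q / x ^ 2 := by rw [le_div_iff₀ (by positivity)]; linarith
    have e3 : 2 * q / x ^ 2 = q / x ^ 2 + q / x ^ 2 := by ring
    linarith
  have h2' : (L + 1 : ℝ) ≤ 2 * (1 + Real.log q) / x ^ 2 := by
    rw [hL1]
    have e := Nat.ceil_lt_add_one (a := (1 + Real.log q) / x ^ 2) (by positivity)
    have e2 : 1 ≤ (1 + Real.log q) / x ^ 2 := by rw [le_div_iff₀ (by positivity)]; linarith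
    have e3 : 2 * (1 + Real.log q) / x ^ 2
        = (1 + Real.log q) / x ^ 2 + (1 + Real.log q) / x ^ 2 := by ring
    linarith
  -- The extra factor 1/x in `k`, which makes repetitions in the K-point samples negligible,
  -- explains the exponent 5.
  have h3 : (m * (L + 1) : ℝ) ≤ x * k := by
    calc (m * (L + 1) : ℝ) ≤ (2 * q / x ^ 2) * (2 * (1 + Real.log q) / x ^ 2) := by gcongr
      _ = x * (4 * q * (1 + Real.log q) / x ^ 5) := by field_simp; norm_num
      _ ≤ x * k := by gcongr
  have hkx : 1 / x ^ 3 ≤ k := by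
    refine le_trans ?_ hk
    rw [div_le_div_iff₀ (by positivity) (by positivity)]
    have : x ^ 5 ≤ x ^ 3 := pow_le_pow_of_le_one hx.le hx1 (by norm_num)
    have e : 1 ≤ 4 * q * (1 + Real.log q) := by nlinarith
    have : 0 < x ^ 3 := by positivity
    nlinarith
  have hkpos : (0 : ℝ) < k := lt_of_lt_of_le (by positivity) hkx
  have hk' : 0 < k := by exact_mod_cast hkpos
  have hnek : Nonempty (Fin k) := ⟨⟨0, hk'⟩⟩
  have hmean := abs_expect_embedding_partOpt_sub_le (c := c) hD hG hx hx1 h1 h2 h3 hkn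
  set f : (Fin k ↪ Fin n) → ℝ := fun σ => partOpt D c (induced G σ) with hf
  -- A transposition moves at most two sampled points, each worth 4/k. Chebyshev then gives 64/(k
  -- x²) ≤ 64x.
  have hvar := expect_embedding_sq_le (α := Fin n) (c := 8 / k) (by positivity)
    (by simpa using hkn) f fun σ a b => by
      have hb := bddDiff_partOpt (ι := Fin k) (c := c) hD hG
      rw [Fintype.card_fin] at hb
      have h := hb.sub_le (Finset.univ.filter (fun i => σ i = a) ∪
        Finset.univ.filter (fun i => σ i = b)) (⇑(Equiv.swap a b • σ : Fin k ↪ Fin n)) σ fun i hi => by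
          simp only [Finset.mem_union, Finset.mem_filter, Finset.mem_univ, true_and,
            not_or] at hi
          rw [Function.Embedding.smul_apply, Equiv.Perm.smul_def,
            Equiv.swap_apply_of_ne_of_ne hi.1 hi.2]
      have hcard1 : ∀ a, (Finset.univ.filter (fun i => σ i = a)).card ≤ 1 := fun a =>
        Finset.card_le_one.mpr fun i hi j hj => σ.injective
          ((Finset.mem_filter.mp hi).2.trans (Finset.mem_filter.mp hj).2.symm)
      have hcard : ((Finset.univ.filter (fun i => σ i = a) ∪
          Finset.univ.filter (fun i => σ i = b)).card : ℝ) ≤ 2 := by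
        have := (Finset.card_union_le (Finset.univ.filter (fun i => σ i = a))
          (Finset.univ.filter (fun i => σ i = b))).trans (add_le_add (hcard1 a) (hcard1 b))
        exact_mod_cast this
      refine h.trans ?_
      calc _ ≤ 2 * (4 / (k : ℝ)) := by gcongr
        _ = 8 / k := by ring
  set μ := 𝔼 τ, f τ with hμ
  have hsub : {σ : Fin k ↪ Fin n | 165 * x < |partOpt D c G - partOpt D c (induced G σ)|}
      ⊆ {σ | x < |f σ - μ|} := by
    intro σ hσ
    simp only [Set.mem_ofPred_eq] at hσ ⊢
    have := abs_sub_le (partOpt D c G) μ (partOpt D c (induced G σ))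
    rw [abs_sub_comm] at hmean
    rw [abs_sub_comm]
    change x < |μ - partOpt D c (induced G σ)|
    linarith
  refine (unifProb_mono hsub).trans ?_
  refine (unifProb_le_expect _ (F := fun σ => (f σ - μ) ^ 2) (fun _ => sq_nonneg _)
    (y := x ^ 2) (by positivity) fun σ hσ => ?_).trans ?_
  · rw [← sq_abs (f σ - μ)]
    exact pow_le_pow_left₀ hx.le (le_of_lt hσ) 2
  · rw [div_le_iff₀ (by positivity)]
    refine hvar.trans ?_
    have e : (k : ℝ) * (8 / k) ^ 2 = 64 / k := by field_simp; norm_num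
    rw [e, div_le_iff₀ hkpos]
    rw [div_le_iff₀ (by positivity)] at hkx
    nlinarith

end Testability

/-! ### The discrete problems as penalized labelling problems. -/

section DiscreteTransfer

variable {B : Type*} [Fintype B] [DecidableEq B] [Nonempty B] {D : B → B → ℝ} {c : B → ℝ}

lemma marg_vertex {ι : Type*} [Fintype ι] (a : ι → B) (b : B) :
    marg (vertex a) b = ((Finset.univ.filter fun i => a i = b).card : ℝ) / Fintype.card ι := by
  simp [marg, vertex, Fintype.expect_eq_sum_div_card, Finset.sum_boole]

/-- Two labellings can be aligned by a permutation up to the difference of their label counts. -/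
lemma exists_perm_mismatch_le {ι : Type*} [Fintype ι] [DecidableEq ι] (a l : ι → B) :
    ∃ ρ : Equiv.Perm ι, ((Finset.univ.filter fun i => a (ρ i) ≠ l i).card : ℝ) / Fintype.card ι
      ≤ ∑ b, |marg (vertex a) b - marg (vertex l) b| := by
  -- For a permutation with fewest mismatches no label is both missing somewhere (`P b`) and
  -- superfluous elsewhere (`N b`), since a transposition would repair one. So the mismatches are
  -- counted by the differences of label counts.
  obtain ⟨ρ, hρ⟩ := Finite.exists_min
    fun ρ : Equiv.Perm ι => (Finset.univ.filter fun i => a (ρ i) ≠ l i).card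
  refine ⟨ρ, ?_⟩
  set P : B → Finset ι := fun b => Finset.univ.filter fun i => l i = b ∧ a (ρ i) ≠ b with hP
  set N : B → Finset ι := fun b => Finset.univ.filter fun i => a (ρ i) = b ∧ l i ≠ b with hN
  set S : B → Finset ι := fun b => Finset.univ.filter fun i => l i = b ∧ a (ρ i) = b with hS
  have hor : ∀ b, P b = ∅ ∨ N b = ∅ := by
    intro b
    by_contra! h
    obtain ⟨⟨i, hi⟩, ⟨j, hj⟩⟩ := h
    simp only [hP, hN, Finset.mem_filter, Finset.mem_univ, true_and] at hi hj
    have hij : i ≠ j := fun h => hi.2 (h ▸ hj.1)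
    refine absurd (hρ (Equiv.swap i j * 1 |>.trans ρ)) (not_le.mpr ?_)
    refine Finset.card_lt_card ⟨fun x hx => ?_, fun hsub => ?_⟩
    · simp only [Finset.mem_filter, Finset.mem_univ, true_and, mul_one,
        Equiv.trans_apply] at hx ⊢
      by_cases hxi : x = i
      · subst hxi
        rw [Equiv.swap_apply_left] at hx
        exact absurd (hj.1.trans hi.1.symm) hx
      · by_cases hxj : x = j
        · subst hxj
          intro h
          exact hj.2 (h ▸ hj.1)
        · rwa [Equiv.swap_apply_of_ne_of_ne hxi hxj] at hx
    · have hmem : i ∈ Finset.univ.filter fun i => a (ρ i) ≠ l i := by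
        simp only [Finset.mem_filter, Finset.mem_univ, true_and]
        rw [hi.1]
        exact hi.2
      have := hsub hmem
      simp only [Finset.mem_filter, Finset.mem_univ, true_and, mul_one, Equiv.trans_apply,
        Equiv.swap_apply_left] at this
      exact this (hj.1.trans hi.1.symm)
  have hl : ∀ b, (Finset.univ.filter fun i => l i = b).card = (S b).card + (P b).card := by
    intro b
    rw [← Finset.card_union_of_disjoint]
    · congr 1
      ext i
      simp only [hS, hP, Finset.mem_union, Finset.mem_filter, Finset.mem_univ, true_and]
      tauto
    · rw [Finset.disjoint_left]
      intro i
      simp only [hS, hP, Finset.mem_filter, Finset.mem_univ, true_and]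
      tauto
  have ha : ∀ b, (Finset.univ.filter fun i => a i = b).card = (S b).card + (N b).card := by
    intro b
    have h1 : (Finset.univ.filter fun i => a i = b).card
        = (Finset.univ.filter fun i => a (ρ i) = b).card := by
      symm
      rw [← Finset.card_map ρ.toEmbedding]
      congr 1
      ext i
      simp only [Finset.mem_map, Finset.mem_filter, Finset.mem_univ, true_and,
        Equiv.coe_toEmbedding]
      exact ⟨by rintro ⟨j, h, rfl⟩; exact h, fun h => ⟨ρ.symm i, by simpa using h, by simp⟩⟩
    rw [h1, ← Finset.card_union_of_disjoint]
    · congr 1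
      ext i
      simp only [hS, hN, Finset.mem_union, Finset.mem_filter, Finset.mem_univ, true_and]
      tauto
    · rw [Finset.disjoint_left]
      intro i
      simp only [hS, hN, Finset.mem_filter, Finset.mem_univ, true_and]
      tauto
  have hmis : (Finset.univ.filter fun i => a (ρ i) ≠ l i).card = ∑ b, (P b).card := by
    rw [Finset.card_eq_sum_card_fiberwise (f := l) (t := Finset.univ) (fun _ _ => by simp)]
    refine Finset.sum_congr rfl fun b _ => ?_
    rw [Finset.filter_filter]
    congr 1
    ext i
    simp only [hP, Finset.mem_filter, Finset.mem_univ, true_and]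
    constructor
    · rintro ⟨h1, rfl⟩; exact ⟨rfl, h1⟩
    · rintro ⟨rfl, h1⟩; exact ⟨h1, rfl⟩
  rw [hmis, Nat.cast_sum, Finset.sum_div]
  refine Finset.sum_le_sum fun b _ => ?_
  rw [marg_vertex, marg_vertex, ← sub_div, abs_div, abs_of_nonneg (Nat.cast_nonneg (α := ℝ) _)]
  refine div_le_div_of_nonneg_right ?_ (Nat.cast_nonneg _)
  rw [hl, ha]
  push_cast
  rcases hor b with h | h
  · rw [h]; simp
  · rw [h]; simp

lemma qap_eq {n : ℕ} (G J : Fin n → Fin n → ℝ) :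
    qap G J = ⨆ ρ : Equiv.Perm (Fin n), 𝔼 i, 𝔼 j, J i j * G (ρ i) (ρ j) := by
  rw [qap, Real.mul_iSup_of_nonneg (by positivity)]
  congr 1
  ext ρ
  simp only [Fintype.expect_eq_sum_div_card, Fintype.card_fin, ← Finset.sum_div]
  rw [div_div]
  ring

lemma le_qap {n : ℕ} (G J : Fin n → Fin n → ℝ) (ρ : Equiv.Perm (Fin n)) :
    𝔼 i, 𝔼 j, J i j * G (ρ i) (ρ j) ≤ qap G J := by
  rw [qap_eq]
  exact le_ciSup (f := fun ρ : Equiv.Perm (Fin n) => 𝔼 i, 𝔼 j, J i j * G (ρ i) (ρ j))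
    (Set.finite_range _).bddAbove ρ

/-- The finite quadratic assignment problem as a penalized labelling problem. -/
lemma abs_qap_sub_partOpt_le {n : ℕ} (hn : 0 < n) (hD : ∀ a b, |D a b| ≤ 1)
    {G J : Fin n → Fin n → ℝ} (hG : ∀ x y, |G x y| ≤ 1) (l : Fin n → B) {η : ℝ}
    (hJ : 𝔼 i, 𝔼 j, |J i j - D (l i) (l j)| ≤ η) :
    |qap G J - partOpt D c G| ≤ η + 4 * ∑ b, |marg (vertex l) b - c b| := by
  have : Nonempty (Fin n) := ⟨⟨0, hn⟩⟩
  have hdiff : ∀ ρ : Equiv.Perm (Fin n), |(𝔼 i, 𝔼 j, J i j * G (ρ i) (ρ j))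
      - 𝔼 i, 𝔼 j, D (l i) (l j) * G (ρ i) (ρ j)| ≤ η := by
    intro ρ
    refine le_trans ?_ hJ
    simp only [← Finset.expect_sub_distrib, ← sub_mul]
    refine abs_expect_expect_le fun i j => ?_
    rw [abs_mul]
    exact mul_le_of_le_one_right (abs_nonneg _) (hG _ _)
  refine abs_le.mpr ⟨?_, ?_⟩
  · obtain ⟨a, ha⟩ := exists_partOpt_eq D c G
    obtain ⟨ρ, hρ⟩ := exists_perm_mismatch_le a l
    have h1 : quad D G (vertex a) ≤ (𝔼 i, 𝔼 j, D (l i) (l j) * G (ρ i) (ρ j))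
        + 4 * ∑ b, |marg (vertex a) b - marg (vertex l) b| := by
      have e1 : quad D G (vertex a) = 𝔼 i, 𝔼 j, D (a (ρ i)) (a (ρ j)) * G (ρ i) (ρ j) := by
        rw [quad_vertex]
        symm
        exact Fintype.expect_equiv ρ _ _ fun i => Fintype.expect_equiv ρ _ _ fun j => rfl
      -- Each mismatched endpoint costs at most 2 and a pair has two endpoints: hence the penalty
      -- factor 4.
      have e2 : 𝔼 i, 𝔼 j, D (a (ρ i)) (a (ρ j)) * G (ρ i) (ρ j)
          ≤ (𝔼 i, 𝔼 j, D (l i) (l j) * G (ρ i) (ρ j)) + 𝔼 i, 𝔼 j,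
            (2 * (if a (ρ i) ≠ l i then (1 : ℝ) else 0)
              + 2 * (if a (ρ j) ≠ l j then (1 : ℝ) else 0)) := by
        simp only [← Finset.expect_add_distrib]
        refine expect_mono fun i => expect_mono fun j => ?_
        have hb : ∀ x y, |D x y * G (ρ i) (ρ j)| ≤ 1 := fun x y => by
          rw [abs_mul]; exact mul_le_one₀ (hD _ _) (abs_nonneg _) (hG _ _)
        have b1 := abs_le.mp (hb (a (ρ i)) (a (ρ j)))
        have b2 := abs_le.mp (hb (l i) (l j))
        by_cases h1 : a (ρ i) = l i
        · by_cases h2 : a (ρ j) = l j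
          · simp [h1, h2]
          · simp only [h1, h2, ne_eq, not_true_eq_false, not_false_eq_true, if_true, if_false]
            rw [h1] at b1
            linarith
        · simp only [h1, ne_eq, not_false_eq_true, if_true]
          split_ifs <;> linarith
      have e3 : 𝔼 i, 𝔼 j, (2 * (if a (ρ i) ≠ l i then (1 : ℝ) else 0)
          + 2 * (if a (ρ j) ≠ l j then (1 : ℝ) else 0))
          = 4 * (((Finset.univ.filter fun i => a (ρ i) ≠ l i).card : ℝ)
            / Fintype.card (Fin n)) := by
        simp only [Finset.expect_add_distrib, Fintype.expect_const, ← Finset.mul_expect]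
        rw [Fintype.expect_eq_sum_div_card, Finset.sum_boole]
        ring
      rw [e1]
      refine e2.trans (add_le_add le_rfl ?_)
      rw [e3]
      exact mul_le_mul_of_nonneg_left hρ (by norm_num)
    have h2 : ∑ b, |marg (vertex a) b - marg (vertex l) b|
        ≤ ∑ b, |marg (vertex a) b - c b| + ∑ b, |marg (vertex l) b - c b| := by
      rw [← Finset.sum_add_distrib]
      refine Finset.sum_le_sum fun b _ => ?_
      rw [abs_sub_comm (marg (vertex l) b)]
      exact abs_sub_le _ _ _
    have h3 := le_qap G J ρ
    have h4 := abs_le.mp (hdiff ρ)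
    rw [← ha, fracVal]
    linarith
  · rw [sub_le_iff_le_add, qap_eq]
    refine ciSup_le fun ρ => ?_
    have h1 := abs_le.mp (hdiff ρ)
    -- Transporting `l` by `ρ` keeps the label counts, so this labelling pays only the penalty of
    -- `l` itself.
    have h2 := fracVal_le_partOpt (D := D) (c := c) G (fun i => l (ρ.symm i))
    have h3 : quad D G (vertex fun i => l (ρ.symm i))
        = 𝔼 i, 𝔼 j, D (l i) (l j) * G (ρ i) (ρ j) := by
      rw [quad_vertex]
      symm
      exact Fintype.expect_equiv ρ _ _ fun i => Fintype.expect_equiv ρ _ _ fun j => by simp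
    have h4 : ∀ b, marg (vertex fun i => l (ρ.symm i)) b = marg (vertex l) b := fun b =>
      Fintype.expect_equiv ρ.symm _ _ fun i => rfl
    rw [fracVal, h3] at h2
    simp only [h4] at h2
    linarith

/-- Replace `ρ` by its inverse: the order is then the fixed array and `G` is the one permuted. -/
lemma mas_eq_qap (n : ℕ) (G : Fin n → Fin n → ℝ) :
    mas n G = qap G (fun i j => if i ≤ j then 1 else 0) := by
  unfold mas qap
  congr 1
  rw [← (Equiv.inv (Equiv.Perm (Fin n))).iSup_congr fun ρ => ?_]
  refine Fintype.sum_equiv ρ.symm _ _ fun i => Fintype.sum_equiv ρ.symm _ _ fun j => ?_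
  simp [mul_comm]

/-- Label of a vertex when `[n]` is split into `q` intervals. -/
def blockLabel (q n : ℕ) [NeZero q] (i : Fin n) : Fin q :=
  ⟨i * q / n, Nat.div_lt_of_lt_mul (Nat.mul_lt_mul_of_pos_right i.2 (NeZero.pos q))⟩

/-- A block consists of the integers in a half-open interval of length n/q, counted by a difference
of ceilings. -/
lemma abs_marg_blockLabel_sub_le {q n : ℕ} [NeZero q] (hn : 0 < n) (b : Fin q) :
    |marg (vertex (blockLabel q n)) b - 1 / q| ≤ 1 / n := by
  have hq : (0 : ℝ) < q := by exact_mod_cast NeZero.pos q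
  have hn' : (0 : ℝ) < n := by exact_mod_cast hn
  set f : ℕ → ℕ := fun b => ⌈(b * n : ℝ) / q⌉₊ with hf
  have hcount : (Finset.univ.filter fun i => blockLabel q n i = b).card = f (b + 1) - f b := by
    rw [← Nat.card_Ico, ← Finset.card_map Fin.valEmbedding]
    congr 1
    ext i
    simp only [Finset.mem_map, Finset.mem_filter, Finset.mem_univ, true_and,
      Fin.valEmbedding_apply, Finset.mem_Ico, hf, Nat.ceil_le, Nat.lt_ceil]
    have key : ∀ i : ℕ, (i * q / n = b ↔ (b * n : ℝ) / q ≤ i ∧ (i : ℝ) < ((b + 1 : ℕ) * n : ℝ) / q)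
        := by
      intro i
      rw [Nat.div_eq_iff hn, div_le_iff₀ hq, lt_div_iff₀ hq]
      norm_cast
      have : (b + 1 : ℕ) * n = b * n + n := by ring
      rw [this]
      constructor
      · rintro ⟨h1, h2⟩; exact ⟨h1, by omega⟩
      · rintro ⟨h1, h2⟩; exact ⟨h1, by omega⟩
    rw [← key]
    constructor
    · rintro ⟨j, hj, rfl⟩
      exact congrArg Fin.val hj
    · intro h
      have hi : i < n := by
        by_contra hlt
        have h1 : q ≤ i * q / n := by
          rw [Nat.le_div_iff_mul_le hn, mul_comm]
          exact Nat.mul_le_mul_right q (not_lt.mp hlt)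
        have := b.2
        omega
      exact ⟨⟨i, hi⟩, Fin.ext h, rfl⟩
  have hmono : f b ≤ f (b + 1) := by
    refine Nat.ceil_mono ?_
    push_cast
    gcongr
    linarith
  rw [marg_vertex, hcount, Fintype.card_fin, Nat.cast_sub hmono]
  have h1 := Nat.le_ceil ((b * n : ℝ) / q)
  have h2 := Nat.ceil_lt_add_one (a := (b * n : ℝ) / q) (by positivity)
  have h3 := Nat.le_ceil (((b + 1 : ℕ) * n : ℝ) / q)
  have h4 := Nat.ceil_lt_add_one (a := ((b + 1 : ℕ) * n : ℝ) / q) (by positivity)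
  have h5 : ((b + 1 : ℕ) * n : ℝ) / q = (b * n : ℝ) / q + n / q := by push_cast; ring
  have h6 : (1 : ℝ) / q = (n / q) / n := by field_simp
  rw [h6, ← sub_div, abs_div, abs_of_pos hn']
  refine div_le_div_of_nonneg_right ?_ hn'.le
  rw [abs_le]
  constructor
  · simp only [hf]; linarith
  · simp only [hf]; linarith

/-- The triangular array and its block version differ only inside a diagonal block, a proportion of
about 1/q of the pairs. The term q/n comes from uneven block sizes. -/
lemma abs_mas_sub_partOpt_le {q n : ℕ} [NeZero q] (hn : 0 < n) {G : Fin n → Fin n → ℝ}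
    (hG : ∀ x y, |G x y| ≤ 1) :
    |mas n G - partOpt (fun a b : Fin q => if a ≤ b then 1 else 0) (fun _ => 1 / (q : ℝ)) G|
      ≤ 1 / q + 1 / n + 4 * (q / n) := by
  have hne : Nonempty (Fin n) := ⟨⟨0, hn⟩⟩
  rw [mas_eq_qap]
  refine (abs_qap_sub_partOpt_le hn (fun a b => by split_ifs <;> simp) hG (blockLabel q n)
    (η := 1 / q + 1 / n) ?_).trans ?_
  · refine (expect_mono fun i => ?_).trans (Fintype.expect_const (ι := Fin n) _).le
    have h1 := (abs_le.mp (abs_marg_blockLabel_sub_le (q := q) hn (blockLabel q n i))).2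
    have h2 : 𝔼 j, |(if i ≤ j then (1 : ℝ) else 0)
        - if blockLabel q n i ≤ blockLabel q n j then 1 else 0|
        ≤ marg (vertex (blockLabel q n)) (blockLabel q n i) := by
      refine expect_mono fun j => ?_
      unfold vertex
      have hmono : ∀ i j : Fin n, i ≤ j → blockLabel q n i ≤ blockLabel q n j := fun i j h =>
        Nat.div_le_div_right (Nat.mul_le_mul_right q h)
      by_cases h : i ≤ j
      · rw [if_pos h, if_pos (hmono i j h)]
        simp only [sub_self, abs_zero]
        positivity
      · rw [if_neg h]
        have h' := hmono j i (le_of_not_ge h)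
        by_cases h2 : blockLabel q n i ≤ blockLabel q n j
        · rw [if_pos h2, if_pos (le_antisymm h' h2)]
          simp
        · rw [if_neg h2]
          simp only [sub_self, abs_zero]
          positivity
    linarith
  · refine add_le_add le_rfl (mul_le_mul_of_nonneg_left ?_ (by norm_num))
    refine (Finset.sum_le_sum fun b _ => abs_marg_blockLabel_sub_le hn b).trans (le_of_eq ?_)
    rw [Finset.sum_const, Finset.card_univ, Fintype.card_fin, nsmul_eq_mul]
    ring

end DiscreteTransfer

/-! ### The continuous problem is Lipschitz in L¹. -/

section ContinuousProblem

open unitInterval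

lemma integrable_of_abs_le {Ω : Type*} [MeasurableSpace Ω] {μ : Measure Ω} [IsFiniteMeasure μ]
    {f : Ω → ℝ} (hf : Measurable f) {C : ℝ} (hC : ∀ x, |f x| ≤ C) : Integrable f μ :=
  Integrable.of_bound hf.aestronglyMeasurable C (Eventually.of_forall hC)

lemma abs_integral_le_of_abs_le {Ω : Type*} [MeasurableSpace Ω] {μ : Measure Ω}
    [IsProbabilityMeasure μ] {f : Ω → ℝ} {C : ℝ} (hC : ∀ x, |f x| ≤ C) : |∫ x, f x ∂μ| ≤ C := by
  simpa using norm_integral_le_of_norm_le_const (μ := μ) (f := f) (C := C)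
    (Eventually.of_forall hC)

/-- Averaging a kernel on `[0,1]²` over a fractional permutation. -/
def fracAvg (μ : Kernel I I) (W : I → I → ℝ) (p : I × I) : ℝ :=
  ∫ z, W z.1 z.2 ∂((μ ∥ₖ μ) p)

/-- Applying a fractional permutation independently to two points preserves area. Hence averaging a
kernel over it preserves integrals, which yields the L¹ bounds in `W`. -/
lemma IsFracPerm.bind_parallelComp {μ : Kernel I I} (hμ : IsFracPerm μ) :
    (volume : Measure (I × I)).bind (μ ∥ₖ μ) = volume := by
  have := hμ.1
  rw [show (volume : Measure (I × I)) = volume.prod volume from rfl]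
  refine (Measure.prod_eq fun s t hs ht => ?_).symm
  rw [Measure.bind_apply (hs.prod ht) (Kernel.measurable _).aemeasurable]
  simp only [Kernel.parallelComp_apply_prod]
  rw [lintegral_prod_mul (Kernel.measurable_coe μ hs).aemeasurable
    (Kernel.measurable_coe μ ht).aemeasurable, hμ.2 s hs, hμ.2 t ht]

lemma measurable_fracAvg (μ : Kernel I I) {W : I → I → ℝ}
    (hW : Measurable (Function.uncurry W)) : Measurable (fracAvg μ W) :=
  (StronglyMeasurable.integral_kernel (κ := μ ∥ₖ μ) hW.stronglyMeasurable).measurable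

lemma abs_fracAvg_le {μ : Kernel I I} (hμ : IsFracPerm μ) {W : I → I → ℝ} {C : ℝ}
    (hC : ∀ x y, |W x y| ≤ C) (p : I × I) : |fracAvg μ W p| ≤ C := by
  have := hμ.1
  exact abs_integral_le_of_abs_le fun z => hC z.1 z.2

lemma fracAvg_eq {μ : Kernel I I} (hμ : IsFracPerm μ) {W : I → I → ℝ}
    (hW : Measurable (Function.uncurry W)) {C : ℝ} (hC : ∀ x y, |W x y| ≤ C) (p : I × I) :
    fracAvg μ W p = ∫ x, ∫ y, W x y ∂(μ p.2) ∂(μ p.1) := by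
  have := hμ.1
  rw [fracAvg, Kernel.parallelComp_apply]
  exact integral_prod (Function.uncurry W) (integrable_of_abs_le hW fun z => hC z.1 z.2)

lemma integral_fracAvg {μ : Kernel I I} (hμ : IsFracPerm μ) {W : I → I → ℝ}
    (hW : Measurable (Function.uncurry W)) {C : ℝ} (hC : ∀ x y, |W x y| ≤ C) :
    ∫ p, fracAvg μ W p = ∫ p : I × I, W p.1 p.2 := by
  have := hμ.1
  have hint : Integrable (fun z : I × I => W z.1 z.2) ((volume : Measure (I × I)).bind (μ ∥ₖ μ)) := by
    rw [hμ.bind_parallelComp]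
    exact integrable_of_abs_le hW fun z => hC z.1 z.2
  have hb := hμ.bind_parallelComp
  rw [Measure.comp_eq_comp_const_apply] at hint hb
  have h := Kernel.integral_comp hint
  rw [hb, Kernel.const_apply] at h
  exact h.symm

lemma contQapAt_eq {μ : Kernel I I} (hμ : IsFracPerm μ) {W J : I → I → ℝ}
    (hW : Measurable (Function.uncurry W)) (hJ : Measurable (Function.uncurry J)) {C C' : ℝ}
    (hC : ∀ x y, |W x y| ≤ C) (hC' : ∀ x y, |J x y| ≤ C') :
    contQapAt μ W J = ∫ p : I × I, J p.1 p.2 * fracAvg μ W p := by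
  have hm : Measurable fun p : I × I => J p.1 p.2 * fracAvg μ W p :=
    hJ.mul (measurable_fracAvg μ hW)
  have hint : Integrable (fun p : I × I => J p.1 p.2 * fracAvg μ W p) volume :=
    integrable_of_abs_le hm (C := C' * C) fun p => by
      rw [abs_mul]
      exact mul_le_mul (hC' _ _) (abs_fracAvg_le hμ hC p) (abs_nonneg _)
        ((abs_nonneg _).trans (hC' 0 0))
  rw [contQapAt, show (volume : Measure (I × I)) = volume.prod volume from rfl,
    integral_prod _ hint]
  simp only [fracAvg_eq hμ hW hC]

/-- The value of a fractional permutation is Lipschitz in both arguments. -/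
lemma abs_contQapAt_sub_le {μ : Kernel I I} (hμ : IsFracPerm μ) {W W' J J' : I → I → ℝ}
    (hW : Measurable (Function.uncurry W)) (hW' : Measurable (Function.uncurry W'))
    (hJ : Measurable (Function.uncurry J)) (hJ' : Measurable (Function.uncurry J'))
    (hW1 : ∀ x y, |W x y| ≤ 1) (hW1' : ∀ x y, |W' x y| ≤ 1)
    (hJ1 : ∀ x y, |J x y| ≤ 1) (hJ1' : ∀ x y, |J' x y| ≤ 1) :
    |contQapAt μ W J - contQapAt μ W' J'|
      ≤ (∫ p : I × I, |W p.1 p.2 - W' p.1 p.2|) + ∫ p : I × I, |J p.1 p.2 - J' p.1 p.2| := by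
  have := hμ.1
  set E : I → I → ℝ := fun x y => |W x y - W' x y| with hE
  have hEm : Measurable (Function.uncurry E) := (hW.sub hW').abs
  have hE2 : ∀ x y, |E x y| ≤ 2 := fun x y => by
    rw [hE, abs_abs]
    exact (abs_sub _ _).trans (by linarith [hW1 x y, hW1' x y])
  have hEJ : Measurable fun p : I × I => |J p.1 p.2 - J' p.1 p.2| := (hJ.sub hJ').abs
  have hEJ2 : ∀ p : I × I, |(|J p.1 p.2 - J' p.1 p.2|)| ≤ 2 := fun p => by
    rw [abs_abs]
    exact (abs_sub _ _).trans (by linarith [hJ1 p.1 p.2, hJ1' p.1 p.2])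
  have hint : ∀ {W J : I → I → ℝ}, Measurable (Function.uncurry W) →
      Measurable (Function.uncurry J) → (∀ x y, |W x y| ≤ 1) → (∀ x y, |J x y| ≤ 1) →
      Integrable (fun p : I × I => J p.1 p.2 * fracAvg μ W p) volume := by
    intro W J hW hJ hW1 hJ1
    refine integrable_of_abs_le (hJ.mul (measurable_fracAvg μ hW)) (C := 1) fun p => ?_
    simp only [abs_mul]
    exact mul_le_one₀ (hJ1 _ _) (abs_nonneg _) (abs_fracAvg_le hμ hW1 p)
  rw [contQapAt_eq hμ hW hJ hW1 hJ1, contQapAt_eq hμ hW' hJ' hW1' hJ1',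
    ← integral_sub (hint hW hJ hW1 hJ1) (hint hW' hJ' hW1' hJ1'), ← integral_fracAvg hμ hEm hE2,
    ← integral_add (integrable_of_abs_le (measurable_fracAvg μ hEm) (abs_fracAvg_le hμ hE2))
      (integrable_of_abs_le hEJ hEJ2)]
  refine (abs_integral_le_integral_abs).trans (integral_mono_of_nonneg
    (Eventually.of_forall fun p => abs_nonneg _)
    ((integrable_of_abs_le (measurable_fracAvg μ hEm) (abs_fracAvg_le hμ hE2)).add
      (integrable_of_abs_le hEJ hEJ2)) (Eventually.of_forall fun p => ?_))
  have h1 : |fracAvg μ W p - fracAvg μ W' p| ≤ fracAvg μ E p := by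
    unfold fracAvg
    rw [← integral_sub (f := fun z : I × I => W z.1 z.2) (g := fun z : I × I => W' z.1 z.2)
      (integrable_of_abs_le hW fun z => hW1 z.1 z.2)
      (integrable_of_abs_le hW' fun z => hW1' z.1 z.2)]
    exact abs_integral_le_integral_abs
  have h2 : J p.1 p.2 * fracAvg μ W p - J' p.1 p.2 * fracAvg μ W' p
      = J' p.1 p.2 * (fracAvg μ W p - fracAvg μ W' p)
        + (J p.1 p.2 - J' p.1 p.2) * fracAvg μ W p := by ring
  simp only [h2]
  refine (abs_add_le _ _).trans (add_le_add ?_ ?_)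
  · rw [abs_mul]
    exact (mul_le_of_le_one_left (abs_nonneg _) (hJ1' _ _)).trans h1
  · rw [abs_mul]
    exact mul_le_of_le_one_right (abs_nonneg _) (abs_fracAvg_le hμ hW1 p)

lemma isFracPerm_const : IsFracPerm (Kernel.const I (volume : Measure I)) :=
  ⟨inferInstance, fun A hA => by simp⟩

instance : Nonempty {μ : Kernel I I // IsFracPerm μ} := ⟨⟨_, isFracPerm_const⟩⟩

lemma abs_contQapAt_le {μ : Kernel I I} (hμ : IsFracPerm μ) {W J : I → I → ℝ}
    {C C' : ℝ} (hC : ∀ x y, |W x y| ≤ C) (hC' : ∀ x y, |J x y| ≤ C') :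
    |contQapAt μ W J| ≤ C' * C := by
  have := hμ.1
  refine abs_integral_le_of_abs_le fun i => abs_integral_le_of_abs_le fun j => ?_
  rw [abs_mul]
  refine mul_le_mul (hC' _ _) ?_ (abs_nonneg _) ((abs_nonneg _).trans (hC' 0 0))
  exact abs_integral_le_of_abs_le fun x => abs_integral_le_of_abs_le fun y => hC x y

lemma contQapAt_le_contQap {μ : Kernel I I} (hμ : IsFracPerm μ) {W J : I → I → ℝ}
    {C C' : ℝ} (hC : ∀ x y, |W x y| ≤ C) (hC' : ∀ x y, |J x y| ≤ C') :
    contQapAt μ W J ≤ contQap W J := by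
  refine le_ciSup (f := fun μ : {μ : Kernel I I // IsFracPerm μ} => contQapAt μ.1 W J) ?_ ⟨μ, hμ⟩
  refine ⟨C' * C, ?_⟩
  rintro _ ⟨ν, rfl⟩
  exact (abs_le.mp (abs_contQapAt_le ν.2 hC hC')).2

/-- The continuous quadratic assignment problem is Lipschitz in both arguments. -/
lemma abs_contQap_sub_le {W W' J J' : I → I → ℝ}
    (hW : Measurable (Function.uncurry W)) (hW' : Measurable (Function.uncurry W'))
    (hJ : Measurable (Function.uncurry J)) (hJ' : Measurable (Function.uncurry J'))
    (hW1 : ∀ x y, |W x y| ≤ 1) (hW1' : ∀ x y, |W' x y| ≤ 1)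
    (hJ1 : ∀ x y, |J x y| ≤ 1) (hJ1' : ∀ x y, |J' x y| ≤ 1) :
    |contQap W J - contQap W' J'|
      ≤ (∫ p : I × I, |W p.1 p.2 - W' p.1 p.2|) + ∫ p : I × I, |J p.1 p.2 - J' p.1 p.2| := by
  have key := fun μ : {μ : Kernel I I // IsFracPerm μ} => abs_le.mp
    (abs_contQapAt_sub_le μ.2 hW hW' hJ hJ' hW1 hW1' hJ1 hJ1')
  rw [abs_le]
  constructor
  · rw [neg_le_sub_iff_le_add]
    refine ciSup_le fun μ => ?_
    linarith [key μ, contQapAt_le_contQap μ.2 hW1 hJ1]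
  · rw [sub_le_iff_le_add']
    refine ciSup_le fun μ => ?_
    linarith [key μ, contQapAt_le_contQap μ.2 hW1' hJ1']

end ContinuousProblem

/-! ### Cells, step functions, and integrals of functions of a finite label. -/

section StepFunctions

open unitInterval

/-- The index of the cell of the partition of `[0,1]` into `n` intervals that contains `x`. -/
def cell (n : ℕ) [NeZero n] (x : I) : Fin n :=
  -- The minimum sends the endpoint 1 to the last cell.
  Fin.ofNat n (min ⌊(n : ℝ) * x⌋₊ (n - 1))

lemma measurable_cell (n : ℕ) [NeZero n] : Measurable (cell n) := by
  have h : Measurable fun x : I => ⌊(n : ℝ) * (x : ℝ)⌋₊ :=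
    Nat.measurable_floor.comp (measurable_const.mul measurable_subtype_coe)
  exact (measurable_from_nat (f := fun m => Fin.ofNat n (min m (n - 1)))).comp h

lemma cell_val (n : ℕ) [NeZero n] (x : I) :
    (cell n x : ℕ) = min ⌊(n : ℝ) * x⌋₊ (n - 1) := by
  have := NeZero.pos n
  rw [cell, Fin.val_ofNat]
  exact Nat.mod_eq_of_lt (by omega)

lemma cell_val_of_lt (n : ℕ) [NeZero n] {x : I} (hx : (x : ℝ) < 1) :
    (cell n x : ℕ) = ⌊(n : ℝ) * x⌋₊ := by
  have hn : (0 : ℝ) < n := by exact_mod_cast NeZero.pos n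
  have : ⌊(n : ℝ) * x⌋₊ < n := by
    rw [Nat.floor_lt (mul_nonneg hn.le x.2.1)]
    nlinarith
  rw [cell_val]
  omega

lemma cell_le (n : ℕ) [NeZero n] (x : I) : ((cell n x : ℕ) : ℝ) ≤ n * x := by
  have hn : (0 : ℝ) < n := by exact_mod_cast NeZero.pos n
  refine le_trans ?_ (Nat.floor_le (mul_nonneg hn.le x.2.1))
  rw [cell_val]
  exact_mod_cast min_le_left _ _

lemma le_cell_add_one (n : ℕ) [NeZero n] (x : I) : n * (x : ℝ) ≤ ((cell n x : ℕ) : ℝ) + 1 := by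
  have hn : (0 : ℝ) < n := by exact_mod_cast NeZero.pos n
  rcases lt_or_eq_of_le x.2.2 with hx | hx
  · rw [cell_val_of_lt n hx]
    exact (Nat.lt_floor_add_one _).le
  · have : ((cell n x : ℕ)) = n - 1 := by rw [cell_val, hx]; simp
    rw [this, hx, Nat.cast_sub (NeZero.pos n)]
    simp

lemma volume_cell (n : ℕ) [NeZero n] (i : Fin n) :
    (volume : Measure I).real (cell n ⁻¹' {i}) = 1 / n := by
  have hn : (0 : ℝ) < n := by exact_mod_cast NeZero.pos n
  have hi : ((i : ℕ) : ℝ) + 1 ≤ n := by exact_mod_cast i.2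
  set a : I := ⟨(i : ℕ) / n, by positivity, by rw [div_le_one hn]; linarith⟩ with ha
  set b : I := ⟨((i : ℕ) + 1) / n, by positivity, by rw [div_le_one hn]; linarith⟩ with hb
  have hab : (b : ℝ) - a = 1 / n := by simp only [ha, hb]; ring
  have h1 : Set.Ico a b ⊆ cell n ⁻¹' {i} := by
    rintro x ⟨hax, hxb⟩
    have hax' : ((i : ℕ) : ℝ) / n ≤ x := hax
    have hxb' : (x : ℝ) < ((i : ℕ) + 1) / n := hxb
    rw [div_le_iff₀ hn] at hax'
    rw [lt_div_iff₀ hn] at hxb'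
    have : ⌊(n : ℝ) * x⌋₊ = i := by
      rw [Nat.floor_eq_iff (by nlinarith [x.2.1])]
      constructor <;> linarith
    rw [Set.mem_preimage, Set.mem_singleton_iff, Fin.ext_iff, cell_val, this]
    have := i.2
    omega
  have h2 : cell n ⁻¹' {i} ⊆ Set.Icc a b := by
    intro x hx
    rw [Set.mem_preimage, Set.mem_singleton_iff] at hx
    have h3 := cell_le n x
    have h4 := le_cell_add_one n x
    rw [hx] at h3 h4
    constructor
    · change ((i : ℕ) : ℝ) / n ≤ x
      rw [div_le_iff₀ hn]; linarith
    · change (x : ℝ) ≤ ((i : ℕ) + 1) / n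
      rw [le_div_iff₀ hn]; linarith
  have h3 : (volume : Measure I) (cell n ⁻¹' {i}) = ENNReal.ofReal (1 / n) := by
    refine le_antisymm ((measure_mono h2).trans ?_) (le_trans ?_ (measure_mono h1))
    · rw [unitInterval.volume_Icc, hab]
    · rw [unitInterval.volume_Ico, hab]
  rw [measureReal_def, h3, ENNReal.toReal_ofReal (by positivity)]

lemma stepGraphon_eq {n : ℕ} [NeZero n] (G : Fin n → Fin n → ℝ) {x y : I} (hx : (x : ℝ) < 1)
    (hy : (y : ℝ) < 1) : stepGraphon G x y = G (cell n x) (cell n y) := by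
  have key : ∀ {x : I}, (x : ℝ) < 1 → ∀ i : Fin n,
      ⌊(n : ℝ) * (x : ℝ)⌋ = ((i : ℕ) : ℤ) ↔ cell n x = i := by
    intro x hx i
    have h0 : 0 ≤ (n : ℝ) * (x : ℝ) := mul_nonneg (Nat.cast_nonneg _) x.2.1
    rw [Fin.ext_iff, cell_val_of_lt n hx, ← Int.natCast_floor_eq_floor h0, Nat.cast_inj]
  simp only [stepGraphon, key hx, key hy, ite_and]
  simp

/-- The step function of an array in terms of cells, without exceptional null set. -/
def cellGraphon {n : ℕ} [NeZero n] (G : Fin n → Fin n → ℝ) : I → I → ℝ :=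
  fun x y => G (cell n x) (cell n y)

lemma stepGraphon_ae_eq {n : ℕ} [NeZero n] (G : Fin n → Fin n → ℝ) :
    ∀ᵐ p : I × I, stepGraphon G p.1 p.2 = cellGraphon G p.1 p.2 := by
  have h : ∀ᵐ x : I, (x : ℝ) < 1 := by
    have : ∀ᵐ x : I, x ≠ 1 := by simp [ae_iff]
    filter_upwards [this] with x hx
    exact lt_of_le_of_ne x.2.2 fun h => hx (Subtype.ext h)
  have h1 : ∀ᵐ p : I × I, (p.1 : ℝ) < 1 := Measure.quasiMeasurePreserving_fst.ae h
  have h2 : ∀ᵐ p : I × I, (p.2 : ℝ) < 1 := Measure.quasiMeasurePreserving_snd.ae h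
  filter_upwards [h1, h2] with p hp1 hp2
  exact stepGraphon_eq G hp1 hp2

lemma measurable_stepGraphon {n : ℕ} (G : Fin n → Fin n → ℝ) :
    Measurable (Function.uncurry (stepGraphon G)) := by
  have hf : Measurable fun x : I => ⌊(n : ℝ) * (x : ℝ)⌋ :=
    Int.measurable_floor.comp (measurable_const.mul measurable_subtype_coe)
  have hm : Measurable fun p : I × I =>
      ∑ i : Fin n, ∑ j : Fin n,
        if ⌊(n : ℝ) * (p.1 : ℝ)⌋ = ((i : ℕ) : ℤ) ∧ ⌊(n : ℝ) * (p.2 : ℝ)⌋ = ((j : ℕ) : ℤ)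
          then G i j else 0 := by
    refine Finset.measurable_sum _ fun i _ => Finset.measurable_sum _ fun j _ =>
      Measurable.ite ?_ measurable_const measurable_const
    exact ((hf.comp measurable_fst) (measurableSet_singleton _)).inter
      ((hf.comp measurable_snd) (measurableSet_singleton _))
  exact hm

lemma abs_stepGraphon_le {n : ℕ} {G : Fin n → Fin n → ℝ} {C : ℝ} (hC : 0 ≤ C)
    (hG : ∀ i j, |G i j| ≤ C) (x y : I) : |stepGraphon G x y| ≤ C := by
  by_cases hx : ∃ i : Fin n, ⌊(n : ℝ) * (x : ℝ)⌋ = ((i : ℕ) : ℤ)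
  · by_cases hy : ∃ j : Fin n, ⌊(n : ℝ) * (y : ℝ)⌋ = ((j : ℕ) : ℤ)
    · obtain ⟨i, hi⟩ := hx
      obtain ⟨j, hj⟩ := hy
      simp only [stepGraphon, hi, hj, Nat.cast_inj, ← Fin.ext_iff, ite_and]
      simpa using hG i j
    · push Not at hy
      simp [stepGraphon, hy, hC]
  · push Not at hx
    simp [stepGraphon, hx, hC]

lemma measurable_comp_label {Ω α : Type*} [MeasurableSpace Ω] [Fintype α] {f : Ω → α}
    (hf : ∀ a, MeasurableSet (f ⁻¹' {a})) (g : α → ℝ) : Measurable fun x => g (f x) := by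
  let _ : MeasurableSpace α := ⊤
  have hfm : Measurable f := measurable_to_countable' hf
  exact (measurable_from_top (f := g)).comp hfm

lemma measurable_comp_label₂ {Ω α : Type*} [MeasurableSpace Ω] [Fintype α] {f : Ω → α}
    (hf : ∀ a, MeasurableSet (f ⁻¹' {a})) (g : α → α → ℝ) :
    Measurable (Function.uncurry fun x y => g (f x) (f y)) := by
  let _ : MeasurableSpace α := ⊤
  have hfm : Measurable f := measurable_to_countable' hf
  have h : Measurable (Function.uncurry g) := Measurable.of_discrete
  exact h.comp (hfm.prodMap hfm)

lemma integral_comp_label {Ω α : Type*} [MeasurableSpace Ω] [Fintype α] {f : Ω → α}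
    (hf : ∀ a, MeasurableSet (f ⁻¹' {a})) (g : α → ℝ) (ν : Measure Ω) [IsFiniteMeasure ν] :
    ∫ x, g (f x) ∂ν = ∑ a, ν.real (f ⁻¹' {a}) * g a := by
  let _ : MeasurableSpace α := ⊤
  have hfm : Measurable f := measurable_to_countable' hf
  have hg : Measurable g := measurable_from_top
  rw [← integral_map hfm.aemeasurable hg.aestronglyMeasurable,
    integral_fintype (Integrable.of_finite)]
  simp only [map_measureReal_apply hfm (measurableSet_singleton _), smul_eq_mul]

lemma measurableSet_cell (n : ℕ) [NeZero n] (i : Fin n) : MeasurableSet (cell n ⁻¹' {i}) :=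
  measurable_cell n (measurableSet_singleton i)

lemma measurable_cellGraphon {n : ℕ} [NeZero n] (G : Fin n → Fin n → ℝ) :
    Measurable (Function.uncurry (cellGraphon G)) :=
  measurable_comp_label₂ (measurableSet_cell n) G

end StepFunctions

/-! ### Fractional permutations versus fractional labellings of the cells. -/

section FractionalLabels

open unitInterval

variable {B : Type*} [Fintype B] [DecidableEq B] [Nonempty B] {D : B → B → ℝ} {c : B → ℝ}
  {n : ℕ} [NeZero n]

/-- The mass that the part of `[0,1]` labelled `b` sends to the cell `i`. -/
def cellMass (μ : Kernel I I) (l : I → B) (i : Fin n) (b : B) : ℝ :=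
  ∫ y, (if l y = b then 1 else 0) * (μ y).real (cell n ⁻¹' {i})

lemma measurable_ite_label {Ω : Type*} [MeasurableSpace Ω] {l : Ω → B}
    (hl : ∀ b, MeasurableSet (l ⁻¹' {b})) (b : B) :
    Measurable fun y => if l y = b then (1 : ℝ) else 0 :=
  measurable_comp_label hl fun b' => if b' = b then 1 else 0

lemma integrable_cellMass {μ : Kernel I I} (hμ : IsFracPerm μ) {l : I → B}
    (hl : ∀ b, MeasurableSet (l ⁻¹' {b})) (i : Fin n) (b : B) :
    Integrable fun y => (if l y = b then (1 : ℝ) else 0) * (μ y).real (cell n ⁻¹' {i}) := by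
  have := hμ.1
  refine integrable_of_abs_le (C := 1) ((measurable_ite_label hl b).mul
    (Kernel.measurable_coe μ (measurableSet_cell n i)).ennreal_toReal) fun y => ?_
  rw [abs_mul]
  refine mul_le_one₀ (by split_ifs <;> simp) (abs_nonneg _) ?_
  rw [abs_of_nonneg measureReal_nonneg]
  exact measureReal_le_one

lemma integral_sum_mul {Ω κ : Type*} [MeasurableSpace Ω] {ν : Measure Ω} [Fintype κ] {u : κ → Ω → ℝ}
    (hu : ∀ p, Integrable (u p) ν) (K : κ → ℝ) :
    ∫ s, ∑ p, u p s * K p ∂ν = ∑ p, (∫ s, u p s ∂ν) * K p := by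
  rw [integral_finsetSum _ fun p _ => (hu p).mul_const _]
  simp only [integral_mul_const]

/-- For step functions only the masses sent from labels to cells matter: the integrand is a finite
sum of products of a function of `s` and a function of `t`. The factor `n` compensates for `quad`
averaging over vertices. -/
lemma contQapAt_cellGraphon {μ : Kernel I I} (hμ : IsFracPerm μ) {l : I → B}
    (hl : ∀ b, MeasurableSet (l ⁻¹' {b})) (G : Fin n → Fin n → ℝ) :
    contQapAt μ (cellGraphon G) (fun s t => D (l s) (l t))
      = quad D G fun i b => n * cellMass μ l i b := by
  have := hμ.1
  have hn : (n : ℝ) ≠ 0 := by exact_mod_cast NeZero.ne n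
  set u : Fin n × B → I → ℝ := fun p y =>
    (if l y = p.2 then 1 else 0) * (μ y).real (cell n ⁻¹' {p.1}) with hu
  have hui : ∀ p, Integrable (u p) := fun p => integrable_cellMass hμ hl p.1 p.2
  have h1 : ∀ s t, D (l s) (l t) * ∫ x, ∫ y, cellGraphon G x y ∂(μ t) ∂(μ s)
      = ∑ r, u r t * ∑ p, u p s * (D p.2 r.2 * G p.1 r.1) := by
    intro s t
    have e : ∀ x, ∫ y, cellGraphon G x y ∂(μ t)
        = ∑ j, (μ t).real (cell n ⁻¹' {j}) * G (cell n x) j := fun x =>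
      integral_comp_label (measurableSet_cell n) (fun j => G (cell n x) j) (μ t)
    simp only [e]
    rw [integral_comp_label (measurableSet_cell n)
      fun i => ∑ j, (μ t).real (cell n ⁻¹' {j}) * G i j]
    simp only [hu, Fintype.sum_prod_type, ite_mul, one_mul, zero_mul, Finset.mul_sum,
      Finset.sum_ite_eq, Finset.mem_univ, if_true]
    rw [Finset.sum_comm]
    refine Finset.sum_congr rfl fun j _ => ?_
    rw [Finset.sum_comm]
    simp only [Finset.sum_ite_eq, Finset.mem_univ, if_true]
    refine Finset.sum_congr rfl fun i _ => ?_
    ring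
  simp only [contQapAt, h1]
  have h2 : ∀ s, ∫ t, ∑ r, u r t * ∑ p, u p s * (D p.2 r.2 * G p.1 r.1)
      = ∑ p, u p s * ∑ r, (∫ t, u r t) * (D p.2 r.2 * G p.1 r.1) := by
    intro s
    rw [integral_sum_mul hui fun r => ∑ p, u p s * (D p.2 r.2 * G p.1 r.1)]
    simp only [Finset.mul_sum]
    rw [Finset.sum_comm]
    refine Finset.sum_congr rfl fun p _ => Finset.sum_congr rfl fun r _ => ?_
    ring
  simp only [h2]
  rw [integral_sum_mul hui fun p => ∑ r, (∫ t, u r t) * (D p.2 r.2 * G p.1 r.1)]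
  simp only [quad, Fintype.expect_eq_sum_div_card, Fintype.card_fin]
  change ∑ p : Fin n × B, cellMass μ l p.1 p.2 * ∑ r : Fin n × B, cellMass μ l r.1 r.2 * _ = _
  simp only [Fintype.sum_prod_type, Finset.mul_sum, Finset.sum_div]
  refine Finset.sum_congr rfl fun i _ => ?_
  rw [Finset.sum_comm]
  refine Finset.sum_congr rfl fun j _ => Finset.sum_congr rfl fun a _ =>
    Finset.sum_congr rfl fun b _ => ?_
  field_simp

lemma IsFracPerm.integral_real {μ : Kernel I I} (hμ : IsFracPerm μ) {A : Set I}
    (hA : MeasurableSet A) : ∫ y, (μ y).real A = (volume : Measure I).real A := by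
  have := hμ.1
  simp only [measureReal_def]
  rw [integral_toReal (Kernel.measurable_coe μ hA).aemeasurable, hμ.2 A hA]
  exact Eventually.of_forall fun y => measure_lt_top _ _

/-- The rows sum to one because `μ` preserves volume and a cell has volume 1/n. That each `μ y` is a
probability measure is used in `marg_cellMass` instead. -/
lemma isProb_cellMass {μ : Kernel I I} (hμ : IsFracPerm μ) {l : I → B}
    (hl : ∀ b, MeasurableSet (l ⁻¹' {b})) : IsProb fun (i : Fin n) b => n * cellMass μ l i b := by
  have hn : (n : ℝ) ≠ 0 := by exact_mod_cast NeZero.ne n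
  refine ⟨fun i b => mul_nonneg (Nat.cast_nonneg _) (integral_nonneg fun y => ?_), fun i => ?_⟩
  · exact mul_nonneg (by dsimp only; split_ifs <;> simp) measureReal_nonneg
  · simp only [cellMass, ← Finset.mul_sum]
    rw [← integral_finsetSum _ fun b _ => integrable_cellMass hμ hl i b]
    simp only [ite_mul, one_mul, zero_mul, Finset.sum_ite_eq, Finset.mem_univ, if_true]
    rw [hμ.integral_real (measurableSet_cell n i), volume_cell]
    field_simp

lemma sum_real_cell (ν : Measure I) [IsProbabilityMeasure ν] :
    ∑ i, ν.real (cell n ⁻¹' {i}) = 1 := by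
  have := integral_comp_label (measurableSet_cell n) (fun _ => (1 : ℝ)) ν
  simpa using this.symm

lemma marg_cellMass {μ : Kernel I I} (hμ : IsFracPerm μ) {l : I → B}
    (hl : ∀ b, MeasurableSet (l ⁻¹' {b})) (b : B) :
    marg (fun (i : Fin n) b => n * cellMass μ l i b) b = (volume : Measure I).real (l ⁻¹' {b}) := by
  have hn : (n : ℝ) ≠ 0 := by exact_mod_cast NeZero.ne n
  have := hμ.1
  simp only [marg, Fintype.expect_eq_sum_div_card, Fintype.card_fin, ← Finset.mul_sum]
  rw [mul_div_cancel_left₀ _ hn]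
  simp only [cellMass]
  rw [← integral_finsetSum _ fun i _ => integrable_cellMass hμ hl i b]
  simp only [← Finset.mul_sum, sum_real_cell, mul_one]
  rw [integral_comp_label hl fun b' => if b' = b then (1 : ℝ) else 0]
  simp

/-- The conditional distribution of a point with label `b` under a fractional labelling `φ`. -/
def labelMeasure (φ : Fin n → B → ℝ) (b : B) : Measure I :=
  -- An arbitrary probability measure; such a label carries no mass.
  if marg φ b = 0 then volume
  else volume.withDensity fun x => ENNReal.ofReal (φ (cell n x) b / marg φ b)

lemma measurable_cell_density (φ : Fin n → B → ℝ) (b : B) :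
    Measurable fun x : I => ENNReal.ofReal (φ (cell n x) b / marg φ b) :=
  (measurable_comp_label (measurableSet_cell n) fun i => φ i b / marg φ b).ennreal_ofReal

lemma eq_zero_of_marg_eq_zero {φ : Fin n → B → ℝ} (hφ : IsProb φ) {b : B} (h : marg φ b = 0)
    (i : Fin n) : φ i b = 0 := by
  rw [marg, Finset.expect_eq_zero_iff_of_nonneg (fun i _ => hφ.nonneg i b)] at h
  exact h i (Finset.mem_univ i)

lemma marg_mul_labelMeasure {φ : Fin n → B → ℝ} (hφ : IsProb φ) (b : B) {A : Set I}
    (hA : MeasurableSet A) : ENNReal.ofReal (marg φ b) * labelMeasure φ b A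
      = ∫⁻ x in A, ENNReal.ofReal (φ (cell n x) b) := by
  rw [labelMeasure]
  split_ifs with h
  · simp [h, eq_zero_of_marg_eq_zero hφ h]
  · have hpos : 0 < marg φ b := lt_of_le_of_ne (marg_nonneg hφ b) (Ne.symm h)
    rw [withDensity_apply _ hA, ← lintegral_const_mul _ (measurable_cell_density φ b)]
    refine lintegral_congr fun x => ?_
    rw [← ENNReal.ofReal_mul hpos.le, mul_div_cancel₀ _ h]

lemma lintegral_cell (g : Fin n → ℝ) (hg : ∀ i, 0 ≤ g i) :
    ∫⁻ x : I, ENNReal.ofReal (g (cell n x)) = ENNReal.ofReal (𝔼 i, g i) := by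
  have hm := measurable_comp_label (measurableSet_cell n) g
  rw [← ofReal_integral_eq_lintegral_ofReal _ (Eventually.of_forall fun x => hg _),
    integral_comp_label (measurableSet_cell n) g]
  · simp only [volume_cell, Fintype.expect_eq_sum_div_card, Fintype.card_fin, Finset.sum_div]
    congr 1
    refine Finset.sum_congr rfl fun i _ => ?_
    ring
  · have hi : Integrable (fun x : I => g (cell n x)) :=
      integrable_of_abs_le hm (C := ∑ i, |g i|) fun x =>
        Finset.single_le_sum (f := fun i => |g i|) (fun i _ => abs_nonneg _) (Finset.mem_univ _)
    exact hi

lemma isProbabilityMeasure_labelMeasure {φ : Fin n → B → ℝ} (hφ : IsProb φ) (b : B) :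
    IsProbabilityMeasure (labelMeasure φ b) := by
  by_cases h : marg φ b = 0
  · rw [labelMeasure, if_pos h]; infer_instance
  · have hpos : 0 < marg φ b := lt_of_le_of_ne (marg_nonneg hφ b) (Ne.symm h)
    constructor
    have h1 := marg_mul_labelMeasure hφ b MeasurableSet.univ
    rw [Measure.restrict_univ, lintegral_cell (fun i => φ i b) fun i => hφ.nonneg i b] at h1
    change _ = ENNReal.ofReal (marg φ b) at h1
    have h0 : ENNReal.ofReal (marg φ b) ≠ 0 := by simpa using hpos
    exact (ENNReal.mul_eq_left h0 ENNReal.ofReal_ne_top).mp h1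

/-- The fractional permutation induced by a fractional labelling of the cells. -/
def labelKernel (φ : Fin n → B → ℝ) {l : I → B} (hl : ∀ b, MeasurableSet (l ⁻¹' {b})) :
    Kernel I I where
  toFun y := labelMeasure φ (l y)
  measurable' := by
    let _ : MeasurableSpace B := ⊤
    have hlm : Measurable l := measurable_to_countable' hl
    exact (measurable_from_top (f := labelMeasure φ)).comp hlm

lemma labelKernel_apply (φ : Fin n → B → ℝ) {l : I → B} (hl : ∀ b, MeasurableSet (l ⁻¹' {b}))
    (y : I) : labelKernel φ hl y = labelMeasure φ (l y) := rfl

lemma lintegral_comp_label {Ω α : Type*} [MeasurableSpace Ω] [Fintype α] {f : Ω → α}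
    (hf : ∀ a, MeasurableSet (f ⁻¹' {a})) (g : α → ENNReal) (ν : Measure Ω) :
    ∫⁻ x, g (f x) ∂ν = ∑ a, ν (f ⁻¹' {a}) * g a := by
  let _ : MeasurableSpace α := ⊤
  have hfm : Measurable f := measurable_to_countable' hf
  have hg : Measurable g := measurable_from_top
  rw [← lintegral_map hg hfm, lintegral_fintype]
  refine Finset.sum_congr rfl fun a _ => ?_
  rw [Measure.map_apply hfm (measurableSet_singleton a), mul_comm]

/-- Mixing the conditional laws with weights `marg φ b` gives density Σ_b φ b = 1. This needs the
label sets to have volume exactly `marg φ b`. -/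
lemma isFracPerm_labelKernel {φ : Fin n → B → ℝ} (hφ : IsProb φ) {l : I → B}
    (hl : ∀ b, MeasurableSet (l ⁻¹' {b}))
    (hc : ∀ b, marg φ b = (volume : Measure I).real (l ⁻¹' {b})) :
    IsFracPerm (labelKernel φ hl) := by
  refine ⟨⟨fun y => isProbabilityMeasure_labelMeasure hφ (l y)⟩, fun A hA => ?_⟩
  simp only [labelKernel_apply]
  rw [lintegral_comp_label hl fun b => labelMeasure φ b A]
  have h1 : ∀ b, (volume : Measure I) (l ⁻¹' {b}) = ENNReal.ofReal (marg φ b) := fun b => by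
    rw [hc, ofReal_measureReal]
  simp only [h1, marg_mul_labelMeasure hφ _ hA]
  rw [← lintegral_finsetSum _ fun b _ =>
    (measurable_comp_label (measurableSet_cell n) fun i => φ i b).ennreal_ofReal]
  simp only [← ENNReal.ofReal_sum_of_nonneg fun b _ => hφ.nonneg _ b, hφ.sum_eq]
  simp

lemma cellMass_labelKernel {φ : Fin n → B → ℝ} (hφ : IsProb φ) {l : I → B}
    (hl : ∀ b, MeasurableSet (l ⁻¹' {b}))
    (hc : ∀ b, marg φ b = (volume : Measure I).real (l ⁻¹' {b})) (i : Fin n) (b : B) :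
    n * cellMass (labelKernel φ hl) l i b = φ i b := by
  have hn : (n : ℝ) ≠ 0 := by exact_mod_cast NeZero.ne n
  simp only [cellMass, labelKernel_apply]
  rw [integral_comp_label hl fun b' =>
    (if b' = b then 1 else 0) * (labelMeasure φ b').real (cell n ⁻¹' {i})]
  simp only [ite_mul, one_mul, zero_mul, mul_ite, mul_zero, Finset.sum_ite_eq', Finset.mem_univ,
    if_true, ← hc]
  have h1 := marg_mul_labelMeasure hφ b (measurableSet_cell n i)
  rw [setLIntegral_congr_fun (measurableSet_cell n i)
    (g := fun _ => ENNReal.ofReal (φ i b)) (fun x hx => by rw [hx]), setLIntegral_const] at h1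
  have h2 := congrArg ENNReal.toReal h1
  rw [ENNReal.toReal_mul, ENNReal.toReal_mul, ENNReal.toReal_ofReal (marg_nonneg hφ b),
    ENNReal.toReal_ofReal (hφ.nonneg i b)] at h2
  change marg φ b * (labelMeasure φ b).real _ = φ i b * (volume : Measure I).real _ at h2
  rw [h2, volume_cell]
  field_simp

end FractionalLabels

/-! ### The continuous problem as a penalized labelling problem; step function approximation. -/

section ContinuousTransfer

open unitInterval

variable {B : Type*} [Fintype B] [DecidableEq B] [Nonempty B] {D : B → B → ℝ} {c : B → ℝ}

lemma abs_quad_sub_quad_le {ι : Type*} [Fintype ι] [Nonempty ι] (hD : ∀ a b, |D a b| ≤ 1)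
    {H : ι → ι → ℝ} (hH : ∀ i j, |H i j| ≤ 1) {φ ψ : ι → B → ℝ} (hφ : IsProb φ) (hψ : IsProb ψ) :
    |quad D H φ - quad D H ψ| ≤ 2 * 𝔼 i, ∑ b, |φ i b - ψ i b| := by
  rw [quad_eq, quad_eq]
  simp only [← Finset.expect_sub_distrib, ← sub_mul]
  refine (abs_expect_expect_le (g := fun i j => ∑ b, |φ i b - ψ i b| + ∑ b, |φ j b - ψ j b|)
    fun i j => ?_).trans (le_of_eq ?_)
  · rw [abs_mul]
    refine (mul_le_of_le_one_right (abs_nonneg _) (hH i j)).trans ?_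
    have h1 : ∀ a b, |φ i a * φ j b * D a b - ψ i a * ψ j b * D a b|
        ≤ |φ i a - ψ i a| * φ j b + ψ i a * |φ j b - ψ j b| := by
      intro a b
      rw [← sub_mul, abs_mul]
      refine (mul_le_of_le_one_right (abs_nonneg _) (hD a b)).trans ?_
      have : φ i a * φ j b - ψ i a * ψ j b
          = (φ i a - ψ i a) * φ j b + ψ i a * (φ j b - ψ j b) := by ring
      rw [this]
      refine (abs_add_le _ _).trans (le_of_eq ?_)
      rw [abs_mul, abs_mul, abs_of_nonneg (hφ.nonneg j b), abs_of_nonneg (hψ.nonneg i a)]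
    simp only [← Finset.sum_sub_distrib]
    refine (Finset.abs_sum_le_sum_abs _ _).trans ((Finset.sum_le_sum fun a _ =>
      (Finset.abs_sum_le_sum_abs _ _).trans (Finset.sum_le_sum fun b _ => h1 a b)).trans
      (le_of_eq ?_))
    simp only [Finset.sum_add_distrib, ← Finset.mul_sum, hφ.sum_eq, mul_one, ← Finset.sum_mul,
      hψ.sum_eq, one_mul]
  · simp only [Finset.expect_add_distrib, Fintype.expect_const]
    ring

/-- A labelling can be perturbed to a fractional one with prescribed label fractions. -/
lemma exists_isProb_marg_eq {ι : Type*} [Fintype ι] [Nonempty ι] (hD : ∀ a b, |D a b| ≤ 1)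
    {H : ι → ι → ℝ} (hH : ∀ i j, |H i j| ≤ 1) (hc : ∀ b, 0 ≤ c b) (hc1 : ∑ b, c b = 1)
    (a : ι → B) : ∃ φ : ι → B → ℝ, IsProb φ ∧ (∀ b, marg φ b = c b) ∧
      fracVal D c H (vertex a) ≤ quad D H φ := by
  set c' : B → ℝ := marg (vertex a) with hc'
  have hc'0 : ∀ b, 0 ≤ c' b := marg_nonneg (isProb_vertex a)
  have hc'1 : ∑ b, c' b = 1 := sum_marg (isProb_vertex a)
  set m : B → ℝ := fun b => min (c b) (c' b) with hm
  -- Maximal coupling of `c'` and `c`: their common part `m` keeps its labels, and the remaining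
  -- mass `R`, at most the total deviation, is redistributed according to `r`.
  have hm0 : ∀ b, 0 ≤ m b := fun b => le_min (hc b) (hc'0 b)
  have hmc : ∀ b, m b ≤ c b := fun b => min_le_left _ _
  have hmc' : ∀ b, m b ≤ c' b := fun b => min_le_right _ _
  set R : ℝ := 1 - ∑ b, m b with hR
  have hR0 : 0 ≤ R := by
    rw [hR, ← hc1]; exact sub_nonneg.mpr (Finset.sum_le_sum fun b _ => hmc b)
  have hRle : R ≤ ∑ b, |c' b - c b| := by
    rw [hR, ← hc1, ← Finset.sum_sub_distrib]
    refine Finset.sum_le_sum fun b _ => ?_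
    simp only [hm]
    rcases min_cases (c b) (c' b) with ⟨h, h'⟩ | ⟨h, h'⟩
    · rw [h, sub_self]; exact abs_nonneg _
    · rw [h, abs_sub_comm]; exact le_abs_self _
  rcases hR0.eq_or_lt with h0 | hpos
  · refine ⟨vertex a, isProb_vertex a, ?_, ?_⟩
    · have h1 : ∀ b ∈ Finset.univ, m b = c b :=
        (Finset.sum_eq_sum_iff_of_le fun b _ => hmc b).mp (by rw [hc1]; linarith)
      have h2 : ∀ b ∈ Finset.univ, m b = c' b :=
        (Finset.sum_eq_sum_iff_of_le fun b _ => hmc' b).mp (by rw [hc'1]; linarith)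
      intro b
      rw [← h1 b (Finset.mem_univ b), h2 b (Finset.mem_univ b)]
    · rw [fracVal, sub_le_self_iff]
      positivity
  set r : B → ℝ := fun b => (c b - m b) / R with hr
  have hr0 : ∀ b, 0 ≤ r b := fun b => div_nonneg (sub_nonneg.mpr (hmc b)) hR0
  have hr1 : ∑ b, r b = 1 := by
    simp only [hr, ← Finset.sum_div, Finset.sum_sub_distrib, hc1]
    exact div_self hpos.ne'
  -- The fraction of the vertex that keeps its label.
  set κ : ι → ℝ := fun i => m (a i) / c' (a i) with hκ
  have hκ0 : ∀ i, 0 ≤ κ i := fun i => div_nonneg (hm0 _) (hc'0 _)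
  have hκ1 : ∀ i, κ i ≤ 1 := fun i => div_le_one_of_le₀ (hmc' _) (hc'0 _)
  have hκm : ∀ b, 𝔼 i, κ i * vertex a i b = m b := by
    intro b
    have : ∀ i, κ i * vertex a i b = m b / c' b * vertex a i b := by
      intro i
      simp only [hκ, vertex]
      split_ifs with h
      · rw [h]
      · simp
    simp only [this, ← Finset.mul_expect]
    change m b / c' b * c' b = m b
    rcases (hc'0 b).eq_or_lt with h | h
    · rw [← h, mul_zero]; exact (le_antisymm (h ▸ hmc' b) (hm0 b)).symm
    · exact div_mul_cancel₀ _ h.ne'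
  have hκE : 𝔼 i, κ i = ∑ b, m b := by
    simp only [← hκm]
    rw [← Finset.expect_sum_comm]
    simp only [← Finset.mul_sum, (isProb_vertex a).sum_eq, mul_one]
  have hκR : 𝔼 i, (1 - κ i) = R := by
    rw [Finset.expect_sub_distrib, hκE, Fintype.expect_const]
  have hφ : IsProb fun i b => κ i * vertex a i b + (1 - κ i) * r b := by
    refine ⟨fun i b => add_nonneg (mul_nonneg (hκ0 i) ((isProb_vertex a).nonneg i b))
      (mul_nonneg (sub_nonneg.mpr (hκ1 i)) (hr0 b)), fun i => ?_⟩
    rw [Finset.sum_add_distrib, ← Finset.mul_sum, ← Finset.mul_sum, hr1, (isProb_vertex a).sum_eq]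
    ring
  refine ⟨_, hφ, fun b => ?_, ?_⟩
  · rw [marg, Finset.expect_add_distrib, hκm, ← Finset.expect_mul, hκR, hr,
      mul_div_cancel₀ _ hpos.ne']
    ring
  · have h1 := (abs_le.mp (abs_quad_sub_quad_le hD hH (isProb_vertex a) hφ)).2
    -- The labelling moves by at most 2R in L¹ and the form by twice that: 4R, exactly what the
    -- penalty pays for.
    have h2 : 𝔼 i, ∑ b, |vertex a i b - (κ i * vertex a i b + (1 - κ i) * r b)| ≤ 2 * R := by
      rw [← hκR, Finset.mul_expect]
      refine expect_mono fun i => ?_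
      have : ∀ b, |vertex a i b - (κ i * vertex a i b + (1 - κ i) * r b)|
          ≤ (1 - κ i) * (vertex a i b + r b) := by
        intro b
        rw [show vertex a i b - (κ i * vertex a i b + (1 - κ i) * r b)
          = (1 - κ i) * (vertex a i b - r b) by ring, abs_mul,
          abs_of_nonneg (sub_nonneg.mpr (hκ1 i))]
        refine mul_le_mul_of_nonneg_left ?_ (sub_nonneg.mpr (hκ1 i))
        refine (abs_sub _ _).trans (le_of_eq ?_)
        rw [abs_of_nonneg ((isProb_vertex a).nonneg i b), abs_of_nonneg (hr0 b)]
      refine (Finset.sum_le_sum fun b _ => this b).trans (le_of_eq ?_)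
      rw [← Finset.mul_sum, Finset.sum_add_distrib, hr1, (isProb_vertex a).sum_eq]
      ring
    rw [fracVal]
    linarith

lemma sum_volume_label {l : I → B} (hl : ∀ b, MeasurableSet (l ⁻¹' {b})) :
    ∑ b, (volume : Measure I).real (l ⁻¹' {b}) = 1 := by
  have := integral_comp_label hl (fun _ => (1 : ℝ)) (volume : Measure I)
  simpa using this.symm

/-- The continuous problem for step functions is a penalized labelling problem. -/
lemma abs_contQap_cellGraphon_sub_le {n : ℕ} [NeZero n] (hD : ∀ a b, |D a b| ≤ 1)
    {G : Fin n → Fin n → ℝ} (hG : ∀ x y, |G x y| ≤ 1) {l : I → B}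
    (hl : ∀ b, MeasurableSet (l ⁻¹' {b})) {δ : ℝ} (hδ : 0 < δ) :
    |contQap (cellGraphon G) (fun s t => D (l s) (l t))
        - partOpt D (fun b => (volume : Measure I).real (l ⁻¹' {b})) G|
      ≤ 2 / n + 4 * (δ + Fintype.card B / (n * δ)) := by
  have hn : (0 : ℝ) < n := by exact_mod_cast NeZero.pos n
  have hpos : 0 ≤ 2 / (n : ℝ) + 4 * (δ + Fintype.card B / (n * δ)) := by positivity
  set c : B → ℝ := fun b => (volume : Measure I).real (l ⁻¹' {b}) with hc
  rw [abs_le]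
  constructor
  -- This direction has no error: the penalty already pays for a fractional labelling with exact
  -- fractions, which is realized by a kernel. Rounding is needed only in the other direction.
  · obtain ⟨a, ha⟩ := exists_partOpt_eq D c G
    obtain ⟨φ, hφ, hφc, hφa⟩ := exists_isProb_marg_eq hD hG (c := c)
      (fun b => measureReal_nonneg) (sum_volume_label hl) a
    have h1 := contQapAt_cellGraphon (D := D) (isFracPerm_labelKernel hφ hl hφc) hl G
    simp only [cellMass_labelKernel hφ hl hφc] at h1
    have h2 := contQapAt_le_contQap (isFracPerm_labelKernel hφ hl hφc)
      (W := cellGraphon G) (J := fun s t => D (l s) (l t)) (fun x y => hG _ _) (fun x y => hD _ _)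
    linarith
  · rw [sub_le_iff_le_add']
    refine ciSup_le fun μ => ?_
    rw [contQapAt_cellGraphon μ.2 hl]
    have h1 := fracVal_le_partOpt_add (c := c) hD hG (isProb_cellMass (n := n) μ.2 hl) hδ
    simp only [fracVal, marg_cellMass μ.2 hl, Fintype.card_fin] at h1
    simpa [hc] using h1

lemma abs_contQap_stepGraphon_sub_le {n : ℕ} [NeZero n] (hD : ∀ a b, |D a b| ≤ 1)
    {G : Fin n → Fin n → ℝ} (hG : ∀ x y, |G x y| ≤ 1) {l : I → B}
    (hl : ∀ b, MeasurableSet (l ⁻¹' {b})) {δ : ℝ} (hδ : 0 < δ) {W J : I → I → ℝ}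
    (hW : Measurable (Function.uncurry W)) (hW1 : ∀ x y, |W x y| ≤ 1)
    (hJ : Measurable (Function.uncurry J)) (hJ1 : ∀ x y, |J x y| ≤ 1) {η γ : ℝ}
    (hη : ∫ p : I × I, |J p.1 p.2 - D (l p.1) (l p.2)| ≤ η)
    (hγ : ∫ p : I × I, |W p.1 p.2 - cellGraphon G p.1 p.2| ≤ γ) :
    |contQap W J - partOpt D (fun b => (volume : Measure I).real (l ⁻¹' {b})) G|
      ≤ γ + η + (2 / n + 4 * (δ + Fintype.card B / (n * δ))) := by
  refine (abs_sub_le _ (contQap (cellGraphon G) (fun s t => D (l s) (l t))) _).trans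
    (add_le_add ?_ (abs_contQap_cellGraphon_sub_le hD hG hl hδ))
  exact (abs_contQap_sub_le hW (measurable_cellGraphon G) hJ (measurable_comp_label₂ hl D) hW1
    (fun x y => hG _ _) hJ1 fun x y => hD _ _).trans (add_le_add hγ hη)

lemma integral_abs_stepGraphon_sub {n : ℕ} [NeZero n] (G : Fin n → Fin n → ℝ) :
    ∫ p : I × I, |stepGraphon G p.1 p.2 - cellGraphon G p.1 p.2| = 0 := by
  refine integral_eq_zero_of_ae ?_
  filter_upwards [stepGraphon_ae_eq G] with p hp
  simp [hp]

/-- Bounded measurable kernels are approximated by step functions. -/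
lemma exists_cellGraphon_approx {W : I → I → ℝ} (hW : Measurable (Function.uncurry W))
    (hW1 : ∀ x y, |W x y| ≤ 1) {δ : ℝ} (hδ : 0 < δ) :
    ∃ n₀ : ℕ, ∀ n : ℕ, ∀ _ : NeZero n, n₀ ≤ n → ∃ G : Fin n → Fin n → ℝ, (∀ i j, |G i j| ≤ 1) ∧
      ∫ p : I × I, |W p.1 p.2 - cellGraphon G p.1 p.2| ≤ δ := by
  obtain ⟨f, hf, -⟩ := (integrable_of_abs_le (μ := (volume : Measure (I × I))) hW
    fun z => hW1 z.1 z.2).exists_boundedContinuous_integral_sub_le (half_pos hδ)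
  -- Clipping a continuous L¹ approximation to [-1,1] does not increase its distance to `W` and
  -- bounds the sampled values.
  set g : I × I → ℝ := fun p => max (-1) (min 1 (f p)) with hg
  have hgc : Continuous g := continuous_const.max (continuous_const.min f.continuous)
  have hg1 : ∀ p, |g p| ≤ 1 := fun p =>
    abs_le.mpr ⟨le_max_left _ _, max_le (by norm_num) (min_le_left _ _)⟩
  have hu : UniformContinuous g := CompactSpace.uniformContinuous_of_continuous hgc
  obtain ⟨r, hr, hgr⟩ := Metric.uniformContinuous_iff.mp hu (δ / 2) (half_pos hδ)
  obtain ⟨n₀, hn₀⟩ := exists_nat_one_div_lt hr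
  refine ⟨n₀ + 1, fun n _ hn => ?_⟩
  have hnpos : (0 : ℝ) < n := by exact_mod_cast NeZero.pos n
  have hnr : 1 / (n : ℝ) < r := by
    refine lt_of_le_of_lt ?_ hn₀
    exact one_div_le_one_div_of_le (by positivity) (by exact_mod_cast hn)
  set pt : Fin n → I := fun i => ⟨(i : ℕ) / n, by positivity, by
    rw [div_le_one hnpos]; exact_mod_cast i.2.le⟩ with hpt
  have hdist : ∀ x : I, dist x (pt (cell n x)) < r := by
    intro x
    refine lt_of_le_of_lt ?_ hnr
    rw [Subtype.dist_eq, Real.dist_eq]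
    have h1 := cell_le n x
    have h2 := le_cell_add_one n x
    have h3 : (x : ℝ) - (pt (cell n x) : ℝ) = (n * x - (cell n x : ℕ)) / n := by
      simp only [hpt]; field_simp
    rw [h3, abs_div, abs_of_pos hnpos, abs_of_nonneg (by linarith)]
    gcongr
    linarith
  refine ⟨fun i j => g (pt i, pt j), fun i j => hg1 _, ?_⟩
  have hgW : ∀ p : I × I, |W p.1 p.2 - g p| ≤ |W p.1 p.2 - f p| := by
    intro p
    have h := abs_le.mp (hW1 p.1 p.2)
    simp only [hg]
    rcases max_cases (-1) (min 1 (f p)) with ⟨h1, h2⟩ | ⟨h1, h2⟩ <;>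
    rcases min_cases 1 (f p) with ⟨h3, h4⟩ | ⟨h3, h4⟩ <;>
    rw [abs_le] <;> constructor <;>
    cases abs_cases (W p.1 p.2 - f p) <;> linarith
  have hfi : Integrable (fun p : I × I => |W p.1 p.2 - f p|) := by
    have h := ((integrable_of_abs_le (μ := (volume : Measure (I × I))) hW
      fun z => hW1 z.1 z.2).sub (f.integrable _)).abs
    exact h
  calc ∫ p : I × I, |W p.1 p.2 - cellGraphon (fun i j => g (pt i, pt j)) p.1 p.2|
      ≤ ∫ p : I × I, (|W p.1 p.2 - f p| + δ / 2) := by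
        refine integral_mono_of_nonneg (Eventually.of_forall fun p => abs_nonneg _)
          (hfi.add (integrable_const _)) (Eventually.of_forall fun p => ?_)
        have h1 : dist p (pt (cell n p.1), pt (cell n p.2)) < r :=
          max_lt (hdist p.1) (hdist p.2)
        have h2 := hgr h1
        rw [Real.dist_eq] at h2
        exact (abs_sub_le _ (g p) _).trans (add_le_add (hgW p) h2.le)
    _ ≤ δ := by
        rw [integral_add hfi (integrable_const _)]
        have h : ∫ p : I × I, |W p.1 p.2 - f p| ≤ δ / 2 := hf
        simp only [integral_const, probReal_univ, one_smul]
        linarith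

end ContinuousTransfer

/-! ### Sampling from graphons through fine step functions. -/

section GraphonSampling

open unitInterval

variable {B : Type*} [Fintype B] [DecidableEq B] [Nonempty B] {D : B → B → ℝ} {c : B → ℝ}
  {k n : ℕ}

lemma preimage_pi_label (l : I → B) (w : Fin k → B) :
    (fun (U : Fin k → I) i => l (U i)) ⁻¹' {w} = Set.univ.pi fun i => l ⁻¹' {w i} := by
  ext U
  simp [funext_iff]

lemma measurableSet_pi_label {l : I → B} (hl : ∀ b, MeasurableSet (l ⁻¹' {b})) (w : Fin k → B) :
    MeasurableSet ((fun (U : Fin k → I) i => l (U i)) ⁻¹' {w}) := by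
  rw [preimage_pi_label]
  exact MeasurableSet.univ_pi fun i => hl _

/-- The labels of independent uniform points are independent. -/
lemma integral_comp_pi_label {l : I → B} (hl : ∀ b, MeasurableSet (l ⁻¹' {b}))
    (f : (Fin k → B) → ℝ) : ∫ U : Fin k → I, f (fun i => l (U i))
      = pexp (fun _ b => (volume : Measure I).real (l ⁻¹' {b})) f := by
  rw [integral_comp_label (measurableSet_pi_label hl) f, pexp]
  refine Finset.sum_congr rfl fun w _ => ?_
  rw [preimage_pi_label, measureReal_def, volume_pi_pi, ENNReal.toReal_prod]
  rfl

lemma measureReal_pi_label {l : I → B} (hl : ∀ b, MeasurableSet (l ⁻¹' {b}))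
    (A : Set (Fin k → B)) [DecidablePred (· ∈ A)] :
    (volume : Measure (Fin k → I)).real {U | (fun i => l (U i)) ∈ A}
      = pexp (fun _ b => (volume : Measure I).real (l ⁻¹' {b}))
        (fun w => if w ∈ A then 1 else 0) := by
  have hA : MeasurableSet {U : Fin k → I | (fun i => l (U i)) ∈ A} := by
    let _ : MeasurableSpace (Fin k → B) := ⊤
    have : Measurable fun (U : Fin k → I) i => l (U i) :=
      measurable_to_countable' (measurableSet_pi_label hl)
    exact this (MeasurableSpace.measurableSet_top (s := A))
  rw [← integral_comp_pi_label hl, ← integral_indicator_one hA]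
  refine integral_congr_ae (Eventually.of_forall fun U => ?_)
  simp [Set.indicator]

lemma unifProb_eq_expect {Ω : Type} [Fintype Ω] (A : Set Ω) [DecidablePred (· ∈ A)] :
    unifProb A = 𝔼 ω, if ω ∈ A then (1 : ℝ) else 0 := by
  rw [unifProb, Fintype.expect_eq_sum_div_card, Nat.card_eq_fintype_card, Finset.sum_boole,
    Set.ncard_eq_toFinset_card']
  congr 2
  refine congrArg Finset.card ?_
  ext ω
  simp

/-- Sampling with replacement from a large set is close to sampling without replacement. -/
lemma measureReal_cell_le [NeZero n] (hkn : k ≤ n) (A : Set (Fin k → Fin n)) :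
    (volume : Measure (Fin k → I)).real {U | (fun i => cell n (U i)) ∈ A}
      ≤ unifProb {τ : Fin k ↪ Fin n | ⇑τ ∈ A} + (k : ℝ) ^ 2 / n := by
  classical
  rw [measureReal_pi_label (measurableSet_cell n), unifProb_eq_expect]
  -- An indicator changes by at most 1 with any coordinate, so the comparison costs k²/n.
  have h := abs_expect_sub_expect_embedding_le (α := Fin n) (zero_le_one (α := ℝ))
    (by simpa using hkn) (fun w : Fin k → Fin n => if w ∈ A then (1 : ℝ) else 0) (fun w i v => by
      beta_reduce; split_ifs <;> simp)
  rw [← pexp_uniform] at h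
  simp only [Fintype.card_fin, one_mul] at h
  simp only [volume_cell, one_div]
  have h' := (abs_le.mp h).2
  simp only [Set.mem_ofPred_eq] at h' ⊢
  linarith

/-- Two distinct coordinates of a uniform sequence are independent and uniform. -/
lemma integral_pair (E : I → I → ℝ) (hE : Measurable (Function.uncurry E)) {i j : Fin k}
    (hij : i ≠ j) : ∫ U : Fin k → I, E (U i) (U j) = ∫ p : I × I, E p.1 p.2 := by
  have hind : IndepFun (fun U : Fin k → I => U i) (fun U : Fin k → I => U j) volume :=
    (iIndepFun_pi (μ := fun _ : Fin k => (volume : Measure I)) (X := fun _ => id)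
      (fun _ => aemeasurable_id)).indepFun hij
  have hmap := hind.map_prod_eq_prod_map_map (measurable_pi_apply i).aemeasurable
    (measurable_pi_apply j).aemeasurable
  have hev : ∀ i : Fin k, Measure.map (fun U : Fin k → I => U i) volume = volume := fun i =>
    (measurePreserving_eval (fun _ : Fin k => (volume : Measure I)) i).map_eq
  rw [hev, hev] at hmap
  have h := integral_map (μ := (volume : Measure (Fin k → I))) (φ := fun U => (U i, U j))
    ((measurable_pi_apply i).prodMk (measurable_pi_apply j)).aemeasurable
    (f := Function.uncurry E) hE.aestronglyMeasurable
  rw [hmap] at h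
  exact h.symm

lemma integral_expect_expect_le (hk : 0 < k) (E : I → I → ℝ)
    (hE : Measurable (Function.uncurry E)) (hE0 : ∀ x y, 0 ≤ E x y) (hE2 : ∀ x y, E x y ≤ 2) :
    ∫ U : Fin k → I, 𝔼 i, 𝔼 j, E (U i) (U j) ≤ (∫ p : I × I, E p.1 p.2) + 2 / k := by
  have hne : Nonempty (Fin k) := ⟨⟨0, hk⟩⟩
  have hm : ∀ i j : Fin k, Measurable fun U : Fin k → I => E (U i) (U j) := fun i j =>
    hE.comp (f := fun U : Fin k → I => (U i, U j))
      ((measurable_pi_apply i).prodMk (measurable_pi_apply j))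
  have hi : ∀ i j : Fin k, Integrable fun U : Fin k → I => E (U i) (U j) := fun i j =>
    integrable_of_abs_le (hm i j) (C := 2) fun U => by
      rw [abs_of_nonneg (hE0 _ _)]; exact hE2 _ _
  have h1 : ∫ U : Fin k → I, 𝔼 i, 𝔼 j, E (U i) (U j)
      = 𝔼 i : Fin k, 𝔼 j : Fin k, ∫ U : Fin k → I, E (U i) (U j) := by
    simp only [Fintype.expect_eq_sum_div_card]
    rw [integral_div, integral_finsetSum _ fun i _ =>
      (integrable_finsetSum _ fun j _ => hi i j).div_const _]
    simp only [integral_div, integral_finsetSum _ fun j _ => hi _ j]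
  rw [h1]
  have hint : 0 ≤ ∫ p : I × I, E p.1 p.2 := integral_nonneg fun p => hE0 _ _
  calc 𝔼 i : Fin k, 𝔼 j : Fin k, ∫ U : Fin k → I, E (U i) (U j)
      ≤ 𝔼 i : Fin k, 𝔼 j : Fin k, ((∫ p : I × I, E p.1 p.2) + if j = i then 2 else 0) := by
        refine expect_mono fun i => expect_mono fun j => ?_
        by_cases hij : j = i
        · rw [if_pos hij]
          have : ∫ U : Fin k → I, E (U i) (U j) ≤ 2 := by
            have h := abs_integral_le_of_abs_le (μ := (volume : Measure (Fin k → I)))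
              (f := fun U => E (U i) (U j)) (C := 2) fun U => by
                rw [abs_of_nonneg (hE0 _ _)]; exact hE2 _ _
            exact (abs_le.mp h).2
          linarith
        · rw [if_neg hij, integral_pair E hE (Ne.symm hij), add_zero]
    _ = (∫ p : I × I, E p.1 p.2) + 2 / k := by
        simp only [Finset.expect_add_distrib, Fintype.expect_const]
        simp [NNRat.smul_def]
        ring

/-- The continuous problem is determined by a sampled penalized labelling problem. -/
theorem measureReal_contQap_sub_partOpt_le (hD : ∀ a b, |D a b| ≤ 1) {l : I → B}
    (hl : ∀ b, MeasurableSet (l ⁻¹' {b})) {W J : I → I → ℝ}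
    (hW : Measurable (Function.uncurry W)) (hW1 : ∀ x y, |W x y| ≤ 1)
    (hJ : Measurable (Function.uncurry J)) (hJ1 : ∀ x y, |J x y| ≤ 1) {η x : ℝ}
    (hη : ∫ p : I × I, |J p.1 p.2 - D (l p.1) (l p.2)| ≤ η) (hx : 0 < x) (hx1 : x ≤ 1)
    (hk : 4 * Fintype.card B * (1 + Real.log (Fintype.card B)) / x ^ 5 ≤ k) :
    (volume : Measure (Fin k → I)).real {U | η + 168 * x < |contQap W J
        - partOpt D (fun b => (volume : Measure I).real (l ⁻¹' {b})) (induced W U)|}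
      ≤ 67 * x := by
  set c : B → ℝ := fun b => (volume : Measure I).real (l ⁻¹' {b}) with hc
  set q : ℝ := (Fintype.card B : ℝ) with hq
  have hq1 : 1 ≤ q := by rw [hq]; exact_mod_cast Fintype.card_pos
  have hlog : 0 ≤ Real.log q := Real.log_nonneg hq1
  have hkx : 4 / x ^ 5 ≤ k := by
    refine le_trans ?_ hk
    gcongr
    nlinarith
  have hk0 : (0 : ℝ) < k := lt_of_lt_of_le (by positivity) hkx
  have hkpos : 0 < k := by exact_mod_cast hk0
  have hne : Nonempty (Fin k) := ⟨⟨0, hkpos⟩⟩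
  have h2k : 2 / (k : ℝ) ≤ x ^ 2 := by
    rw [div_le_iff₀ (by positivity)] at hkx ⊢
    have : x ^ 5 ≤ x ^ 2 := pow_le_pow_of_le_one hx.le hx1 (by norm_num)
    nlinarith
  obtain ⟨n₀, hn₀⟩ := exists_cellGraphon_approx hW hW1 (δ := x ^ 2 / 2) (by positivity)
  -- The resolution does not appear in the conclusion, so it may depend on `W` and `k`. The ceilings
  -- make the rounding errors 2/n and q/(nδ) with δ = x/16, and the replacement error k²/n, at most
  -- of order `x`.
  set n : ℕ := max (max n₀ k) (max ⌈8 / x⌉₊ (max ⌈128 * q / x ^ 2⌉₊ ⌈2 * (k : ℝ) ^ 2 / x⌉₊)) with hn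
  have hnn₀ : n₀ ≤ n := by omega
  have hkn : k ≤ n := by omega
  have hn1 : 8 / x ≤ n := Nat.ceil_le.mp (by omega)
  have hn2 : 128 * q / x ^ 2 ≤ n := Nat.ceil_le.mp (by omega)
  have hn3 : 2 * (k : ℝ) ^ 2 / x ≤ n := Nat.ceil_le.mp (by omega)
  have hnz : NeZero n := ⟨by omega⟩
  have hn0 : (0 : ℝ) < n := by exact_mod_cast NeZero.pos n
  clear_value n
  obtain ⟨G, hG, hWG⟩ := hn₀ n hnz hnn₀
  have hxx : x ^ 2 ≤ x := by nlinarith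
  have hF : |contQap W J - partOpt D c G| ≤ η + 2 * x := by
    have h := abs_contQap_stepGraphon_sub_le hD hG hl (δ := x / 16) (by positivity) hW hW1 hJ hJ1
      hη hWG
    have e1 : 2 / (n : ℝ) ≤ x / 4 := by
      rw [div_le_iff₀ hx] at hn1
      rw [div_le_iff₀ hn0]
      linarith
    have e2 : q / (n * (x / 16)) ≤ x / 8 := by
      rw [div_le_iff₀ (by positivity)] at hn2
      rw [div_le_iff₀ (by positivity)]
      nlinarith
    refine h.trans ?_
    linarith
  set E : I → I → ℝ := fun s t => |W s t - cellGraphon G s t| with hE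
  have hEm : Measurable (Function.uncurry E) := (hW.sub (measurable_cellGraphon G)).abs
  have hE0 : ∀ s t, 0 ≤ E s t := fun s t => abs_nonneg _
  have hE2 : ∀ s t, E s t ≤ 2 := fun s t => (abs_sub _ _).trans (by
    have h1 := hW1 s t
    have h2 : |cellGraphon G s t| ≤ 1 := hG _ _
    linarith)
  set Z : (Fin k → I) → ℝ := fun U => 𝔼 i, 𝔼 j, E (U i) (U j) with hZ
  have hZ0 : ∀ U, 0 ≤ Z U := fun U =>
    Finset.expect_nonneg fun i _ => Finset.expect_nonneg fun j _ => hE0 _ _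
  have hZm : Measurable Z := by
    simp only [hZ, Fintype.expect_eq_sum_div_card]
    refine (Finset.measurable_sum _ fun i _ => (Finset.measurable_sum _ fun j _ => ?_).div_const
      _).div_const _
    exact hEm.comp (f := fun U : Fin k → I => (U i, U j)) ((measurable_pi_apply i).prodMk (measurable_pi_apply j))
  have hZi : Integrable Z := integrable_of_abs_le hZm (C := 2) fun U => by
    rw [abs_of_nonneg (hZ0 U)]
    calc Z U ≤ 𝔼 i : Fin k, 𝔼 j : Fin k, (2 : ℝ) :=
          expect_mono fun i => expect_mono fun j => hE2 _ _
      _ = 2 := by simp only [Fintype.expect_const]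
  -- Markov: the sampled L¹ distance of `W` to the step function has mean at most x²/2 + 2/k, the
  -- last term from the diagonal.
  have hbad : (volume : Measure (Fin k → I)).real {U | x ≤ Z U} ≤ 2 * x := by
    have h1 := mul_meas_ge_le_integral_of_nonneg (Eventually.of_forall hZ0) hZi x
    have h2 := integral_expect_expect_le hkpos E hEm hE0 hE2
    have h3 : x * (volume : Measure (Fin k → I)).real {U | x ≤ Z U} ≤ x * (2 * x) := by
      have : ∫ p : I × I, E p.1 p.2 ≤ x ^ 2 / 2 := hWG
      calc _ ≤ _ := h1
        _ ≤ _ := h2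
        _ ≤ _ := by nlinarith
    exact le_of_mul_le_mul_left h3 hx
  set A : Set (Fin k → Fin n) :=
    {w | 165 * x < |partOpt D c G - partOpt D c (fun i j => G (w i) (w j))|} with hA
  have hcell : (volume : Measure (Fin k → I)).real {U | (fun i => cell n (U i)) ∈ A} ≤ 65 * x := by
    refine (measureReal_cell_le hkn A).trans ?_
    have h1 := unifProb_partOpt_le (c := c) hD hG hx hx1 hk hkn
    have h2 : (k : ℝ) ^ 2 / n ≤ x := by
      rw [div_le_iff₀ hx] at hn3
      rw [div_le_iff₀ hn0]
      nlinarith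
    have h3 : unifProb {τ : Fin k ↪ Fin n | ⇑τ ∈ A} ≤ 64 * x := h1
    linarith
  refine (measureReal_mono (s₂ := {U | (fun i => cell n (U i)) ∈ A} ∪ {U | x ≤ Z U})
    fun U hU => ?_).trans ((measureReal_union_le _ _).trans (by linarith))
  by_contra hcon
  simp only [Set.mem_union, Set.mem_ofPred_eq, not_or, not_le, hA, not_lt] at hcon hU
  have h1 : |partOpt D c (fun i j => G (cell n (U i)) (cell n (U j)))
      - partOpt D c (induced W U)| ≤ Z U := by
    rw [abs_sub_comm]
    exact abs_partOpt_sub_le hD _ _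
  have h2 := abs_sub_le (contQap W J) (partOpt D c G) (partOpt D c (induced W U))
  have h3 := abs_sub_le (partOpt D c G)
    (partOpt D c (fun i j => G (cell n (U i)) (cell n (U j)))) (partOpt D c (induced W U))
  linarith [hcon.1, hcon.2]

/-- The continuous problem for the step function of an array with many vertices. -/
lemma abs_contQap_stepGraphon_sub_partOpt_le (hD : ∀ a b, |D a b| ≤ 1) {l : I → B}
    (hl : ∀ b, MeasurableSet (l ⁻¹' {b})) {G : Fin n → Fin n → ℝ} (hG : ∀ x y, |G x y| ≤ 1)
    {J : I → I → ℝ} (hJ : Measurable (Function.uncurry J)) (hJ1 : ∀ x y, |J x y| ≤ 1) {η x : ℝ}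
    (hη : ∫ p : I × I, |J p.1 p.2 - D (l p.1) (l p.2)| ≤ η) (hx : 0 < x) (hx1 : x ≤ 1)
    (hn : 4 * Fintype.card B * (1 + Real.log (Fintype.card B)) / x ^ 5 ≤ n) :
    |contQap (stepGraphon G) J
        - partOpt D (fun b => (volume : Measure I).real (l ⁻¹' {b})) G| ≤ η + 6 * x := by
  set q : ℝ := (Fintype.card B : ℝ) with hq
  have hq1 : 1 ≤ q := by rw [hq]; exact_mod_cast Fintype.card_pos
  have hlog : 0 ≤ Real.log q := Real.log_nonneg hq1
  have hnx : 4 * q / x ^ 5 ≤ n := by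
    refine le_trans (div_le_div_of_nonneg_right ?_ (by positivity)) hn
    nlinarith
  have hn0 : (0 : ℝ) < n := lt_of_lt_of_le (by positivity) hnx
  have hnz : NeZero n := ⟨by rintro rfl; simp at hn0⟩
  have h := abs_contQap_stepGraphon_sub_le hD hG hl hx (measurable_stepGraphon G)
    (abs_stepGraphon_le zero_le_one hG) hJ hJ1 hη (integral_abs_stepGraphon_sub G).le
  rw [div_le_iff₀ (by positivity)] at hnx
  have h5 : x ^ 5 ≤ x ^ 2 := pow_le_pow_of_le_one hx.le hx1 (by norm_num)
  have h6 : 4 * q ≤ n * x ^ 2 := hnx.trans (by gcongr)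
  have hxx : x ^ 2 ≤ x := by nlinarith
  have e1 : 2 / (n : ℝ) ≤ x := by
    rw [div_le_iff₀ hn0]
    nlinarith
  have e2 : q / (n * x) ≤ x / 4 := by
    rw [div_le_iff₀ (by positivity)]
    nlinarith
  linarith

end GraphonSampling

/-! ### Concentration of label fractions in samples. -/

section LabelSampling

open unitInterval

variable {B : Type*} [Fintype B] [DecidableEq B] [Nonempty B] {k n : ℕ}

lemma expect_embedding_apply (hkn : k ≤ n) (i : Fin k) (g : Fin n → ℝ) :
    𝔼 τ : Fin k ↪ Fin n, g (τ i) = 𝔼 x, g x := by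
  have h := expect_embedding_comp (α := Fin n) (by simpa using hkn)
    (⟨fun _ => i, fun a b _ => Subsingleton.elim a b⟩ : Fin 1 ↪ Fin k) fun τ => g (τ 0)
  refine h.trans ?_
  exact Fintype.expect_equiv Equiv.uniqueEmbeddingEquivResult _ _ fun τ => rfl

/-- Concentration of the label fractions of a uniformly random injective sequence. -/
lemma expect_embedding_marg_dev_le (hk : 0 < k) (hkn : k ≤ n) (l : Fin n → B) {s : ℝ}
    (hs : 0 < s) (b : B) :
    𝔼 τ : Fin k ↪ Fin n, |marg (vertex fun i => l (τ i)) b - marg (vertex l) b|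
      ≤ s + 4 / (k * s) := by
  have hne : Nonempty (Fin k) := ⟨⟨0, hk⟩⟩
  have hne' : Nonempty (Fin k ↪ Fin n) := by
    rw [Function.Embedding.nonempty_iff_card_le]; simpa using hkn
  have hk0 : (0 : ℝ) < k := by exact_mod_cast hk
  set f : (Fin k ↪ Fin n) → ℝ := fun τ => marg (vertex fun i => l (τ i)) b with hf
  have hmean : 𝔼 τ, f τ = marg (vertex l) b := by
    simp only [hf, marg, vertex]
    rw [Finset.expect_comm]
    simp only [expect_embedding_apply hkn _ fun x => if l x = b then (1 : ℝ) else 0,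
      Fintype.expect_const]
  have hswap : ∀ (τ : Fin k ↪ Fin n) (u v : Fin n), |f (Equiv.swap u v • τ) - f τ| ≤ 2 / k := by
    intro τ u v
    have hone : ∀ u : Fin n, 𝔼 i : Fin k, (if τ i = u then (1 : ℝ) else 0) ≤ 1 / k := by
      intro u
      rw [Fintype.expect_eq_sum_div_card, Fintype.card_fin]
      refine div_le_div_of_nonneg_right ?_ hk0.le
      rw [Finset.sum_boole]
      have : (Finset.univ.filter fun i => τ i = u).card ≤ 1 :=
        Finset.card_le_one.mpr fun i hi j hj => τ.injective (by
          simp only [Finset.mem_filter, Finset.mem_univ, true_and] at hi hj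
          rw [hi, hj])
      exact_mod_cast this
    simp only [hf, marg]
    rw [← Finset.expect_sub_distrib]
    have hpt : ∀ i, |vertex (fun i => l ((Equiv.swap u v • τ) i)) i b
        - vertex (fun i => l (τ i)) i b|
        ≤ (if τ i = u then (1 : ℝ) else 0) + if τ i = v then 1 else 0 := by
      intro i
      by_cases h1 : τ i = u
      · rw [if_pos h1]
        have : |vertex (fun i => l ((Equiv.swap u v • τ) i)) i b
            - vertex (fun i => l (τ i)) i b| ≤ 1 := by
          unfold vertex; split_ifs <;> simp
        exact this.trans (le_add_of_nonneg_right (by positivity))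
      · by_cases h2 : τ i = v
        · rw [if_pos h2]
          have : |vertex (fun i => l ((Equiv.swap u v • τ) i)) i b
              - vertex (fun i => l (τ i)) i b| ≤ 1 := by
            unfold vertex; split_ifs <;> simp
          exact this.trans (le_add_of_nonneg_left (by positivity))
        · have h3 : (Equiv.swap u v • τ) i = τ i := Equiv.swap_apply_of_ne_of_ne h1 h2
          simp only [vertex, h3, sub_self, abs_zero]
          positivity
    refine (Finset.abs_expect_le _ _).trans ((expect_mono hpt).trans ?_)
    rw [Finset.expect_add_distrib]
    calc _ ≤ 1 / (k : ℝ) + 1 / k := add_le_add (hone u) (hone v)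
      _ = 2 / k := by ring
  have hvar := expect_embedding_sq_le (α := Fin n) (c := 2 / (k : ℝ)) (by positivity)
    (by simpa using hkn) f hswap
  rw [hmean] at hvar
  calc 𝔼 τ : Fin k ↪ Fin n, |f τ - marg (vertex l) b|
      ≤ 𝔼 τ : Fin k ↪ Fin n, (s + (f τ - marg (vertex l) b) ^ 2 / s) :=
        expect_mono fun τ => abs_le_add_sq_div hs
    _ = s + (𝔼 τ : Fin k ↪ Fin n, (f τ - marg (vertex l) b) ^ 2) / s := by
        rw [Finset.expect_add_distrib, Fintype.expect_const, Finset.expect_div]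
    _ ≤ s + (k * (2 / (k : ℝ)) ^ 2) / s := by gcongr
    _ = s + 4 / (k * s) := by field_simp; norm_num

/-- Markov after a variance bound for each label. The bound 4/k ignores how rare the label is, so
summing with s = x²/q costs q²; this is the second term of `sampleBound`. -/
lemma unifProb_marg_dev_le (hkn : k ≤ n) (l : Fin n → B) {x : ℝ} (hx : 0 < x)
    (hk : 4 * (Fintype.card B : ℝ) ^ 2 / x ^ 4 ≤ k) :
    unifProb {τ : Fin k ↪ Fin n |
      x < ∑ b, |marg (vertex fun i => l (τ i)) b - marg (vertex l) b|} ≤ 2 * x := by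
  set q : ℝ := (Fintype.card B : ℝ) with hq
  have hq0 : 0 < q := by rw [hq]; exact_mod_cast Fintype.card_pos
  have hk0 : (0 : ℝ) < k := lt_of_lt_of_le (by positivity) hk
  have hkpos : 0 < k := by exact_mod_cast hk0
  refine (unifProb_le_expect _ (F := fun τ : Fin k ↪ Fin n =>
    ∑ b, |marg (vertex fun i => l (τ i)) b - marg (vertex l) b|)
    (fun τ => Finset.sum_nonneg fun b _ => abs_nonneg _) hx fun τ hτ => hτ.le).trans ?_
  rw [div_le_iff₀ hx, Finset.expect_sum_comm]
  refine (Finset.sum_le_sum fun b _ => expect_embedding_marg_dev_le hkpos hkn l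
    (s := x ^ 2 / q) (by positivity) b).trans ?_
  rw [Finset.sum_const, Finset.card_univ, nsmul_eq_mul, ← hq]
  have h1 : q * (4 / (k * (x ^ 2 / q))) ≤ x ^ 2 := by
    rw [div_le_iff₀ (by positivity)] at hk
    have : q * (4 / (k * (x ^ 2 / q))) = 4 * q ^ 2 / (k * x ^ 2) := by field_simp
    rw [this, div_le_iff₀ (by positivity)]
    nlinarith
  have h2 : q * (x ^ 2 / q) = x ^ 2 := by field_simp
  rw [mul_add, h2]
  nlinarith

lemma measureReal_marg_dev_le {l : I → B} (hl : ∀ b, MeasurableSet (l ⁻¹' {b})) {x : ℝ}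
    (hx : 0 < x) (hk : 4 * (Fintype.card B : ℝ) ^ 2 / x ^ 4 ≤ k) :
    (volume : Measure (Fin k → I)).real {V | x < ∑ b, |marg (vertex fun i => l (V i)) b
      - (volume : Measure I).real (l ⁻¹' {b})|} ≤ 2 * x := by
  classical
  set q : ℝ := (Fintype.card B : ℝ) with hq
  have hq1 : 1 ≤ q := by rw [hq]; exact_mod_cast Fintype.card_pos
  have hk0 : (0 : ℝ) < k := lt_of_lt_of_le (by positivity) hk
  have hkpos : 0 < k := by exact_mod_cast hk0
  have hne : Nonempty (Fin k) := ⟨⟨0, hkpos⟩⟩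
  set c : B → ℝ := fun b => (volume : Measure I).real (l ⁻¹' {b}) with hc
  have hp : IsProb fun (_ : Fin k) b => c b :=
    ⟨fun _ b => measureReal_nonneg, fun _ => sum_volume_label hl⟩
  have hrw := measureReal_pi_label (k := k) hl {w : Fin k → B | x < ∑ b, |marg (vertex w) b - c b|}
  refine hrw.le.trans ?_
  have hdev := pexp_marg_dev_le hp id (δ := x ^ 2) (by positivity)
  simp only [id, mul_ite, mul_one, mul_zero, Finset.sum_ite_eq', Finset.mem_univ, if_true,
    Fintype.expect_const, Fintype.card_fin, ← hq] at hdev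
  have h1 : pexp (fun (_ : Fin k) b => c b)
      (fun w => if w ∈ {w : Fin k → B | x < ∑ b, |marg (vertex w) b - c b|} then 1 else 0)
      ≤ x⁻¹ * pexp (fun (_ : Fin k) b => c b) (fun w => ∑ b, |marg (vertex w) b - c b|) := by
    rw [← pexp_mul_left]
    refine pexp_mono hp fun w => ?_
    rw [← div_eq_inv_mul]
    split_ifs with h
    · rw [one_le_div hx]; exact le_of_lt h
    · positivity
  refine h1.trans ?_
  rw [← div_eq_inv_mul, div_le_iff₀ hx]
  refine hdev.trans ?_
  have h2 : q / (k * x ^ 2) ≤ x ^ 2 := by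
    rw [div_le_iff₀ (by positivity)] at hk
    rw [div_le_iff₀ (by positivity)]
    nlinarith
  linarith

end LabelSampling

/-! ### Block approximation of geometric arrays. -/

section GeometricLabels

/-- The ℓ^p norm is at most d^(1/p) ≤ d times the sup norm, uniformly in `p`, so the label count
does not depend on `p`. -/
lemma dist_le_of_coord {d : ℕ} (hd : 0 < d) {p : ENNReal} [Fact (1 ≤ p)]
    (u v : PiLp p (fun _ : Fin d => ℝ)) {h : ℝ} (hh : 0 ≤ h) (huv : ∀ t, |u t - v t| ≤ h) :
    dist u v ≤ d * h := by
  have h1 := (PiLp.antilipschitzWith_ofLp p (fun _ : Fin d => ℝ)).le_mul_dist u v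
  have h2 : dist (WithLp.ofLp u) (WithLp.ofLp v) ≤ h :=
    (dist_pi_le_iff hh).mpr fun t => by rw [Real.dist_eq]; exact huv t
  refine h1.trans (mul_le_mul ?_ h2 dist_nonneg (Nat.cast_nonneg _))
  rw [Fintype.card_fin, NNReal.coe_rpow, NNReal.coe_natCast]
  have hp : (1 : ENNReal) ≤ p := Fact.out
  have hexp : (1 / p).toReal ≤ 1 := by
    refine ENNReal.toReal_le_of_le_ofReal zero_le_one ?_
    rw [ENNReal.ofReal_one, one_div]
    exact ENNReal.inv_le_one.mpr hp
  calc (d : ℝ) ^ (1 / p).toReal ≤ (d : ℝ) ^ (1 : ℝ) :=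
        Real.rpow_le_rpow_of_exponent_le (by exact_mod_cast hd) hexp
    _ = d := Real.rpow_one _

/-- A geometric array is uniformly close to a block array with few blocks. -/
lemma exists_labels {V : Type} [MeasurableSpace V] [Nonempty V] {d : ℕ} (hd : 0 < d)
    {J : V → V → ℝ} (hJ : IsGeometric d J) (hm : ∀ i, Measurable (J i)) (hJ1 : ∀ i j, |J i j| ≤ 1)
    {x : ℝ} (hx : 0 < x) (hx1 : x ≤ 1) :
    ∃ (q : ℕ) (_ : NeZero q) (l : V → Fin q) (D : Fin q → Fin q → ℝ),
      (q : ℝ) ≤ (5 * d / x) ^ d ∧ (∀ b, MeasurableSet (l ⁻¹' {b})) ∧ (∀ a b, |D a b| ≤ 1) ∧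
      ∀ i j, |J i j - D (l i) (l j)| ≤ x := by
  classical
  obtain ⟨p, hp, e, he⟩ := hJ
  have hd0 : (0 : ℝ) < d := by exact_mod_cast hd
  have hd1 : (1 : ℝ) ≤ d := by exact_mod_cast hd
  obtain ⟨v₀⟩ := ‹Nonempty V›
  -- Grid cubes of this side have diameter at most x/2. Coordinates differ by at most 1 from those
  -- of `e v₀`, so 2/h + 1 ≤ 5d/x cubes per direction suffice.
  set h : ℝ := x / (2 * d) with hh
  have hh0 : 0 < h := by positivity
  set s : ℕ := ⌊2 / h⌋₊ + 1 with hs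
  have hcoord : ∀ v t, |e v t - e v₀ t| ≤ 1 := by
    intro v t
    rw [← Real.dist_eq]
    refine (PiLp.dist_apply_le (e v) (e v₀) t).trans ?_
    rw [← he]
    exact (le_abs_self _).trans (hJ1 _ _)
  have hlt : ∀ v t, ⌊(e v t - e v₀ t + 1) / h⌋₊ < s := by
    intro v t
    rw [hs, Nat.lt_succ_iff]
    refine Nat.floor_le_floor ?_
    gcongr
    linarith [(abs_le.mp (hcoord v t)).2]
  set g : V → Fin d → Fin s := fun v t => ⟨_, hlt v t⟩ with hg
  have hclose : ∀ v v', g v = g v' → J v v' ≤ x / 2 := by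
    intro v v' hvv
    rw [he]
    have h1 := dist_le_of_coord hd (e v) (e v') hh0.le fun t => ?_
    · refine h1.trans (le_of_eq ?_)
      rw [hh]; field_simp
    · have h2 : ⌊(e v t - e v₀ t + 1) / h⌋₊ = ⌊(e v' t - e v₀ t + 1) / h⌋₊ :=
        congrArg Fin.val (congrFun hvv t)
      have hnn : ∀ v, 0 ≤ (e v t - e v₀ t + 1) / h := fun v =>
        div_nonneg (by linarith [(abs_le.mp (hcoord v t)).1]) hh0.le
      have a1 := Nat.floor_le (hnn v)
      have a2 := Nat.lt_floor_add_one ((e v t - e v₀ t + 1) / h)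
      have b1 := Nat.floor_le (hnn v')
      have b2 := Nat.lt_floor_add_one ((e v' t - e v₀ t + 1) / h)
      rw [h2] at a1 a2
      rw [le_div_iff₀ hh0] at a1 b1
      rw [div_lt_iff₀ hh0] at a2 b2
      rw [abs_le]
      constructor <;> linarith
  set q : ℕ := Fintype.card (Fin d → Fin s) with hq
  have hsz : NeZero s := ⟨by omega⟩
  have hqz : NeZero q := ⟨Fintype.card_ne_zero⟩
  set E := Fintype.equivFin (Fin d → Fin s) with hE
  -- A representative point of each grid cube, with a default for the empty ones.
  set r : Fin q → V := fun b => if hb : ∃ v, E (g v) = b then hb.choose else v₀ with hr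
  have hne : ∀ v, (Finset.univ.filter fun b => J (r b) v ≤ x / 2).Nonempty := by
    intro v
    refine ⟨E (g v), Finset.mem_filter.mpr ⟨Finset.mem_univ _, hclose _ _ ?_⟩⟩
    have hb : ∃ v', E (g v') = E (g v) := ⟨v, rfl⟩
    simp only [hr, dif_pos hb]
    exact E.injective hb.choose_spec
  -- The embedding need not be measurable, so the grid cube of `v` is unsuitable as a label. The
  -- first representative within x/2 of `v` depends only on the measurable sections of `J`.
  set l : V → Fin q := fun v => (Finset.univ.filter fun b => J (r b) v ≤ x / 2).min' (hne v) with hl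
  have hlr : ∀ v, J (r (l v)) v ≤ x / 2 := fun v =>
    (Finset.mem_filter.mp (Finset.min'_mem _ (hne v))).2
  have hmin : ∀ v b, J (r b) v ≤ x / 2 → l v ≤ b := fun v b hb =>
    Finset.min'_le _ b (Finset.mem_filter.mpr ⟨Finset.mem_univ b, hb⟩)
  refine ⟨q, hqz, l, fun a b => J (r a) (r b), ?_, ?_, fun a b => hJ1 _ _, ?_⟩
  · rw [hq, Fintype.card_fun, Fintype.card_fin, Fintype.card_fin, Nat.cast_pow]
    refine pow_le_pow_left₀ (Nat.cast_nonneg _) ?_ _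
    rw [hs]
    push_cast
    have h1 : (⌊2 / h⌋₊ : ℝ) ≤ 2 / h := Nat.floor_le (by positivity)
    have h2 : 2 / h = 4 * d / x := by rw [hh]; field_simp; norm_num
    have h3 : 1 ≤ d / x := by rw [one_le_div hx]; linarith
    have h4 : 5 * d / x = 4 * d / x + d / x := by ring
    linarith
  · intro b
    have : l ⁻¹' {b} = {v | J (r b) v ≤ x / 2} ∩ ⋂ b' : Fin q, ⋂ _ : b' < b,
        {v | J (r b') v ≤ x / 2}ᶜ := by
      ext v
      simp only [Set.mem_preimage, Set.mem_singleton_iff, Set.mem_inter_iff, Set.mem_iInter,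
        Set.mem_compl_iff, Set.mem_ofPred_eq]
      constructor
      · rintro rfl
        refine ⟨hlr v, fun b' hb' hb => absurd hb' (not_lt.mpr ?_)⟩
        exact hmin v b' hb
      · rintro ⟨h1, h2⟩
        refine le_antisymm (hmin v b h1) ?_
        by_contra hcon
        exact h2 (l v) (not_le.mp hcon) (hlr v)
    rw [this]
    refine (measurableSet_le (hm _) measurable_const).inter (MeasurableSet.iInter fun b' =>
      MeasurableSet.iInter fun _ => (measurableSet_le (hm _) measurable_const).compl)
  · intro i j
    have h1 := hlr i
    have h2 := hlr j
    rw [he] at h1 h2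
    beta_reduce
    rw [he, he]
    have h3 := dist_dist_dist_le (e i) (e j) (e (r (l i))) (e (r (l j)))
    rw [Real.dist_eq] at h3
    rw [dist_comm] at h1 h2
    linarith

end GeometricLabels

/-! ### Testability for arrays and kernels bounded by 1. -/

section NormalizedTestability

open unitInterval

variable {k n d : ℕ}

/-- Sample size that suffices for a problem with `Q` labels at accuracy `x`. -/
def sampleBound (Q x : ℝ) : ℝ := 4 * Q * (1 + Real.log Q) / x ^ 5 + 4 * Q ^ 2 / x ^ 4

lemma le_of_sampleBound_le {q : ℕ} (hq : 0 < q) {Q x : ℝ} (hqQ : (q : ℝ) ≤ Q) (hx : 0 < x)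
    (hk : sampleBound Q x ≤ k) :
    4 * (Fintype.card (Fin q) : ℝ) * (1 + Real.log (Fintype.card (Fin q))) / x ^ 5 ≤ k ∧
      4 * (Fintype.card (Fin q) : ℝ) ^ 2 / x ^ 4 ≤ k := by
  have hq1 : (1 : ℝ) ≤ q := by exact_mod_cast hq
  have hlog : 0 ≤ Real.log q := Real.log_nonneg hq1
  have hlogQ : Real.log q ≤ Real.log Q := Real.log_le_log (by linarith) hqQ
  have h1 : 0 ≤ 4 * Q * (1 + Real.log Q) / x ^ 5 := by
    have : 0 ≤ Q := by linarith
    have : 0 ≤ 1 + Real.log Q := by linarith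
    positivity
  have h2 : 0 ≤ 4 * Q ^ 2 / x ^ 4 := by positivity
  rw [Fintype.card_fin]
  unfold sampleBound at hk
  constructor
  · refine le_trans ?_ (show 4 * Q * (1 + Real.log Q) / x ^ 5 ≤ k by linarith)
    gcongr
    linarith
  · refine le_trans ?_ (show 4 * Q ^ 2 / x ^ 4 ≤ k by linarith)
    gcongr

lemma unifProb_preimage_fst_le {Ω Ω' : Type} [Finite Ω] [Finite Ω'] [Nonempty Ω'] (A : Set Ω) :
    unifProb {s : Ω × Ω' | s.1 ∈ A} ≤ unifProb A := by
  have h : {s : Ω × Ω' | s.1 ∈ A} = A ×ˢ Set.univ := by ext; simp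
  have h0 : (Nat.card Ω' : ℝ) ≠ 0 := by exact_mod_cast Nat.card_pos.ne'
  rw [unifProb, unifProb, h, Set.ncard_prod, Set.ncard_univ, Nat.card_prod]
  push_cast
  rw [mul_div_mul_right _ _ h0]

lemma unifProb_preimage_snd_le {Ω Ω' : Type} [Finite Ω] [Finite Ω'] [Nonempty Ω] (A : Set Ω') :
    unifProb {s : Ω × Ω' | s.2 ∈ A} ≤ unifProb A := by
  have h : {s : Ω × Ω' | s.2 ∈ A} = Set.univ ×ˢ A := by ext; simp
  have h0 : (Nat.card Ω : ℝ) ≠ 0 := by exact_mod_cast Nat.card_pos.ne'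
  rw [unifProb, unifProb, h, Set.ncard_prod, Set.ncard_univ, Nat.card_prod]
  push_cast
  rw [mul_div_mul_left _ _ h0]

lemma expect_expect_abs_sub_le {ι : Type*} [Fintype ι] [Nonempty ι] {f : ι → ι → ℝ} {x : ℝ}
    (h : ∀ i j, |f i j| ≤ x) : 𝔼 i, 𝔼 j, |f i j| ≤ x :=
  (expect_mono fun i => expect_mono fun j => h i j).trans (by simp only [Fintype.expect_const]; rfl)

lemma integral_abs_le_of_abs_le {f : I × I → ℝ} {x : ℝ} (h : ∀ p, |f p| ≤ x) :
    ∫ p : I × I, |f p| ≤ x :=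
  (le_abs_self _).trans (abs_integral_le_of_abs_le fun p => by rw [abs_abs]; exact h p)

/-- Sampling for the discrete problem with normalized arrays. -/
lemma unifProb_qap_le (hd : 0 < d) {x : ℝ} (hx : 0 < x) (hx1 : x ≤ 1)
    (hk : sampleBound ((5 * d / x) ^ d) x ≤ k) (hk0 : 0 < k) (hkn : k ≤ n)
    {G J : Fin n → Fin n → ℝ} (hG : ∀ i j, |G i j| ≤ 1) (hJ1 : ∀ i j, |J i j| ≤ 1)
    (hJ : IsGeometric d J) :
    unifProb {s : (Fin k ↪ Fin n) × (Fin k ↪ Fin n) |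
      180 * x < |qap G J - qap (induced G s.1) (induced J s.2)|} ≤ 68 * x := by
  have hn0 : 0 < n := by omega
  have : Nonempty (Fin n) := ⟨⟨0, hn0⟩⟩
  have : Nonempty (Fin k) := ⟨⟨0, hk0⟩⟩
  have : Nonempty (Fin k ↪ Fin n) := by
    rw [Function.Embedding.nonempty_iff_card_le]; simpa using hkn
  obtain ⟨q, hq, l, D, hqQ, -, hD, hJD⟩ :=
    exists_labels hd hJ (fun i => measurable_of_finite (J i)) hJ1 hx hx1
  obtain ⟨hk1, hk2⟩ := le_of_sampleBound_le (NeZero.pos q) hqQ hx hk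
  -- The target fractions are those of the full array `J`, so only the sampled array pays a penalty.
  set c : Fin q → ℝ := fun b => marg (vertex l) b with hc
  have h1 := unifProb_partOpt_le (c := c) hD hG hx hx1 hk1 hkn
  have h2 := unifProb_marg_dev_le hkn l hx hk2
  refine (unifProb_mono fun s hs => ?_).trans ((unifProb_union_le _ _).trans ((add_le_add
    ((unifProb_preimage_fst_le _).trans h1) ((unifProb_preimage_snd_le _).trans h2)).trans
    (by linarith)))
  by_contra hcon
  simp only [Set.mem_union, Set.mem_ofPred_eq, not_or, not_lt] at hcon hs
  have e1 := abs_qap_sub_partOpt_le (c := c) hn0 hD hG l (expect_expect_abs_sub_le hJD)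
  have e2 := abs_qap_sub_partOpt_le (c := c) hk0 hD (G := induced G s.1) (J := induced J s.2)
    (fun i j => hG _ _) (fun i => l (s.2 i)) (expect_expect_abs_sub_le fun i j => hJD _ _)
  simp only [hc, sub_self, abs_zero, Finset.sum_const_zero, mul_zero, add_zero] at e1
  rw [abs_sub_comm] at e2
  have e3 := abs_sub_le (qap G J) (partOpt D c G) (qap (induced G s.1) (induced J s.2))
  have e4 := abs_sub_le (partOpt D c G) (partOpt D c (induced G s.1))
    (qap (induced G s.1) (induced J s.2))
  linarith [hcon.1, hcon.2]

lemma measureReal_preimage_fst_le {Ω Ω' : Type*} [MeasureSpace Ω] [MeasureSpace Ω']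
    [IsProbabilityMeasure (volume : Measure Ω)] [IsProbabilityMeasure (volume : Measure Ω')]
    (A : Set Ω) : (volume : Measure (Ω × Ω')).real {s | s.1 ∈ A}
      ≤ (volume : Measure Ω).real A := by
  have h : {s : Ω × Ω' | s.1 ∈ A} = A ×ˢ Set.univ := by ext; simp
  rw [h, Measure.volume_eq_prod, measureReal_prod_prod]
  simp

lemma measureReal_preimage_snd_le {Ω Ω' : Type*} [MeasureSpace Ω] [MeasureSpace Ω']
    [IsProbabilityMeasure (volume : Measure Ω)] [IsProbabilityMeasure (volume : Measure Ω')]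
    (A : Set Ω') : (volume : Measure (Ω × Ω')).real {s | s.2 ∈ A}
      ≤ (volume : Measure Ω').real A := by
  have h : {s : Ω × Ω' | s.2 ∈ A} = Set.univ ×ˢ A := by ext; simp
  rw [h, Measure.volume_eq_prod, measureReal_prod_prod]
  simp

/-- Sampling for the continuous problem with normalized kernels. -/
lemma measureReal_contQap_le (hd : 0 < d) {x : ℝ} (hx : 0 < x) (hx1 : x ≤ 1)
    (hk : sampleBound ((5 * d / x) ^ d) x ≤ k) (hk0 : 0 < k)
    {W J : I → I → ℝ} (hW : Measurable (Function.uncurry W)) (hW1 : ∀ i j, |W i j| ≤ 1)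
    (hJm : Measurable (Function.uncurry J)) (hJ1 : ∀ i j, |J i j| ≤ 1) (hJ : IsGeometric d J) :
    (volume : Measure ((Fin k → I) × (Fin k → I))).real {s |
      180 * x < |contQap W J - qap (induced W s.1) (induced J s.2)|} ≤ 69 * x := by
  have : Nonempty (Fin k) := ⟨⟨0, hk0⟩⟩
  obtain ⟨q, hq, l, D, hqQ, hl, hD, hJD⟩ :=
    exists_labels hd hJ (fun i => hJm.of_uncurry_left) hJ1 hx hx1
  obtain ⟨hk1, hk2⟩ := le_of_sampleBound_le (NeZero.pos q) hqQ hx hk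
  have h1 := measureReal_contQap_sub_partOpt_le hD hl hW hW1 hJm hJ1
    (integral_abs_le_of_abs_le fun p => hJD p.1 p.2) hx hx1 hk1
  have h2 := measureReal_marg_dev_le hl hx hk2
  set c : Fin q → ℝ := fun b => (volume : Measure I).real (l ⁻¹' {b}) with hc
  refine (measureReal_mono fun s hs => ?_).trans ((measureReal_union_le _ _).trans ((add_le_add
    ((measureReal_preimage_fst_le _).trans h1) ((measureReal_preimage_snd_le _).trans h2)).trans
    (by linarith)))
  by_contra hcon
  simp only [Set.mem_union, Set.mem_ofPred_eq, not_or, not_lt] at hcon hs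
  have e2 := abs_qap_sub_partOpt_le (c := c) hk0 hD (G := induced W s.1) (J := induced J s.2)
    (fun i j => hW1 _ _) (fun i => l (s.2 i)) (expect_expect_abs_sub_le fun i j => hJD _ _)
  rw [abs_sub_comm] at e2
  have e3 := abs_sub_le (contQap W J) (partOpt D c (induced W s.1))
    (qap (induced W s.1) (induced J s.2))
  linarith [hcon.1, hcon.2]

/-- Sampling for the problem with fixed kernel as a graph parameter. -/
lemma unifProb_fixedQap_le (hd : 0 < d) {x : ℝ} (hx : 0 < x) (hx1 : x ≤ 1)
    (hk : sampleBound ((5 * d / x) ^ d) x ≤ k) (hkn : k ≤ n)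
    {G : Fin n → Fin n → ℝ} (hG : ∀ i j, |G i j| ≤ 1) {J : I → I → ℝ}
    (hJm : Measurable (Function.uncurry J)) (hJ1 : ∀ i j, |J i j| ≤ 1) (hJ : IsGeometric d J) :
    unifProb {τ : Fin k ↪ Fin n |
      180 * x < |fixedQap J n G - fixedQap J k (induced G τ)|} ≤ 68 * x := by
  obtain ⟨q, hq, l, D, hqQ, hl, hD, hJD⟩ :=
    exists_labels hd hJ (fun i => hJm.of_uncurry_left) hJ1 hx hx1
  obtain ⟨hk1, hk2⟩ := le_of_sampleBound_le (NeZero.pos q) hqQ hx hk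
  set c : Fin q → ℝ := fun b => (volume : Measure I).real (l ⁻¹' {b}) with hc
  have hη := integral_abs_le_of_abs_le fun p : I × I => hJD p.1 p.2
  refine (unifProb_mono fun τ hτ => ?_).trans ((unifProb_partOpt_le (c := c) hD hG hx hx1 hk1
    hkn).trans (by linarith))
  by_contra hcon
  simp only [Set.mem_ofPred_eq, not_lt] at hcon hτ
  have e1 := abs_contQap_stepGraphon_sub_partOpt_le hD hl hG hJm hJ1 hη hx hx1
    (hk1.trans (by exact_mod_cast hkn))
  have e2 := abs_contQap_stepGraphon_sub_partOpt_le hD hl (G := induced G τ) (fun i j => hG _ _)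
    hJm hJ1 hη hx hx1 hk1
  rw [abs_sub_comm] at e2
  have e3 := abs_sub_le (contQap (stepGraphon G) J) (partOpt D c G)
    (contQap (stepGraphon (induced G τ)) J)
  have e4 := abs_sub_le (partOpt D c G) (partOpt D c (induced G τ))
    (contQap (stepGraphon (induced G τ)) J)
  simp only [fixedQap] at hτ
  linarith

/-- Sampling for the problem with fixed kernel as a graphon parameter. -/
lemma measureReal_fixedQap_le (hd : 0 < d) {x : ℝ} (hx : 0 < x) (hx1 : x ≤ 1)
    (hk : sampleBound ((5 * d / x) ^ d) x ≤ k)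
    {W J : I → I → ℝ} (hW : Measurable (Function.uncurry W)) (hW1 : ∀ i j, |W i j| ≤ 1)
    (hJm : Measurable (Function.uncurry J)) (hJ1 : ∀ i j, |J i j| ≤ 1) (hJ : IsGeometric d J) :
    (volume : Measure (Fin k → I)).real {U |
      180 * x < |contQap W J - fixedQap J k (induced W U)|} ≤ 69 * x := by
  obtain ⟨q, hq, l, D, hqQ, hl, hD, hJD⟩ :=
    exists_labels hd hJ (fun i => hJm.of_uncurry_left) hJ1 hx hx1
  obtain ⟨hk1, hk2⟩ := le_of_sampleBound_le (NeZero.pos q) hqQ hx hk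
  have hη := integral_abs_le_of_abs_le fun p : I × I => hJD p.1 p.2
  have h1 := measureReal_contQap_sub_partOpt_le hD hl hW hW1 hJm hJ1 hη hx hx1 hk1
  set c : Fin q → ℝ := fun b => (volume : Measure I).real (l ⁻¹' {b}) with hc
  refine (measureReal_mono fun U hU => ?_).trans (h1.trans (by linarith))
  by_contra hcon
  simp only [Set.mem_ofPred_eq, not_lt] at hcon hU
  have e2 := abs_contQap_stepGraphon_sub_partOpt_le hD hl (G := induced W U) (fun i j => hW1 _ _)
    hJm hJ1 hη hx hx1 hk1
  rw [abs_sub_comm] at e2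
  have e4 := abs_sub_le (contQap W J) (partOpt D c (induced W U))
    (contQap (stepGraphon (induced W U)) J)
  simp only [fixedQap] at hU
  linarith

lemma cell_mono (q : ℕ) [NeZero q] : Monotone (cell q) := by
  intro s t hst
  rw [Fin.le_def, cell_val, cell_val]
  have h : (s : ℝ) ≤ t := hst
  exact min_le_min (Nat.floor_le_floor (by gcongr)) le_rfl

/-- The two kernels agree outside the `q` diagonal squares, of total area 1/q. -/
lemma integral_abs_triangle_sub_le (q : ℕ) [NeZero q] :
    ∫ p : I × I, |(if p.1 ≤ p.2 then (1 : ℝ) else 0) - if cell q p.1 ≤ cell q p.2 then 1 else 0|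
      ≤ 1 / q := by
  have hq : (q : ℝ) ≠ 0 := by exact_mod_cast NeZero.ne q
  set D : Fin q → Fin q → ℝ := fun a b => if a = b then 1 else 0 with hD
  have hDm := measurable_comp_label₂ (measurableSet_cell q) D
  have hint : Integrable fun p : I × I => D (cell q p.1) (cell q p.2) :=
    integrable_of_abs_le hDm (C := 1) fun p => by
      simp only [hD]; split_ifs <;> simp
  refine (integral_mono_of_nonneg (Eventually.of_forall fun p => abs_nonneg _) hint
    (Eventually.of_forall fun p => ?_)).trans (le_of_eq ?_)
  · beta_reduce
    by_cases h : p.1 ≤ p.2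
    · rw [if_pos h, if_pos (cell_mono q h), sub_self, abs_zero]
      simp only [hD]; positivity
    · rw [if_neg h]
      by_cases h' : cell q p.1 ≤ cell q p.2
      · have : cell q p.1 = cell q p.2 := le_antisymm h' (cell_mono q (not_le.mp h).le)
        simp [hD, this]
      · rw [if_neg h', sub_self, abs_zero]
        simp only [hD]; positivity
  · rw [Measure.volume_eq_prod, integral_prod _ hint]
    have h1 : ∀ s : I, ∫ t : I, D (cell q s) (cell q t) = 1 / q := by
      intro s
      rw [integral_comp_label (measurableSet_cell q) (D (cell q s))]
      simp [hD, volume_cell]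
    simp [h1]

/-- The label count used for the acyclic subgraph problem. -/
lemma exists_label_count {x : ℝ} (hx : 0 < x) (hx1 : x ≤ 1) :
    ∃ (q : ℕ) (_ : NeZero q), 1 / (q : ℝ) ≤ x ∧ (q : ℝ) ≤ (5 * (1 : ℕ) / x) ^ 1 := by
  have h1 : 1 ≤ 1 / x := by rw [one_le_div hx]; exact hx1
  refine ⟨⌈1 / x⌉₊, ⟨(Nat.ceil_pos.mpr (by positivity)).ne'⟩, ?_, ?_⟩
  · rw [one_div_le (by exact_mod_cast Nat.ceil_pos.mpr (by positivity)) hx]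
    exact Nat.le_ceil _
  · have h2 := Nat.ceil_lt_add_one (show 0 ≤ 1 / x by positivity)
    have h3 : (5 * (1 : ℕ) / x) ^ 1 = 5 * (1 / x) := by push_cast; ring
    rw [h3]
    linarith

lemma abs_mas_sub_partOpt_le_of_large {q : ℕ} [NeZero q] {x : ℝ} (hx : 0 < x) (hx1 : x ≤ 1)
    (hqx : 1 / (q : ℝ) ≤ x) (hn : 4 * (Fintype.card (Fin q) : ℝ) ^ 2 / x ^ 4 ≤ n)
    {G : Fin n → Fin n → ℝ} (hG : ∀ i j, |G i j| ≤ 1) :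
    |mas n G - partOpt (fun a b : Fin q => if a ≤ b then 1 else 0) (fun _ => 1 / (q : ℝ)) G|
      ≤ 3 * x := by
  have hq1 : (1 : ℝ) ≤ q := by exact_mod_cast NeZero.pos q
  rw [Fintype.card_fin] at hn
  have hn0 : (0 : ℝ) < n := lt_of_lt_of_le (by positivity) hn
  rw [div_le_iff₀ (by positivity)] at hn
  have h4 : x ^ 4 ≤ x := pow_le_of_le_one hx.le hx1 (by norm_num)
  have h5 : 4 * (q : ℝ) ^ 2 ≤ n * x := hn.trans (by gcongr)
  have e1 : 4 * ((q : ℝ) / n) ≤ x := by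
    rw [← mul_div_assoc, div_le_iff₀ hn0]
    nlinarith
  have e2 : 1 / (n : ℝ) ≤ x := by
    rw [div_le_iff₀ hn0]
    nlinarith
  refine (abs_mas_sub_partOpt_le (by exact_mod_cast hn0) hG).trans ?_
  linarith

lemma abs_triangle_le {α : Type*} [LinearOrder α] (a b : α) :
    |if a ≤ b then (1 : ℝ) else 0| ≤ 1 := by
  split_ifs <;> simp

/-- Sampling for the acyclic subgraph problem on normalized arrays. -/
lemma unifProb_mas_le {x : ℝ} (hx : 0 < x) (hx1 : x ≤ 1)
    (hk : sampleBound ((5 * (1 : ℕ) / x) ^ 1) x ≤ k) (hkn : k ≤ n)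
    {G : Fin n → Fin n → ℝ} (hG : ∀ i j, |G i j| ≤ 1) :
    unifProb {τ : Fin k ↪ Fin n | 180 * x < |mas n G - mas k (induced G τ)|} ≤ 68 * x := by
  obtain ⟨q, hq, hqx, hqQ⟩ := exists_label_count hx hx1
  obtain ⟨hk1, hk2⟩ := le_of_sampleBound_le (NeZero.pos q) hqQ hx hk
  set D : Fin q → Fin q → ℝ := fun a b => if a ≤ b then 1 else 0 with hD
  refine (unifProb_mono fun τ hτ => ?_).trans ((unifProb_partOpt_le (D := D)
    (c := fun _ => 1 / (q : ℝ)) (fun a b => abs_triangle_le a b) hG hx hx1 hk1 hkn).trans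
    (by linarith))
  by_contra hcon
  simp only [Set.mem_ofPred_eq, not_lt] at hcon hτ
  have e1 := abs_mas_sub_partOpt_le_of_large hx hx1 hqx (hk2.trans (by exact_mod_cast hkn)) hG
  have e2 := abs_mas_sub_partOpt_le_of_large hx hx1 hqx hk2 (G := induced G τ) fun i j => hG _ _
  rw [abs_sub_comm] at e2
  have e3 := abs_sub_le (mas n G) (partOpt D (fun _ => 1 / (q : ℝ)) G) (mas k (induced G τ))
  have e4 := abs_sub_le (partOpt D (fun _ => 1 / (q : ℝ)) G)
    (partOpt D (fun _ => 1 / (q : ℝ)) (induced G τ)) (mas k (induced G τ))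
  linarith

lemma measurable_triangle :
    Measurable (Function.uncurry fun x y : I => if x ≤ y then (1 : ℝ) else 0) := by
  have h : Measurable fun p : I × I => if p.1 ≤ p.2 then (1 : ℝ) else 0 :=
    Measurable.ite (measurableSet_le measurable_fst measurable_snd) measurable_const
      measurable_const
  exact h

/-- Sampling for the acyclic subgraph problem on normalized kernels. -/
lemma measureReal_contMas_le {x : ℝ} (hx : 0 < x) (hx1 : x ≤ 1)
    (hk : sampleBound ((5 * (1 : ℕ) / x) ^ 1) x ≤ k)
    {W : I → I → ℝ} (hW : Measurable (Function.uncurry W)) (hW1 : ∀ i j, |W i j| ≤ 1) :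
    (volume : Measure (Fin k → I)).real {U |
      180 * x < |contMas W - mas k (induced W U)|} ≤ 69 * x := by
  obtain ⟨q, hq, hqx, hqQ⟩ := exists_label_count hx hx1
  obtain ⟨hk1, hk2⟩ := le_of_sampleBound_le (NeZero.pos q) hqQ hx hk
  set D : Fin q → Fin q → ℝ := fun a b => if a ≤ b then 1 else 0 with hD
  have h1 := measureReal_contQap_sub_partOpt_le (D := D) (fun a b => abs_triangle_le a b)
    (measurableSet_cell q) hW hW1 measurable_triangle (fun a b => abs_triangle_le a b)
    ((integral_abs_triangle_sub_le q).trans hqx) hx hx1 hk1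
  simp only [volume_cell] at h1
  refine (measureReal_mono fun U hU => ?_).trans (h1.trans (by linarith))
  by_contra hcon
  simp only [Set.mem_ofPred_eq, not_lt] at hcon hU
  have e2 := abs_mas_sub_partOpt_le_of_large hx hx1 hqx hk2 (G := induced W U) fun i j => hW1 _ _
  rw [abs_sub_comm] at e2
  have e4 := abs_sub_le (contMas W) (partOpt D (fun _ => 1 / (q : ℝ)) (induced W U))
    (mas k (induced W U))
  simp only [contMas] at hU e4
  linarith

end NormalizedTestability

/-! ### Homogeneity and degenerate cases. -/

section Scaling

open unitInterval

variable {k n d : ℕ}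

lemma qap_scale {a b : ℝ} (ha : 0 ≤ a) (hb : 0 ≤ b) (G J : Fin n → Fin n → ℝ) :
    qap (fun i j => a * G i j) (fun i j => b * J i j) = b * a * qap G J := by
  rw [qap_eq, qap_eq, Real.mul_iSup_of_nonneg (mul_nonneg hb ha)]
  congr 1
  ext ρ
  simp only [Finset.mul_expect]
  refine Finset.expect_congr rfl fun i _ => Finset.expect_congr rfl fun j _ => ?_
  ring

lemma mas_scale {a : ℝ} (ha : 0 ≤ a) (G : Fin n → Fin n → ℝ) :
    mas n (fun i j => a * G i j) = a * mas n G := by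
  have h := qap_scale ha zero_le_one G (fun i j => if i ≤ j then (1 : ℝ) else 0)
  simp only [one_mul] at h
  rw [mas_eq_qap, mas_eq_qap, h]

lemma contQap_scale {a b : ℝ} (ha : 0 ≤ a) (hb : 0 ≤ b) (W J : I → I → ℝ) :
    contQap (fun x y => a * W x y) (fun x y => b * J x y) = b * a * contQap W J := by
  rw [contQap, contQap, Real.mul_iSup_of_nonneg (mul_nonneg hb ha)]
  congr 1
  ext μ
  simp only [contQapAt, integral_const_mul]
  simp only [← integral_const_mul]
  refine integral_congr_ae (Eventually.of_forall fun i => integral_congr_ae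
    (Eventually.of_forall fun j => ?_))
  simp only [integral_const_mul]
  ring

lemma contMas_scale {a : ℝ} (ha : 0 ≤ a) (W : I → I → ℝ) :
    contMas (fun x y => a * W x y) = a * contMas W := by
  have h := contQap_scale ha zero_le_one W (fun x y => if x ≤ y then (1 : ℝ) else 0)
  simp only [one_mul] at h
  rw [contMas, contMas, h]

lemma stepGraphon_scale (a : ℝ) (G : Fin n → Fin n → ℝ) :
    stepGraphon (fun i j => a * G i j) = fun x y => a * stepGraphon G x y := by
  ext x y
  simp only [stepGraphon, Finset.mul_sum, mul_ite, mul_zero]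

lemma fixedQap_scale {a b : ℝ} (ha : 0 ≤ a) (hb : 0 ≤ b) (J : I → I → ℝ) (G : Fin n → Fin n → ℝ) :
    fixedQap (fun x y => b * J x y) n (fun i j => a * G i j) = b * a * fixedQap J n G := by
  rw [fixedQap, stepGraphon_scale, contQap_scale ha hb, fixedQap]

/-- Normalization of a bounded array. -/
lemma exists_normalized {V : Type} [MeasurableSpace V] [Nonempty V] {W : V → V → ℝ} {M : ℝ}
    (hM : ∀ x y, |W x y| ≤ M) : 0 ≤ M ∧ ∃ W' : V → V → ℝ, (W = fun x y => M * W' x y) ∧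
      (∀ x y, |W' x y| ≤ 1) ∧ (Measurable (Function.uncurry W) → Measurable (Function.uncurry W')) ∧
      (∀ d, IsGeometric d W → IsGeometric d W') := by
  obtain ⟨v⟩ := ‹Nonempty V›
  have hM0 : 0 ≤ M := (abs_nonneg _).trans (hM v v)
  refine ⟨hM0, fun x y => M⁻¹ * W x y, ?_, fun x y => ?_, fun h => h.const_mul M⁻¹, ?_⟩
  · ext x y
    -- If the bound is zero then so is the array, and the identity holds despite the inverse of zero
    -- being zero.
    rcases hM0.eq_or_lt with h | h
    · have := hM x y
      rw [← h] at this
      rw [← h, abs_nonpos_iff.mp this]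
      simp
    · field_simp
  · rw [abs_mul, abs_of_nonneg (inv_nonneg.mpr hM0), ← div_eq_inv_mul]
    exact div_le_one_of_le₀ (hM x y) hM0
  · rintro d ⟨p, hp, e, he⟩
    refine ⟨p, hp, fun v => M⁻¹ • e v, fun i j => ?_⟩
    beta_reduce
    rw [dist_smul₀, he, Real.norm_of_nonneg (inv_nonneg.mpr hM0)]

lemma abs_apply_le_norm (G : Fin n → Fin n → ℝ) (i j : Fin n) : |G i j| ≤ ‖G‖ :=
  (norm_le_pi_norm (G i) j).trans (norm_le_pi_norm G i)

lemma eq_zero_of_isGeometric_zero {V : Type} {J : V → V → ℝ} (hJ : IsGeometric 0 J) :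
    J = fun _ _ => 0 := by
  obtain ⟨p, hp, e, he⟩ := hJ
  ext i j
  rw [he, Subsingleton.elim (e i) (e j), dist_self]

lemma qap_zero_right (G : Fin n → Fin n → ℝ) : qap G (fun _ _ => 0) = 0 := by
  simp [qap]

lemma contQap_zero_right (W : I → I → ℝ) : contQap W (fun _ _ => 0) = 0 := by
  simp [contQap, contQapAt]

end Scaling

/-! ### The sample size function and its growth. -/

section Rate

/-- The sample size function for `d`-dimensional geometric arrays. -/
def geomRate (d : ℕ) (ε : ℝ) : ℕ :=
  ⌈sampleBound ((5 * d / (min ε (1 / 2) / 180)) ^ d) (min ε (1 / 2) / 180)⌉₊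

lemma measurable_geomRate (d : ℕ) : Measurable (geomRate d) := by
  refine Nat.measurable_ceil.comp ?_
  unfold sampleBound
  fun_prop

lemma hasRate_geomRate {d : ℕ} (hd : 0 < d) : HasRate (geomRate d) (2 * d + 4) := by
  refine ⟨measurable_geomRate d, ?_⟩
  have hd1 : (1 : ℝ) ≤ d := by exact_mod_cast hd
  set a : ℝ := 900 * d with ha
  have ha1 : 1 ≤ a := by rw [ha]; linarith
  have hloga : 0 ≤ Real.log a := Real.log_nonneg ha1
  -- Chosen so that 1 + d(log a + L) ≤ C₁ L once L ≥ 1/2, which holds for ε < 1/2. The final 2 in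
  -- `C` absorbs the rounding of the ceiling.
  set C₁ : ℝ := 2 + 2 * d * Real.log a + d with hC₁
  set C : ℝ := 4 * 180 ^ 5 * a ^ d * C₁ + 8 * 180 ^ 4 * a ^ (2 * d) + 2 with hC
  refine IsBigO.of_bound C ?_
  have hev : ∀ᶠ ε : ℝ in 𝓝[>] 0, ε < 1 / 2 := nhdsWithin_le_nhds (gt_mem_nhds (by norm_num))
  filter_upwards [hev, self_mem_nhdsWithin] with ε hε hε0
  have hε0 : 0 < ε := hε0
  set y : ℝ := 1 / ε with hy
  have hy2 : 2 ≤ y := by rw [hy, le_one_div (by norm_num) hε0]; exact hε.le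
  have hy0 : 0 < y := by linarith
  have hy1 : 1 ≤ y := by linarith
  set L : ℝ := Real.log y with hL
  have hL2 : 1 / 2 ≤ L := by
    have h1 : Real.log 2 ≤ L := Real.log_le_log (by norm_num) hy2
    linarith [Real.log_two_gt_d9]
  have hεy : ε = 1 / y := by rw [hy, one_div_one_div]
  have hx : min ε (1 / 2) / 180 = 1 / (180 * y) := by
    rw [min_eq_left hε.le, hεy]; field_simp
  have hQ : 5 * d / (1 / (180 * y)) = a * y := by rw [ha]; field_simp; norm_num
  have hpow : ∀ m : ℕ, m ≤ 2 * d + 4 → y ^ m ≤ y ^ (2 * d + 4) := fun m hm =>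
    pow_le_pow_right₀ hy1 hm
  have hlogQ : Real.log ((a * y) ^ d) = d * (Real.log a + L) := by
    rw [Real.log_pow, Real.log_mul (by positivity) (by positivity)]
  have hC₁L : 1 + d * (Real.log a + L) ≤ C₁ * L := by
    have : 0 ≤ d * Real.log a := by positivity
    rw [hC₁]
    nlinarith
  have hC₁0 : 0 ≤ C₁ := by positivity
  have hL0 : 0 ≤ L := by linarith
  have hmain : sampleBound ((a * y) ^ d) (1 / (180 * y))
      ≤ (4 * 180 ^ 5 * a ^ d * C₁ + 8 * 180 ^ 4 * a ^ (2 * d)) * (L * y ^ (2 * d + 4)) := by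
    rw [sampleBound, hlogQ, add_mul]
    refine add_le_add ?_ ?_
    · calc 4 * (a * y) ^ d * (1 + d * (Real.log a + L)) / (1 / (180 * y)) ^ 5
          = 4 * 180 ^ 5 * a ^ d * ((1 + d * (Real.log a + L)) * y ^ (d + 5)) := by
            rw [mul_pow, pow_add]; field_simp
        _ ≤ 4 * 180 ^ 5 * a ^ d * ((C₁ * L) * y ^ (2 * d + 4)) := by
            -- Here d + 5 ≤ 2d + 4, which is where d ≥ 1 enters.
            exact mul_le_mul_of_nonneg_left (mul_le_mul hC₁L (hpow (d + 5) (by omega))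
              (by positivity) (by positivity)) (by positivity)
        _ = _ := by ring
    · calc 4 * ((a * y) ^ d) ^ 2 / (1 / (180 * y)) ^ 4
          = 8 * 180 ^ 4 * a ^ (2 * d) * (1 / 2 * y ^ (2 * d + 4)) := by
            rw [← pow_mul, mul_comm d 2, mul_pow, pow_add]; field_simp; norm_num
        _ ≤ _ := by gcongr
  rw [geomRate, hx, hQ, Real.norm_of_nonneg (Nat.cast_nonneg _), Real.norm_of_nonneg (by positivity)]
  have h1 : 1 ≤ y ^ (2 * d + 4) := one_le_pow₀ hy1
  have hS0 : 0 ≤ sampleBound ((a * y) ^ d) (1 / (180 * y)) := by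
    have : 0 ≤ Real.log ((a * y) ^ d) := by rw [hlogQ]; positivity
    unfold sampleBound
    positivity
  have h2 := (Nat.ceil_lt_add_one hS0).le
  rw [hC, add_mul]
  nlinarith

/-- The factor 180 covers the accumulated errors of all the normalized statements, and 69 their
failure probabilities. Capping ε at 1/2 keeps x ≤ 1. -/
lemma geomRate_spec {d : ℕ} {ε : ℝ} (hε : 0 < ε) (hd : 0 < d) {k : ℕ} (hk : geomRate d ε ≤ k) :
    ∃ x : ℝ, 0 < x ∧ x ≤ 1 ∧ 180 * x ≤ ε ∧ 69 * x < ε ∧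
      sampleBound ((5 * d / x) ^ d) x ≤ k ∧ 0 < k := by
  have hm : 0 < min ε (1 / 2) := lt_min hε (by norm_num)
  have hm1 : min ε (1 / 2) ≤ ε := min_le_left _ _
  have hm2 : min ε (1 / 2) ≤ 1 / 2 := min_le_right _ _
  have hd1 : (1 : ℝ) ≤ d := by exact_mod_cast hd
  set x : ℝ := min ε (1 / 2) / 180 with hx
  have hx0 : 0 < x := by positivity
  have hx1 : x ≤ 1 := by linarith
  have hbd : sampleBound ((5 * d / x) ^ d) x ≤ k := Nat.ceil_le.mp hk
  refine ⟨x, hx0, hx1, by linarith, by linarith, hbd, ?_⟩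
  have h1 : 1 ≤ (5 * d / x) ^ d := one_le_pow₀ (by rw [one_le_div hx0]; linarith)
  have h2 : 0 ≤ Real.log ((5 * d / x) ^ d) := Real.log_nonneg h1
  have h3 : 0 < sampleBound ((5 * d / x) ^ d) x := by unfold sampleBound; positivity
  exact_mod_cast h3.trans_le hbd

end Rate

/-! ### Removing the normalization, and the case d = 0. -/

section Testability

open unitInterval

variable {k n d : ℕ}

/-- Monotonicity alone is used, so neither event has to be measurable. -/
lemma volume_lt_of_measureReal_le {Ω : Type*} [MeasureSpace Ω]
    [IsProbabilityMeasure (volume : Measure Ω)] {A A' : Set Ω} (h : A ⊆ A') {y ε : ℝ}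
    (hA : (volume : Measure Ω).real A' ≤ y) (hy : y < ε) :
    volume A < ENNReal.ofReal ε := by
  have hε : 0 < ε := lt_of_le_of_lt (measureReal_nonneg.trans hA) hy
  refine (measure_mono h).trans_lt ?_
  rw [← ofReal_measureReal, ENNReal.ofReal_lt_ofReal_iff hε]
  exact hA.trans_lt hy

lemma lt_of_scaled_lt {ε x c u v : ℝ} (hc : 0 ≤ c) (hx : 180 * x ≤ ε)
    (h : ε * c < |c * u - c * v|) : 180 * x < |u - v| := by
  rw [← mul_sub, abs_mul, abs_of_nonneg hc, mul_comm] at h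
  exact hx.trans_lt (lt_of_mul_lt_mul_left h hc)

lemma isContQapTestable_geomRate (hd : 0 < d) : IsContQapTestable (geomRate d) d := by
  intro ε hε k hk W J M N hW hM hJm hN hJ
  obtain ⟨x, hx, hx1, hxε, hxε', hbd, hk0⟩ := geomRate_spec hε hd hk
  obtain ⟨hM0, W', rfl, hW1, hWm, -⟩ := exists_normalized hM
  obtain ⟨hN0, J', rfl, hJ1, hJm', hJg⟩ := exists_normalized hN
  refine volume_lt_of_measureReal_le (fun s hs => ?_)
    (measureReal_contQap_le hd hx hx1 hbd hk0 (hWm hW) hW1 (hJm' hJm) hJ1 (hJg d hJ)) hxε'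
  simp only [Set.mem_ofPred_eq] at hs ⊢
  refine lt_of_scaled_lt (mul_nonneg hN0 hM0) hxε ?_
  rw [← contQap_scale hM0 hN0, ← qap_scale hM0 hN0, ← mul_assoc]
  exact hs

lemma isDiscreteQapTestable_geomRate (hd : 0 < d) : IsDiscreteQapTestable (geomRate d) d := by
  intro ε hε k n hk hkn G J hJ
  obtain ⟨x, hx, hx1, hxε, hxε', hbd, hk0⟩ := geomRate_spec hε hd hk
  have : Nonempty (Fin n) := ⟨⟨0, by omega⟩⟩
  obtain ⟨hM0, G', hG, hG1, -, -⟩ := exists_normalized (abs_apply_le_norm G)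
  obtain ⟨hN0, J', hJ', hJ1, -, hJg⟩ := exists_normalized (abs_apply_le_norm J)
  generalize ‖G‖ = M at *
  generalize ‖J‖ = N at *
  subst hG hJ'
  refine (unifProb_mono fun s hs => ?_).trans_lt
    ((unifProb_qap_le hd hx hx1 hbd hk0 hkn hG1 hJ1 (hJg d hJ)).trans_lt (by linarith))
  simp only [Set.mem_ofPred_eq] at hs ⊢
  refine lt_of_scaled_lt (mul_nonneg hN0 hM0) hxε ?_
  rw [← qap_scale hM0 hN0, ← qap_scale hM0 hN0, ← mul_assoc]
  exact hs

lemma isGraphTestable_fixedQap (hd : 0 < d) {J : I → I → ℝ} {N : ℝ}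
    (hJm : Measurable (Function.uncurry J)) (hN : ∀ x y, |J x y| ≤ N) (hJ : IsGeometric d J) :
    IsGraphTestable (geomRate d) N (fixedQap J) := by
  intro ε hε k n hk hkn G
  obtain ⟨x, hx, hx1, hxε, hxε', hbd, hk0⟩ := geomRate_spec hε hd hk
  have : Nonempty (Fin n) := ⟨⟨0, by omega⟩⟩
  obtain ⟨hM0, G', hG, hG1, -, -⟩ := exists_normalized (abs_apply_le_norm G)
  obtain ⟨hN0, J', rfl, hJ1, hJm', hJg⟩ := exists_normalized hN
  generalize ‖G‖ = M at *
  subst hG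
  refine (unifProb_mono fun s hs => ?_).trans_lt
    ((unifProb_fixedQap_le hd hx hx1 hbd hkn hG1 (hJm' hJm) hJ1 (hJg d hJ)).trans_lt (by linarith))
  simp only [Set.mem_ofPred_eq] at hs ⊢
  refine lt_of_scaled_lt (mul_nonneg hN0 hM0) hxε ?_
  rw [← fixedQap_scale hM0 hN0, ← fixedQap_scale hM0 hN0, ← mul_assoc]
  exact hs

lemma isGraphonTestable_fixedQap (hd : 0 < d) {J : I → I → ℝ} {N : ℝ}
    (hJm : Measurable (Function.uncurry J)) (hN : ∀ x y, |J x y| ≤ N) (hJ : IsGeometric d J) :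
    IsGraphonTestable (geomRate d) N (fun W => contQap W J) (fixedQap J) := by
  intro ε hε k hk W M hW hM
  obtain ⟨x, hx, hx1, hxε, hxε', hbd, hk0⟩ := geomRate_spec hε hd hk
  obtain ⟨hM0, W', rfl, hW1, hWm, -⟩ := exists_normalized hM
  obtain ⟨hN0, J', rfl, hJ1, hJm', hJg⟩ := exists_normalized hN
  refine volume_lt_of_measureReal_le (fun s hs => ?_)
    (measureReal_fixedQap_le hd hx hx1 hbd (hWm hW) hW1 (hJm' hJm) hJ1 (hJg d hJ)) hxε'
  simp only [Set.mem_ofPred_eq] at hs ⊢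
  refine lt_of_scaled_lt (mul_nonneg hN0 hM0) hxε ?_
  rw [← contQap_scale hM0 hN0, ← fixedQap_scale hM0 hN0, ← mul_assoc]
  exact hs

lemma isGraphTestable_mas : IsGraphTestable (geomRate 1) 1 mas := by
  intro ε hε k n hk hkn G
  obtain ⟨x, hx, hx1, hxε, hxε', hbd, hk0⟩ := geomRate_spec hε one_pos hk
  have : Nonempty (Fin n) := ⟨⟨0, by omega⟩⟩
  obtain ⟨hM0, G', hG, hG1, -, -⟩ := exists_normalized (abs_apply_le_norm G)
  generalize ‖G‖ = M at *
  subst hG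
  refine (unifProb_mono fun s hs => ?_).trans_lt
    ((unifProb_mas_le hx hx1 hbd hkn hG1).trans_lt (by linarith))
  simp only [Set.mem_ofPred_eq, mul_one] at hs ⊢
  refine lt_of_scaled_lt hM0 hxε ?_
  rw [← mas_scale hM0, ← mas_scale hM0]
  exact hs

lemma isGraphonTestable_contMas : IsGraphonTestable (geomRate 1) 1 contMas mas := by
  intro ε hε k hk W M hW hM
  obtain ⟨x, hx, hx1, hxε, hxε', hbd, hk0⟩ := geomRate_spec hε one_pos hk
  obtain ⟨hM0, W', rfl, hW1, hWm, -⟩ := exists_normalized hM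
  refine volume_lt_of_measureReal_le (fun s hs => ?_)
    (measureReal_contMas_le hx hx1 hbd (hWm hW) hW1) hxε'
  simp only [Set.mem_ofPred_eq, mul_one] at hs ⊢
  refine lt_of_scaled_lt hM0 hxε ?_
  rw [← contMas_scale hM0, ← mas_scale hM0]
  exact hs

lemma isContQapTestable_zero (β : ℝ → ℕ) : IsContQapTestable β 0 := by
  intro ε hε k _ W J M N _ hM _ hN hJ
  have hM0 : 0 ≤ M := (abs_nonneg _).trans (hM 0 0)
  have hN0 : 0 ≤ N := (abs_nonneg _).trans (hN 0 0)
  rw [eq_zero_of_isGeometric_zero hJ]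
  have h : ¬ ε * N * M < 0 := not_lt.mpr (by positivity)
  have h' : ∀ s : Fin k → I, induced (fun _ _ : I => (0 : ℝ)) s = fun _ _ => 0 := fun _ => rfl
  simpa [contQap_zero_right, qap_zero_right, h', h] using hε

lemma isDiscreteQapTestable_zero (β : ℝ → ℕ) : IsDiscreteQapTestable β 0 := by
  intro ε hε k n _ _ G J hJ
  rw [eq_zero_of_isGeometric_zero hJ]
  have h' : ∀ s : Fin k → Fin n, induced (fun _ _ : Fin n => (0 : ℝ)) s = fun _ _ => 0 :=
    fun _ => rfl
  have h : ¬ ε * ‖(fun _ _ => 0 : Fin n → Fin n → ℝ)‖ * ‖G‖ < 0 := not_lt.mpr (by positivity)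
  simpa only [qap_zero_right, h', sub_self, abs_zero, h, Set.ofPred_false, unifProb,
    Set.ncard_empty, Nat.cast_zero, zero_div] using hε

lemma isGraphTestable_fixedQap_zero (β : ℝ → ℕ) {J : I → I → ℝ} {N : ℝ}
    (hN : ∀ x y, |J x y| ≤ N) (hJ : IsGeometric 0 J) : IsGraphTestable β N (fixedQap J) := by
  intro ε hε k n _ _ G
  have hN0 : 0 ≤ N := (abs_nonneg _).trans (hN 0 0)
  rw [eq_zero_of_isGeometric_zero hJ]
  have h : ¬ ε * N * ‖G‖ < 0 := not_lt.mpr (by positivity)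
  simpa [fixedQap, contQap_zero_right, h, unifProb] using hε

lemma isGraphonTestable_fixedQap_zero (β : ℝ → ℕ) {J : I → I → ℝ} {N : ℝ}
    (hN : ∀ x y, |J x y| ≤ N) (hJ : IsGeometric 0 J) :
    IsGraphonTestable β N (fun W => contQap W J) (fixedQap J) := by
  intro ε hε k _ W M _ hM
  have hM0 : 0 ≤ M := (abs_nonneg _).trans (hM 0 0)
  have hN0 : 0 ≤ N := (abs_nonneg _).trans (hN 0 0)
  rw [eq_zero_of_isGeometric_zero hJ]
  have h : ¬ ε * N * M < 0 := not_lt.mpr (by positivity)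
  simpa [fixedQap, contQap_zero_right, h] using hε

end Testability

end GeomQAP

end

theorem corollary5p6 :
    (∀ d : ℕ, ∃ β : ℝ → ℕ, GeomQAP.HasRate β (2 * d + 4) ∧
      GeomQAP.IsContQapTestable β d ∧
      GeomQAP.IsDiscreteQapTestable β d ∧
      (∀ (J : unitInterval → unitInterval → ℝ) (N : ℝ), Measurable (Function.uncurry J) →
        (∀ x y, |J x y| ≤ N) → GeomQAP.IsGeometric d J →
        GeomQAP.IsGraphTestable β N (GeomQAP.fixedQap J) ∧
        GeomQAP.IsGraphonTestable β N (fun W => GeomQAP.contQap W J) (GeomQAP.fixedQap J))) ∧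
    (∃ β : ℝ → ℕ, GeomQAP.HasRate β 6 ∧
      GeomQAP.IsGraphTestable β 1 GeomQAP.mas ∧
      GeomQAP.IsGraphonTestable β 1 GeomQAP.contMas GeomQAP.mas) := by
  refine ⟨fun d => ?_, ⟨GeomQAP.geomRate 1, GeomQAP.hasRate_geomRate one_pos,
    GeomQAP.isGraphTestable_mas, GeomQAP.isGraphonTestable_contMas⟩⟩
  rcases Nat.eq_zero_or_pos d with rfl | hd
  -- In dimension 0 all distances vanish, so `J` and every value are zero and no samples are needed.
  · exact ⟨fun _ => 0, ⟨measurable_const, by simpa using Asymptotics.isBigO_zero _ _⟩,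
      GeomQAP.isContQapTestable_zero _, GeomQAP.isDiscreteQapTestable_zero _,
      fun J N _ hN hJ => ⟨GeomQAP.isGraphTestable_fixedQap_zero _ hN hJ,
        GeomQAP.isGraphonTestable_fixedQap_zero _ hN hJ⟩⟩
  · exact ⟨GeomQAP.geomRate d, GeomQAP.hasRate_geomRate hd, GeomQAP.isContQapTestable_geomRate hd,
      GeomQAP.isDiscreteQapTestable_geomRate hd, fun J N hJm hN hJ =>
        ⟨GeomQAP.isGraphTestable_fixedQap hd hJm hN hJ,
          GeomQAP.isGraphonTestable_fixedQap hd hJm hN hJ⟩⟩
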